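/- For $n\ge 1$ let $\mathcal D_n$ be the set of sequences $(D(1),\dots,D(n))$ that are the degree sequence of some tree with node set $\{1,\dots,n\}$. For each $n$ let $\mathbf D_n$ be a random element of $\mathcal D_n$ that is exchangeable, i.e. $(\mathbf D_n(i))_{i=1}^n$ and $(\mathbf D_n(\sigma(i)))_{i=1}^n$ have the same law for every permutation $\sigma$ of $\{1,\dots,n\}$. Let $\mathbf T(\mathbf D_n)$ be the random tree on $\{1,\dots,n\}$ which, given $\mathbf D_n$, is uniformly distributed among the labeled trees with degree sequence $\mathbf D_n$. For a graph $G$, a node $v$ and $R\ge 0$, let $B_G(v,R)$ be the subgraph induced by the nodes at distance at most $R$ from $v$, rooted at $v$. For a finite rooted graph $F$ let $p(R,F,U(G))$ be the proportion of the nodes $v$ of the finite graph $G$ for which $B_G(v,R)$ is isomorphic to $F$ as a rooted graph. An infinite random rooted tree is a probability measure $\mu$ on the set of countably infinite, connected, locally finite rooted trees, with the $\sigma$-algebra generated by the events that the $R$-ball around the root is rooted isomorphic to $F$; let $p(R,F,\mu)$ be the probability of this event. We say that $\mathbf T(\mathbf D_n)$ converges to $\mu$ if for every integer $R\ge 1$,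 every finite rooted graph $F$ and every $\varepsilon>0$, $$\lim_{n\to\infty}\mathbb P\bigl(|p(R,F,U(\mathbf T(\mathbf D_n)))-p(R,F,\mu)|>\varepsilon\bigr)=0 .$$ For a random infinite sequence $\mathbf D=(\mathbf D(i))_{i\ge1}$ we write $\mathbf D_n\to\mathbf D$ if for every $k$ the vector $(\mathbf D_n(i))_{i=1}^k$ converges in distribution to $(\mathbf D(i))_{i=1}^k$ as $n\to\infty$. **Theorem.** There is an infinite random rooted tree $\mu$ to which $\mathbf T(\mathbf D_n)$ converges if and only if $\mathbf D_n\to\mathbf D$ for an infinite sequence $\mathbf D$ of independent random variables with the same law as some $\mathbb N$-valued random variable $\mathbf D_0$ with $\mathbb E(\mathbf D_0)=2$. In that case, for every $R\ge1$ and every finite rooted tree $F$ in which the largest distance from the root is $R$, the limit $\mu$ satisfies $$p(R,F,\mu)=\frac{t_R}{|\mathrm{Aut}(F)|}\prod_{i\in V(F)\setminus F_R}\mathbb P(\mathbf D_0=d_i)\,(d_i-1)!,$$ where $F_R$ is the set of nodes of $F$ at distance $R$ from the root, $t_R=|F_R|$, $d_i$ is the degree of the node $i$ in $F$, and $\mathrm{Aut}(F)$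 is the group of automorphisms of $F$ that fix the root. -/

import Mathlib

open MeasureTheory ProbabilityTheory Filter Topology
open scoped ENNReal Nat

noncomputable section

namespace RandomTreeLimit

/-- A graph on the vertex set `V` with a distinguished root. -/
structure RootedGraph (V : Type) where
  graph : SimpleGraph V
  root : V

namespace RootedGraph

variable {V W : Type}

/-- Existence of a graph isomorphism that maps the root to the root. -/
def Isomorphic (G : RootedGraph V) (H : RootedGraph W) : Prop :=
  ∃ f : G.graph ≃g H.graph, f G.root = H.root

/-- The number of automorphisms that fix the root. -/
def numAut (F : RootedGraph V) : ℕ :=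
  Nat.card {f : F.graph ≃g F.graph // f F.root = F.root}

/-- The set of vertices at distance exactly `R` from the root
(`edist` is infinite between different components). -/
def level (F : RootedGraph V) (R : ℕ) : Set V :=
  {u | F.graph.edist F.root u = R}

/-- `F` is a rooted tree in which the largest distance from the root is `R`. -/
def IsDeepTree (F : RootedGraph V) (R : ℕ) : Prop :=
  F.graph.IsTree ∧ (∀ u, F.graph.edist F.root u ≤ R) ∧ (F.level R).Nonempty

end RootedGraph

/-- The degree of a vertex (only used for locally finite graphs). -/
def deg {V : Type} (G : SimpleGraph V) (v : V) : ℕ := (G.neighborSet v).ncard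

/-- The rooted `R`-ball around `v`: the subgraph induced on the vertices at distance
at most `R` from `v`, rooted at `v`. -/
def ball {V : Type} (G : SimpleGraph V) (v : V) (R : ℕ) :
    RootedGraph {u : V // G.edist v u ≤ R} where
  graph := G.comap Subtype.val
  root := ⟨v, by simp⟩

/-- The proportion of the vertices of a finite graph `G` whose `R`-ball is rooted isomorphic
to `F`. -/
def nbhdStat {V W : Type} (R : ℕ) (F : RootedGraph W) (G : SimpleGraph V) : ℝ :=
  ({v : V | (ball G v R).Isomorphic F}.ncard : ℝ) / (Nat.card V : ℝ)

/-- A (countably) infinite, connected, locally finite rooted tree. -/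
structure InfRootedTree extends RootedGraph ℕ where
  isTree : graph.IsTree
  locallyFinite : ∀ v, (graph.neighborSet v).Finite

/-- The set of infinite rooted trees whose `R`-ball around the root is rooted isomorphic
to `F`. -/
def nbhdEvent {W : Type} (R : ℕ) (F : RootedGraph W) : Set InfRootedTree :=
  {T | (ball T.graph T.root R).Isomorphic F}

/-- The sigma-algebra generated by the neighbourhood events. -/
instance : MeasurableSpace InfRootedTree :=
  MeasurableSpace.generateFrom
    {s | ∃ (R m : ℕ) (F : RootedGraph (Fin m)), s = nbhdEvent R F}

/-- The labeled trees on `n` nodes with degree sequence `d`. -/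
def treesWithDegrees {n : ℕ} (d : Fin n → ℕ) : Set (SimpleGraph (Fin n)) :=
  {T | T.IsTree ∧ ∀ i, deg T i = d i}

/-- The set of the degree sequences of the labeled trees on `n` nodes. -/
def treeDegSeqs (n : ℕ) : Set (Fin n → ℕ) := {d | (treesWithDegrees d).Nonempty}

/-- The uniform distribution on the labeled trees with degree sequence `d`. -/
def uniformTree {n : ℕ} (d : treeDegSeqs n) : PMF (SimpleGraph (Fin n)) :=
  PMF.uniformOfFinset (Set.toFinite (treesWithDegrees d.1)).toFinset
    ((Set.Finite.toFinset_nonempty _).2 d.2)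

/-- The law of the random tree `T(D)`, where `D` is a random degree sequence with law `ν`:
given `D`, the tree is uniform among the labeled trees with degree sequence `D`. -/
def randomTree {n : ℕ} (ν : PMF (treeDegSeqs n)) : PMF (SimpleGraph (Fin n)) :=
  ν.bind uniformTree

/-- The law of a random degree sequence is invariant under permutations of the nodes. -/
def Exchangeable {n : ℕ} (ν : PMF (treeDegSeqs n)) : Prop :=
  ∀ σ : Equiv.Perm (Fin n),
    ν.map (fun d => fun i => d.1 (σ i)) = ν.map (fun d => d.1)

/-- The first `k` entries of a sequence of length `n` (padded by zeros if `n < k`). -/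
def initial {n : ℕ} (k : ℕ) (d : Fin n → ℕ) : Fin k → ℕ :=
  fun i => if h : i.1 < n then d ⟨i.1, h⟩ else 0

/-- Let `ν n` be the law of a random degree sequence on `n + 1` nodes. It converges to the
infinite random sequence with law `D` if for every `k` the first `k` entries converge in
distribution to the first `k` entries of the limit. -/
def DegSeqTendsto (ν : ∀ n : ℕ, PMF (treeDegSeqs (n + 1)))
    (D : Measure (ℕ → ℕ)) [IsProbabilityMeasure D] : Prop :=
  ∀ k : ℕ, TendstoInDistribution
    (fun (n : ℕ) (d : treeDegSeqs (n + 1)) => initial k d.1) atTop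
    (fun (x : ℕ → ℕ) (i : Fin k) => x i) (fun n => (ν n).toMeasure) D

/-- The law of an infinite sequence of independent random variables with law `q`. -/
def iidLaw (q : PMF ℕ) : Measure (ℕ → ℕ) := Measure.infinitePi (fun _ : ℕ => q.toMeasure)

instance (q : PMF ℕ) : IsProbabilityMeasure (iidLaw q) := by
  unfold iidLaw; infer_instance

/-- The expectation of a random variable with law `q`, possibly infinite. -/
def mean (q : PMF ℕ) : ℝ≥0∞ := ∫⁻ d, (d : ℝ≥0∞) ∂q.toMeasure

/-- Let `τ n` be the law of a random graph on `n + 1` nodes. Its random weak limit is the random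
infinite rooted tree with law `ρ` if all the neighbourhood statistics converge in probability to
those of `ρ`. -/
def RandomWeakLimit (τ : ∀ n : ℕ, PMF (SimpleGraph (Fin (n + 1))))
    (ρ : Measure InfRootedTree) : Prop :=
  ∀ ε : ℝ, 0 < ε → ∀ R : ℕ, 0 < R → ∀ (m : ℕ) (F : RootedGraph (Fin m)),
    Tendsto
      (fun n => (τ n).toMeasure {G | ε < |nbhdStat R F G - ρ.real (nbhdEvent R F)|})
      atTop (𝓝 0)

open Classical in
/-- The number `|T_R| / |Aut F| * ∏ P(D₀ = d_i) (d_i - 1)!`, where `T_R` is the set of vertices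
at distance `R` from the root of `F`, the product is over the vertices `i` outside `T_R`, `d_i` is
the degree of `i` in `F`, and `q` is the law of `D₀`. -/
def limitProb (q : PMF ℕ) (R : ℕ) {m : ℕ} (F : RootedGraph (Fin m)) : ℝ :=
  ((F.level R).ncard : ℝ) / (F.numAut : ℝ) *
    ∏ i : Fin m with i ∉ F.level R,
      (q (deg F.graph i)).toReal * ((deg F.graph i - 1)! : ℝ)

end RandomTreeLimit

end

open RandomTreeLimit

open MeasureTheory ProbabilityTheory Filter Topology
open scoped ENNReal Nat

noncomputable section

namespace RandomTreeLimit

/-! ### Counting trees with prescribed degrees that contain a forest -/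

section Counting

variable {V : Type}

/-! The proof is a second moment argument that rests on an exact count. Take a forest with `N + 2`
components, let `e v` be the number of further edges prescribed at `v`, and let `E j` be the total
of `e` over the component `j`, where the `E j` add up to `2 * (N + 1)`. The number of trees that
complete the forest, times `∏ (e v)!`, is `N ! * ∏ E j` (`ncard_extensionTrees`). The empty forest
gives the number of trees with given degrees. Disjoint copies of `F` give the probability that a
uniform tree contains them (`ncard_treesWithCopies`).

An isomorphism from `F` to an `R`-ball is an injective homomorphism that preserves the degrees of
the vertices off the last level. Hence the number of balls isomorphic to `F`, times `|Aut F|`, is a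
number of copies with prescribed inner degrees. If the degree frequencies converge to `q`, summing
over all placements shows that the expected proportion of such balls tends to the stated formula. In
the second moment, pairs of disjoint copies give the square of the mean, and overlapping pairs are
negligible if the sizes of the `2 * R`-balls are tight. Tightness follows from uniform integrability
of the degrees (`tight_bigBalls`). Since the average degree is `2 - 2 / n`, uniform integrability
amounts to `q` having mean two. Chebyshev's inequality then gives concentration
(`tendsto_deviation`).

By exchangeability, the degree sequences converge to independent variables with law `q` if and only
if the proportion of entries equal to `k` tends to `q k` in probability, for every `k`
(`tendsto_freq_of_degSeqTendsto`, `degSeqTendsto_of_tendsto_freq`).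

It remains to relate limits of statistics to infinite trees. Given convergence of all statistics,
tightness prevents loss of mass, the limit laws for successive radii are compatible under
truncation, and a random compatible sequence of balls is glued to an infinite tree
(`exists_measure_of_tendsto_nbhdStat`). Conversely, degree frequencies are the statistics of stars.
All neighbours of a vertex of high degree have large `2`-balls, so the existence of a limit forces
uniform integrability, and thereby mean two (`exists_degSeqTendsto`). -/

lemma deg_eq_zero_of_adj_false [Finite V] {G : SimpleGraph V} {v : V} (h : ∀ w, ¬ G.Adj v w) :
    deg G v = 0 := by
  rw [deg, Set.ncard_eq_zero]
  ext w
  simpa using h w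

lemma deg_lt_of_adj [Finite V] {G H : SimpleGraph V} (h : G ≤ H) {v w : V} (h1 : H.Adj v w)
    (h2 : ¬ G.Adj v w) : deg G v < deg H v :=
  Set.ncard_lt_ncard (Set.ssubset_iff_of_subset (fun _ hw => h hw) |>.2 ⟨w, h1, h2⟩) (Set.toFinite _)

lemma deg_sup_edge [Finite V] {G : SimpleGraph V} {u v : V} (h : u ≠ v) (h' : ¬ G.Adj u v) (w : V)
    [Decidable (w = u ∨ w = v)] :
    deg (G ⊔ SimpleGraph.edge u v) w = deg G w + if w = u ∨ w = v then 1 else 0 := by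
  have key : ∀ a b : V, a ≠ b → ¬ G.Adj a b →
      deg (G ⊔ SimpleGraph.edge a b) a = deg G a + 1 := by
    intro a b hab hab'
    have : (G ⊔ SimpleGraph.edge a b).neighborSet a = insert b (G.neighborSet a) := by
      ext w
      simp only [SimpleGraph.mem_neighborSet, SimpleGraph.sup_adj, SimpleGraph.edge_adj,
        Set.mem_insert_iff]
      grind
    rw [deg, this, Set.ncard_insert_of_notMem (by simpa using hab') (Set.toFinite _), deg]
  split_ifs with hw
  · rcases hw with rfl | rfl
    · exact key _ _ h h'
    · rw [SimpleGraph.edge_comm]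
      exact key _ _ h.symm (fun hh => h' hh.symm)
  · have : (G ⊔ SimpleGraph.edge u v).neighborSet w = G.neighborSet w := by
      ext x
      simp only [SimpleGraph.mem_neighborSet, SimpleGraph.sup_adj, SimpleGraph.edge_adj]
      grind
    rw [deg, this, deg, add_zero]

/-- Two comparable graphs with the same degrees are equal. -/
lemma eq_of_le_of_deg_eq [Finite V] {G H : SimpleGraph V} (h : G ≤ H)
    (hd : ∀ v, deg H v = deg G v) : G = H := by
  refine le_antisymm h fun v w hvw => ?_
  by_contra h2
  exact (deg_lt_of_adj h hvw h2).ne (hd v).symm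

/-- The trees that contain `G` and have degrees `deg G + e`. -/
def extensionTrees (G : SimpleGraph V) (e : V → ℕ) : Set (SimpleGraph V) :=
  {T | T.IsTree ∧ G ≤ T ∧ ∀ i, deg T i = deg G i + e i}

lemma exists_adj_leaving {ι : Type*} {T : SimpleGraph V} (hT : T.Connected) {κ : V → ι} {i v : V}
    (hv : κ v ≠ κ i) : ∃ a b, T.Adj a b ∧ κ a = κ i ∧ κ b ≠ κ i := by
  obtain ⟨p⟩ := hT.preconnected i v
  obtain ⟨d, -, h1, h2⟩ := p.exists_boundary_dart {w | κ w = κ i} rfl hv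
  exact ⟨d.fst, d.snd, d.adj, h1, h2⟩

lemma pos_of_mem_extensionTrees [Finite V] {G T : SimpleGraph V} {e : V → ℕ}
    (hT : T ∈ extensionTrees G e) {a b : V} (h1 : T.Adj a b) (h2 : ¬ G.Adj a b) : e a ≠ 0 := by
  have := deg_lt_of_adj hT.2.1 h1 h2
  have := hT.2.2 a
  omega

/-- A component with a single free half-edge, at `i`, is joined to some free half-edge `u` of
another component. -/
lemma extensionTrees_eq_iUnion [Finite V] [DecidableEq V] {ι : Type*} {G : SimpleGraph V}
    {e : V → ℕ} {κ : V → ι}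
    (hκ : ∀ u v, G.Adj u v → κ u = κ v) {i : V} (hi : e i = 1)
    (hi' : ∀ w, κ w = κ i → w ≠ i → e w = 0) (hv : ∃ v, κ v ≠ κ i) :
    extensionTrees G e = ⋃ u ∈ {u | κ u ≠ κ i ∧ e u ≠ 0},
      extensionTrees (G ⊔ SimpleGraph.edge i u)
        (fun w => e w - if w = i ∨ w = u then 1 else 0) := by
  ext T
  simp only [Set.mem_iUnion, Set.mem_ofPred_eq, exists_prop]
  constructor
  · intro hT
    obtain ⟨v, hv⟩ := hv
    obtain ⟨a, b, hab, ha, hb⟩ := exists_adj_leaving hT.1.connected hv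
    have hG : ¬ G.Adj a b := fun h => hb ((hκ _ _ h).symm.trans ha)
    have hea := pos_of_mem_extensionTrees hT hab hG
    have heb := pos_of_mem_extensionTrees hT hab.symm (fun h => hG h.symm)
    -- The edge leaving the component uses a free half-edge at `a`, and `i` carries the only one of
    -- its component.
    have hai : a = i := by
      by_contra hne
      exact hea (hi' a ha hne)
    subst hai
    refine ⟨b, ⟨hb, heb⟩, hT.1, sup_le hT.2.1 ?_, fun w => ?_⟩
    · rw [SimpleGraph.edge_le_iff]
      exact Or.inr hab
    · rw [deg_sup_edge (by rintro rfl; exact hb rfl) hG, hT.2.2]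
      dsimp only
      split_ifs with h
      · have : e w ≠ 0 := by rcases h with rfl | rfl <;> assumption
        omega
      · omega
  · rintro ⟨u, ⟨hu, heu⟩, hT⟩
    have hG : ¬ G.Adj i u := fun h => hu (hκ _ _ h).symm
    refine ⟨hT.1, le_sup_left.trans hT.2.1, fun w => ?_⟩
    rw [hT.2.2, deg_sup_edge (by rintro rfl; exact hu rfl) hG]
    dsimp only
    split_ifs with h
    · have : e w ≠ 0 := by
        rcases h with rfl | rfl
        · omega
        · assumption
      omega
    · omega

/-- The only half-edge at `i` is spent on the edge to `u`, so a tree counted for `u` cannot contain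
the edge from `i` to `u'` as well. -/
lemma extensionTrees_pairwiseDisjoint [Finite V] [DecidableEq V] {ι : Type*} {G : SimpleGraph V}
    {e : V → ℕ} {κ : V → ι}
    (hκ : ∀ u v, G.Adj u v → κ u = κ v) {i : V} (hi : e i = 1) :
    {u | κ u ≠ κ i ∧ e u ≠ 0}.PairwiseDisjoint fun u =>
      extensionTrees (G ⊔ SimpleGraph.edge i u)
        (fun w => e w - if w = i ∨ w = u then 1 else 0) := by
  intro u hu u' hu' hne
  refine Set.disjoint_left.2 fun T hT hT' => ?_
  have hiu : i ≠ u := by rintro rfl; exact hu.1 rfl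
  have hiu' : i ≠ u' := by rintro rfl; exact hu'.1 rfl
  have h1 : T.Adj i u' := hT'.2.1 (by simp [SimpleGraph.edge_adj, hiu'])
  have h2 : ¬ (G ⊔ SimpleGraph.edge i u).Adj i u' := by
    simp only [SimpleGraph.sup_adj, SimpleGraph.edge_adj]
    rintro (h | h)
    · exact hu'.1 (hκ _ _ h).symm
    · grind
  have := pos_of_mem_extensionTrees hT h1 h2
  simp [hi] at this

lemma extensionTrees_eq_singleton [Finite V] {G : SimpleGraph V} (hG : G.IsTree) {e : V → ℕ}
    (he : ∀ i, e i = 0) : extensionTrees G e = {G} := by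
  ext T
  constructor
  · intro hT
    exact (eq_of_le_of_deg_eq hT.2.1 (fun v => by rw [hT.2.2, he, add_zero])).symm
  · rintro rfl
    exact ⟨hG, le_rfl, fun i => by rw [he, add_zero]⟩

/-- The labels of the components after the components of `i` and `u` are joined. -/
def mergeLabel {ι : Type*} [DecidableEq ι] (κ : V → ι) (i u w : V) : ι :=
  if κ w = κ i then κ u else κ w

/-- The new edge spends one half-edge at each end. The component of `i` had no other, so the merged
component has the total of the component of `u` less one, and all other totals are unchanged. -/
lemma sum_mergeLabel [Fintype V] [DecidableEq V] {ι : Type*} [DecidableEq ι] {e : V → ℕ}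
    {κ : V → ι} {i u : V} (hi : e i = 1) (hi' : ∀ w, κ w = κ i → w ≠ i → e w = 0)
    (hu : κ u ≠ κ i) (heu : e u ≠ 0) {l : ι} (hl : l ≠ κ i) :
    (∑ w with mergeLabel κ i u w = l, (e w - if w = i ∨ w = u then 1 else 0)) +
      (if l = κ u then 1 else 0) = ∑ w with κ w = l, e w := by
  have h : (if l = κ u then 1 else 0) =
      ∑ w, if w = u then (if l = κ u then 1 else 0) else 0 := by simp
  rw [h, Finset.sum_filter, Finset.sum_filter, ← Finset.sum_add_distrib]
  refine Finset.sum_congr rfl fun w _ => ?_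
  have := hi' w
  simp only [mergeLabel]
  grind

lemma image_mergeLabel [Fintype V] {ι : Type*} [DecidableEq ι] {κ : V → ι} {i u : V}
    (hu : κ u ≠ κ i) :
    Finset.univ.image (mergeLabel κ i u) = (Finset.univ.image κ).erase (κ i) := by
  ext l
  simp only [Finset.mem_image, Finset.mem_univ, true_and, Finset.mem_erase, mergeLabel]
  constructor
  · rintro ⟨w, rfl⟩
    split_ifs with h
    · exact ⟨hu, u, rfl⟩
    · exact ⟨h, w, rfl⟩
  · rintro ⟨h, w, rfl⟩
    exact ⟨w, if_neg h⟩

lemma mergeLabel_eq_of_adj {ι : Type*} [DecidableEq ι] {G : SimpleGraph V} {κ : V → ι} {i u : V}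
    (hκ : ∀ u v, G.Adj u v → κ u = κ v) (a b : V)
    (hab : (G ⊔ SimpleGraph.edge i u).Adj a b) : mergeLabel κ i u a = mergeLabel κ i u b := by
  simp only [SimpleGraph.sup_adj, SimpleGraph.edge_adj] at hab
  simp only [mergeLabel]
  rcases hab with h | ⟨⟨rfl, rfl⟩ | ⟨rfl, rfl⟩, -⟩
  · rw [hκ a b h]
  · simp
  · simp

lemma reachable_of_mergeLabel_eq {ι : Type*} [DecidableEq ι] {G : SimpleGraph V} {κ : V → ι}
    {i u : V} (hκ : ∀ u v, κ u = κ v → G.Reachable u v) (hiu : i ≠ u) (a b : V)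
    (hab : mergeLabel κ i u a = mergeLabel κ i u b) :
    (G ⊔ SimpleGraph.edge i u).Reachable a b := by
  have hm : ∀ {x y}, κ x = κ y → (G ⊔ SimpleGraph.edge i u).Reachable x y :=
    fun h => (hκ _ _ h).mono le_sup_left
  have he : (G ⊔ SimpleGraph.edge i u).Reachable i u :=
    SimpleGraph.Adj.reachable (by simp [SimpleGraph.edge_adj, hiu])
  simp only [mergeLabel] at hab
  split_ifs at hab with h1 h2 h2
  · exact hm (h1.trans h2.symm)
  · exact (hm h1).trans (he.trans (hm hab))
  · exact (hm hab).trans (he.symm.trans (hm h2.symm))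
  · exact hm hab

lemma ncard_extensionTrees_eq_sum [Fintype V] [DecidableEq V] {ι : Type*} [DecidableEq ι]
    {G : SimpleGraph V} {e : V → ℕ} {κ : V → ι}
    (hκ : ∀ u v, G.Adj u v → κ u = κ v) {i : V} (hi : e i = 1)
    (hi' : ∀ w, κ w = κ i → w ≠ i → e w = 0) (hv : ∃ v, κ v ≠ κ i) :
    (extensionTrees G e).ncard = ∑ u with κ u ≠ κ i ∧ e u ≠ 0,
      (extensionTrees (G ⊔ SimpleGraph.edge i u)
        (fun w => e w - if w = i ∨ w = u then 1 else 0)).ncard := by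
  rw [extensionTrees_eq_iUnion hκ hi hi' hv, Set.Finite.ncard_biUnion (Set.toFinite _)
    (fun _ _ => Set.toFinite _) (extensionTrees_pairwiseDisjoint hκ hi),
    ← finsum_mem_coe_finset]
  simp

lemma extensionTrees_eq_empty [Finite V] {ι : Type*} {G : SimpleGraph V} {e : V → ℕ} {κ : V → ι}
    (hκ : ∀ u v, G.Adj u v → κ u = κ v) {i : V} (hi : ∀ w, κ w = κ i → e w = 0)
    (hv : ∃ v, κ v ≠ κ i) : extensionTrees G e = ∅ := by
  refine Set.eq_empty_iff_forall_notMem.2 fun T hT => ?_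
  obtain ⟨v, hv⟩ := hv
  obtain ⟨a, b, hab, ha, hb⟩ := exists_adj_leaving hT.1.connected hv
  exact pos_of_mem_extensionTrees hT hab (fun h => hb ((hκ _ _ h).symm.trans ha)) (hi a ha)

/-- If the labels are at least two and the total of `e` is less than twice their number, then some
label has total `0` or exactly one half-edge. -/
lemma exists_label_sum_le_one [Fintype V] {ι : Type*} [DecidableEq ι] {e : V → ℕ} {κ : V → ι}
    {N : ℕ} (hN : (Finset.univ.image κ).card = N + 2) (he : ∑ v, e v = 2 * (N + 1)) :
    ∃ i, ∑ v with κ v = κ i, e v ≤ 1 := by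
  by_contra! h
  have h1 : ∑ j ∈ Finset.univ.image κ, ∑ v with κ v = j, e v = ∑ v, e v :=
    Finset.sum_fiberwise_of_maps_to (fun v hv => Finset.mem_image_of_mem κ hv) e
  have h2 : (Finset.univ.image κ).card • 2 ≤ ∑ j ∈ Finset.univ.image κ, ∑ v with κ v = j, e v := by
    refine Finset.card_nsmul_le_sum _ _ _ fun j hj => ?_
    obtain ⟨i, -, rfl⟩ := Finset.mem_image.1 hj
    exact h i
  rw [hN, h1, he, smul_eq_mul] at h2
  omega

lemma prod_factorial_sub [Fintype V] [DecidableEq V] {e : V → ℕ} {i u : V} (hi : e i = 1)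
    (hiu : i ≠ u) (heu : e u ≠ 0) :
    ∏ w, (e w)! = (∏ w, (e w - if w = i ∨ w = u then 1 else 0)!) * e u := by
  rw [← Finset.prod_ite_eq' Finset.univ u (fun _ => e u) |>.trans (if_pos (Finset.mem_univ u)),
    ← Finset.prod_mul_distrib]
  refine Finset.prod_congr rfl fun w _ => ?_
  by_cases h1 : w = i
  · subst h1
    simp [hi, hiu]
  by_cases h2 : w = u
  · subst h2
    simp only [or_true, if_true]
    rw [mul_comm, Nat.mul_factorial_pred heu]
  · simp [h1, h2]

/-- Only the factor at `k` changes, from `E k` to `E k - 1`; cross-multiplication avoids a quotient.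
-/
lemma prod_label_sub_mul {ι : Type*} [DecidableEq ι] {s : Finset ι} {k : ι} (hk : k ∈ s)
    (E E' : ι → ℕ) (h : ∀ l ∈ s, E' l + (if l = k then 1 else 0) = E l) :
    (∏ l ∈ s, E' l) * E k = (E k - 1) * ∏ l ∈ s, E l := by
  rw [← Finset.mul_prod_erase s E' hk, ← Finset.mul_prod_erase s E hk]
  have h1 : E' k = E k - 1 := by have := h k hk; simp at this; omega
  have h2 : ∏ l ∈ s.erase k, E' l = ∏ l ∈ s.erase k, E l :=
    Finset.prod_congr rfl fun l hl => by
      have := h l (Finset.mem_of_mem_erase hl)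
      simpa [Finset.ne_of_mem_erase hl] using this
  rw [h1, h2]
  ring

/-- A vertex `u` contributes the share `e u / E (κ u)` of the weight of its label, and the shares
within one component add up to one. -/
lemma sum_eq_sum_label_weight [Fintype V] {ι : Type*} [DecidableEq ι] {e a : V → ℕ}
    {κ : V → ι} {i : V} (W E : ι → ℕ) (hE : ∀ l, E l = ∑ v with κ v = l, e v)
    (hpos : ∀ u, E (κ u) ≠ 0)
    (h : ∀ u, κ u ≠ κ i → e u ≠ 0 → a u * E (κ u) = W (κ u) * e u) :
    ∑ u with κ u ≠ κ i ∧ e u ≠ 0, a u = ∑ l ∈ (Finset.univ.image κ).erase (κ i), W l := by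
  rw [← Finset.sum_fiberwise_of_maps_to (t := (Finset.univ.image κ).erase (κ i)) (g := κ)]
  · refine Finset.sum_congr rfl fun l hl => ?_
    obtain ⟨hne, hl⟩ := Finset.mem_erase.1 hl
    obtain ⟨u, -, rfl⟩ := Finset.mem_image.1 hl
    refine Nat.eq_of_mul_eq_mul_right (Nat.pos_of_ne_zero (hpos u)) ?_
    rw [Finset.sum_mul]
    conv_rhs => rw [hE, Finset.mul_sum]
    rw [Finset.filter_filter, Finset.sum_filter, Finset.sum_filter]
    refine Finset.sum_congr rfl fun w _ => ?_
    by_cases hw : κ w = κ u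
    · by_cases hew : e w = 0
      · simp [hew]
      · simp only [hw, hew, hne, ne_eq, not_false_eq_true, and_self, if_true]
        rw [← hw]
        exact h w (hw ▸ hne) hew
    · simp [hw]
  · intro u hu
    simp only [Finset.mem_filter, Finset.mem_univ, true_and] at hu
    simp [hu.1]

lemma exists_unique_half_edge [Fintype V] [DecidableEq V] {ι : Type*} [DecidableEq ι] {e : V → ℕ}
    {κ : V → ι} {i₀ : V} (h : ∑ v with κ v = κ i₀, e v = 1) :
    ∃ i, κ i = κ i₀ ∧ e i = 1 ∧ ∀ w, κ w = κ i → w ≠ i → e w = 0 := by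
  obtain ⟨i, hi, hne⟩ := Finset.exists_ne_zero_of_sum_ne_zero (by rw [h]; exact one_ne_zero)
  simp only [Finset.mem_filter, Finset.mem_univ, true_and] at hi
  rw [← Finset.add_sum_erase _ _ (by simp [hi] : i ∈ Finset.univ.filter fun v => κ v = κ i₀)] at h
  have h0 : ∑ x ∈ (Finset.univ.filter fun v => κ v = κ i₀).erase i, e x = 0 := by omega
  refine ⟨i, hi, by omega, fun w hw hwi => Finset.sum_eq_zero_iff.1 h0 w ?_⟩
  simp [hwi, hw, hi]

lemma isTree_sup_edge {ι : Type*} [DecidableEq ι] {G : SimpleGraph V} {κ : V → ι} {i u : V}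
    (hG : G.IsAcyclic) (h2 : ∀ u v, κ u = κ v → G.Reachable u v)
    (hu : κ u ≠ κ i) (hr : ¬ G.Reachable i u) (hall : ∀ w, κ w = κ i ∨ κ w = κ u) :
    (G ⊔ SimpleGraph.edge i u).IsTree := by
  refine ⟨?_, SimpleGraph.IsAcyclic.sup_edge_of_not_reachable hr hG⟩
  have : Nonempty V := ⟨i⟩
  refine ⟨fun a b => reachable_of_mergeLabel_eq h2 (by rintro rfl; exact hu rfl) a b ?_⟩
  simp only [mergeLabel]
  have := hall a
  have := hall b
  grind

lemma label_eq_of_reachable {ι : Type*} {G : SimpleGraph V} {κ : V → ι}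
    (h1 : ∀ u v, G.Adj u v → κ u = κ v) {u v : V} (h : G.Reachable u v) : κ u = κ v := by
  obtain ⟨p⟩ := h
  induction p with
  | nil => rfl
  | cons h _ ih => exact (h1 _ _ h).trans ih

/-- The number of trees with prescribed degrees that contain a given forest. The components of the
forest are the fibres of `κ`. -/
theorem ncard_extensionTrees [Fintype V] [DecidableEq V] {ι : Type*} [DecidableEq ι] (N : ℕ) :
    ∀ (G : SimpleGraph V) (e : V → ℕ) (κ : V → ι), G.IsAcyclic →
      (∀ u v, G.Adj u v → κ u = κ v) → (∀ u v, κ u = κ v → G.Reachable u v) →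
      (Finset.univ.image κ).card = N + 2 → ∑ v, e v = 2 * (N + 1) →
      (extensionTrees G e).ncard * ∏ v, (e v)! =
        N ! * ∏ j ∈ Finset.univ.image κ, ∑ v with κ v = j, e v := by
  induction N using Nat.strong_induction_on with
  | _ N ih =>
    intro G e κ hG h1 h2 hN he
    have hv : ∀ i, ∃ v, κ v ≠ κ i := by
      intro i
      obtain ⟨j, hj, hne⟩ := Finset.exists_mem_ne (by omega : 1 < (Finset.univ.image κ).card) (κ i)
      obtain ⟨v, -, rfl⟩ := Finset.mem_image.1 hj
      exact ⟨v, hne⟩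
    set E : ι → ℕ := fun l => ∑ v with κ v = l, e v with hE
    -- A component without free half-edges cannot be joined to the others, so both sides vanish.
    by_cases hzero : ∃ i, E (κ i) = 0
    · obtain ⟨i, hi⟩ := hzero
      rw [extensionTrees_eq_empty h1 (i := i) (fun w hw => ?_) (hv i), Set.ncard_empty, zero_mul,
        Finset.prod_eq_zero (Finset.mem_image_of_mem κ (Finset.mem_univ i)) hi, mul_zero]
      exact Finset.sum_eq_zero_iff.1 hi w (by simpa using hw)
    push Not at hzero
    obtain ⟨i₀, hi₀⟩ := exists_label_sum_le_one hN he
    have hEi : E (κ i₀) = 1 := le_antisymm hi₀ (Nat.pos_of_ne_zero (hzero i₀))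
    obtain ⟨i, hii, hi, hi'⟩ := exists_unique_half_edge hEi
    rw [← hii] at hEi
    clear hii hi₀ i₀
    have hiR : κ i ∈ Finset.univ.image κ := Finset.mem_image_of_mem κ (Finset.mem_univ i)
    have hP : ∏ l ∈ (Finset.univ.image κ).erase (κ i), E l = ∏ l ∈ Finset.univ.image κ, E l := by
      rw [← Finset.mul_prod_erase (Finset.univ.image κ) E hiR, hEi, one_mul]
    have hcard : ((Finset.univ.image κ).erase (κ i)).card = N + 1 := by
      rw [Finset.card_erase_of_mem hiR, hN]
      rfl
    have hsum : ∑ l ∈ (Finset.univ.image κ).erase (κ i), E l = 2 * N + 1 := by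
      have h3 : ∑ l ∈ Finset.univ.image κ, E l = ∑ v, e v :=
        Finset.sum_fiberwise_of_maps_to (fun v hv => Finset.mem_image_of_mem κ hv) e
      rw [← Finset.add_sum_erase _ _ hiR, hEi] at h3
      omega
    have hiu : ∀ u, κ u ≠ κ i → i ≠ u := by rintro u hu rfl; exact hu rfl
    have hr : ∀ u, κ u ≠ κ i → ¬ G.Reachable i u :=
      fun u hu h => hu (label_eq_of_reachable h1 h).symm
    have hsum' : ∀ u, κ u ≠ κ i → e u ≠ 0 →
        (∑ w, (e w - if w = i ∨ w = u then 1 else 0)) = 2 * N := by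
      intro u hu heu
      rw [Finset.sum_tsub_distrib, he, Finset.sum_boole]
      · have : (Finset.univ.filter fun w => w = i ∨ w = u) = {i, u} := by ext; simp
        rw [this, Finset.card_pair (hiu u hu)]
        simp; omega
      · intro w _
        split_ifs with h
        · rcases h with rfl | rfl <;> omega
        · exact Nat.zero_le _
    rw [ncard_extensionTrees_eq_sum h1 hi hi' (hv i), Finset.sum_mul]
    -- With two components, one half-edge each, the join is already the only tree. Otherwise a join
    -- leaves one component fewer and the induction hypothesis applies.
    rcases N with _ | N
    · rw [sum_eq_sum_label_weight (e := e) (κ := κ) (i := i) 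
        (fun _ => ∏ l ∈ Finset.univ.image κ, E l) E (fun _ => rfl) hzero]
      · simp [hcard]
      · intro u hu heu
        have hsing : (Finset.univ.image κ).erase (κ i) = {κ u} := by
          obtain ⟨k, hk⟩ := Finset.card_eq_one.1 hcard
          have : κ u ∈ (Finset.univ.image κ).erase (κ i) := by simp [hu]
          rw [hk, Finset.mem_singleton] at this
          rw [hk, this]
        have hEu : E (κ u) = 1 := by simpa [hsing] using hsum
        have hall : ∀ w, κ w = κ i ∨ κ w = κ u := by
          intro w
          by_cases hw : κ w = κ i
          · exact Or.inl hw
          · have : κ w ∈ (Finset.univ.image κ).erase (κ i) := by simp [hw]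
            rw [hsing, Finset.mem_singleton] at this
            exact Or.inr this
        have he0 := Finset.sum_eq_zero_iff.1 (hsum' u hu heu)
        rw [extensionTrees_eq_singleton (isTree_sup_edge hG h2 hu (hr u hu) hall)
          (fun w => he0 w (Finset.mem_univ _)), Set.ncard_singleton, one_mul,
          prod_factorial_sub hi (hiu u hu) heu, ← hP, hsing, Finset.prod_singleton,
          Finset.prod_eq_one (fun w _ => by rw [he0 w (Finset.mem_univ _), Nat.factorial_zero]),
          one_mul, mul_comm]
    · rw [sum_eq_sum_label_weight (e := e) (κ := κ) (i := i)
        (fun k => (E k - 1) * (N ! * ∏ l ∈ Finset.univ.image κ, E l)) E (fun _ => rfl) hzero]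
      -- The `N + 2` remaining labels have total `2 * N + 3`, so the numbers `E k - 1` add up to `N
      -- + 1`, the factor that turns `N !` into `(N + 1)!`.
      · rw [← Finset.sum_mul, Finset.sum_tsub_distrib, hsum]
        · simp only [Finset.sum_const, hcard, smul_eq_mul, mul_one, Nat.factorial_succ]
          rw [← mul_assoc]
          congr 2
          omega
        · intro l hl
          obtain ⟨u, -, rfl⟩ := Finset.mem_image.1 (Finset.mem_of_mem_erase hl)
          exact Nat.pos_of_ne_zero (hzero u)
      · intro u hu heu
        have h3 := ih N (Nat.lt_succ_self N) (G ⊔ SimpleGraph.edge i u)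
          (fun w => e w - if w = i ∨ w = u then 1 else 0) (mergeLabel κ i u)
          (SimpleGraph.IsAcyclic.sup_edge_of_not_reachable (hr u hu) hG)
          (mergeLabel_eq_of_adj h1) (reachable_of_mergeLabel_eq h2 (hiu u hu))
          (by rw [image_mergeLabel hu, hcard]) (hsum' u hu heu)
        have h4 := prod_label_sub_mul (s := (Finset.univ.image κ).erase (κ i)) (k := κ u)
          (by simp [hu]) E
          (fun l => ∑ w with mergeLabel κ i u w = l, (e w - if w = i ∨ w = u then 1 else 0))
          (fun l hl => sum_mergeLabel hi hi' hu heu (Finset.ne_of_mem_erase hl))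
        rw [hP] at h4
        rw [image_mergeLabel hu] at h3
        rw [prod_factorial_sub hi (hiu u hu) heu, ← mul_assoc, h3]
        linear_combination (N ! * e u) * h4

end Counting

/-! ### Disjoint copies of a finite tree as a forest -/

section Copies

variable {V W ι : Type}

/-- The graph on `V` that consists of disjoint copies of `F`, placed by `Φ`. -/
def copies (F : SimpleGraph W) (Φ : ι × W ↪ V) : SimpleGraph V where
  Adj x y := ∃ a i j, F.Adj i j ∧ Φ (a, i) = x ∧ Φ (a, j) = y
  symm := ⟨by rintro x y ⟨a, i, j, h, rfl, rfl⟩; exact ⟨a, j, i, h.symm, rfl, rfl⟩⟩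
  loopless := ⟨by
    rintro x ⟨a, i, j, h, rfl, h'⟩
    have := Φ.injective h'
    simp only [Prod.mk.injEq, true_and] at this
    exact h.ne this.symm⟩

lemma copies_adj_apply {F : SimpleGraph W} {Φ : ι × W ↪ V} {a : ι} {i : W} {y : V} :
    (copies F Φ).Adj (Φ (a, i)) y ↔ ∃ j, F.Adj i j ∧ Φ (a, j) = y := by
  constructor
  · rintro ⟨b, i', j, h, h', rfl⟩
    have := Φ.injective h'
    simp only [Prod.mk.injEq] at this
    obtain ⟨rfl, rfl⟩ := this
    exact ⟨j, h, rfl⟩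
  · rintro ⟨j, h, rfl⟩
    exact ⟨a, i, j, h, rfl, rfl⟩

lemma copies_le_iff {F : SimpleGraph W} {Φ : ι × W ↪ V} {T : SimpleGraph V} :
    copies F Φ ≤ T ↔ ∀ a i j, F.Adj i j → T.Adj (Φ (a, i)) (Φ (a, j)) := by
  constructor
  · exact fun h a i j hij => h ⟨a, i, j, hij, rfl, rfl⟩
  · rintro h x y ⟨a, i, j, hij, rfl, rfl⟩
    exact h a i j hij

lemma deg_copies_apply (F : SimpleGraph W) (Φ : ι × W ↪ V) (a : ι) (i : W) :
    deg (copies F Φ) (Φ (a, i)) = deg F i := by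
  have : (copies F Φ).neighborSet (Φ (a, i)) = (fun j => Φ (a, j)) '' F.neighborSet i := by
    ext y
    simp [copies_adj_apply]
  rw [deg, this, Set.ncard_image_of_injective _ (fun j k h => by simpa using Φ.injective h), deg]

lemma deg_copies_of_notMem [Finite V] (F : SimpleGraph W) (Φ : ι × W ↪ V) {x : V}
    (hx : x ∉ Set.range Φ) : deg (copies F Φ) x = 0 :=
  deg_eq_zero_of_adj_false (by rintro w ⟨a, i, j, -, rfl, -⟩; exact hx ⟨_, rfl⟩)

/-- A walk cannot leave the copy in which it starts. A detour around an edge of a copy would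
therefore project to a detour around an edge of `F`, where every edge is a bridge. -/
lemma isAcyclic_copies {F : SimpleGraph W} (hF : F.IsAcyclic) (Φ : ι × W ↪ V) :
    (copies F Φ).IsAcyclic := by
  rw [SimpleGraph.isAcyclic_iff_forall_adj_isBridge]
  rintro _ _ ⟨a, i, j, hij, rfl, rfl⟩
  rw [SimpleGraph.isBridge_iff]
  intro h
  have key : ∀ z, ((copies F Φ).deleteEdges {s(Φ (a, i), Φ (a, j))}).Reachable (Φ (a, i)) z →
      ∃ k, Φ (a, k) = z ∧ (F.deleteEdges {s(i, j)}).Reachable i k := by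
    intro z hz
    rw [SimpleGraph.reachable_iff_reflTransGen] at hz
    induction hz with
    | refl => exact ⟨i, rfl, SimpleGraph.Reachable.refl _⟩
    | tail _ hbc ih =>
      obtain ⟨k, rfl, hk⟩ := ih
      rw [SimpleGraph.deleteEdges_adj] at hbc
      obtain ⟨l, hkl, rfl⟩ := copies_adj_apply.1 hbc.1
      refine ⟨l, rfl, hk.trans (SimpleGraph.Adj.reachable ?_)⟩
      rw [SimpleGraph.deleteEdges_adj]
      refine ⟨hkl, fun h' => hbc.2 ?_⟩
      rw [Set.mem_singleton_iff] at h' ⊢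
      rcases Sym2.eq_iff.1 h' with ⟨rfl, rfl⟩ | ⟨rfl, rfl⟩
      · rfl
      · exact Sym2.eq_swap
  obtain ⟨k, hk, hr⟩ := key _ h
  have := Φ.injective hk
  simp only [Prod.mk.injEq, true_and] at this
  subst this
  exact SimpleGraph.isBridge_iff.1 (SimpleGraph.isAcyclic_iff_forall_adj_isBridge.1 hF hij) hr

open Classical in
/-- The components of `copies F Φ`: a copy is labeled by the image of `r`, another vertex by
itself. -/
def copyLabel (Φ : ι × W ↪ V) (r : W) (x : V) : V :=
  if h : ∃ p, Φ p = x then Φ (h.choose.1, r) else x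

lemma copyLabel_apply (Φ : ι × W ↪ V) (r : W) (a : ι) (i : W) :
    copyLabel Φ r (Φ (a, i)) = Φ (a, r) := by
  have h : ∃ p, Φ p = Φ (a, i) := ⟨_, rfl⟩
  rw [copyLabel, dif_pos h, Φ.injective h.choose_spec]

lemma copyLabel_of_notMem (Φ : ι × W ↪ V) (r : W) {x : V} (hx : x ∉ Set.range Φ) :
    copyLabel Φ r x = x := dif_neg hx

lemma copyLabel_eq_of_adj {F : SimpleGraph W} {Φ : ι × W ↪ V} (r : W) (x y : V)
    (h : (copies F Φ).Adj x y) : copyLabel Φ r x = copyLabel Φ r y := by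
  obtain ⟨a, i, j, -, rfl, rfl⟩ := h
  rw [copyLabel_apply, copyLabel_apply]

lemma reachable_copies {F : SimpleGraph W} (hF : F.Connected) (Φ : ι × W ↪ V) (a : ι) (i j : W) :
    (copies F Φ).Reachable (Φ (a, i)) (Φ (a, j)) :=
  (hF.preconnected i j).map
    (⟨fun k => Φ (a, k), fun {k l} h => ⟨a, k, l, h, rfl, rfl⟩⟩ : F →g copies F Φ)

lemma reachable_of_copyLabel_eq {F : SimpleGraph W} (hF : F.Connected) {Φ : ι × W ↪ V} (r : W)
    (x y : V) (h : copyLabel Φ r x = copyLabel Φ r y) : (copies F Φ).Reachable x y := by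
  by_cases hx : x ∈ Set.range Φ <;> by_cases hy : y ∈ Set.range Φ
  · obtain ⟨⟨a, i⟩, rfl⟩ := hx
    obtain ⟨⟨b, j⟩, rfl⟩ := hy
    rw [copyLabel_apply, copyLabel_apply] at h
    have := Φ.injective h
    simp only [Prod.mk.injEq, and_true] at this
    subst this
    exact reachable_copies hF Φ a i j
  · obtain ⟨⟨a, i⟩, rfl⟩ := hx
    rw [copyLabel_apply, copyLabel_of_notMem Φ r hy] at h
    exact absurd ⟨_, h⟩ hy
  · obtain ⟨⟨a, i⟩, rfl⟩ := hy
    rw [copyLabel_apply, copyLabel_of_notMem Φ r hx] at h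
    exact absurd ⟨_, h.symm⟩ hx
  · rw [copyLabel_of_notMem Φ r hx, copyLabel_of_notMem Φ r hy] at h
    rw [h]

variable [Fintype V] [DecidableEq V] [Fintype W] [Fintype ι] 

lemma prod_eq_prod_range_mul {M : Type*} [CommMonoid M] {P : Type*} [Fintype P] (Φ : P ↪ V)
    (f : V → M) : ∏ x, f x = (∏ x ∈ (Finset.univ.map Φ)ᶜ, f x) * ∏ p, f (Φ p) := by
  rw [← Finset.prod_compl_mul_prod (Finset.univ.map Φ), Finset.prod_map]

lemma notMem_range_of_mem {P : Type*} [Fintype P] {Φ : P ↪ V} {x : V}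
    (hx : x ∈ (Finset.univ.map Φ)ᶜ) : x ∉ Set.range Φ := by
  simpa using hx

lemma image_copyLabel [DecidableEq ι] (Φ : ι × W ↪ V) (r : W) :
    Finset.univ.image (copyLabel Φ r) =
      (Finset.univ.map Φ)ᶜ ∪ Finset.univ.image fun a => Φ (a, r) := by
  ext y
  simp only [Finset.mem_image, Finset.mem_univ, true_and, Finset.mem_union, Finset.mem_compl,
    Finset.mem_map]
  constructor
  · rintro ⟨x, rfl⟩
    by_cases hx : x ∈ Set.range Φ
    · obtain ⟨⟨a, i⟩, rfl⟩ := hx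
      exact Or.inr ⟨a, (copyLabel_apply ..).symm⟩
    · rw [copyLabel_of_notMem Φ r hx]
      exact Or.inl hx
  · rintro (h | ⟨a, rfl⟩)
    · exact ⟨y, copyLabel_of_notMem Φ r h⟩
    · exact ⟨Φ (a, r), copyLabel_apply ..⟩

lemma disjoint_compl_image (Φ : ι × W ↪ V) (r : W) :
    Disjoint (Finset.univ.map Φ)ᶜ (Finset.univ.image fun a => Φ (a, r)) := by
  rw [Finset.disjoint_right]
  intro x hx
  obtain ⟨a, -, rfl⟩ := Finset.mem_image.1 hx
  simp

/-- Each copy is one component and so is each vertex outside the copies; the additive form avoids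
truncated subtraction. -/
lemma card_image_copyLabel [DecidableEq ι] (Φ : ι × W ↪ V) (r : W) :
    (Finset.univ.image (copyLabel Φ r)).card + Fintype.card ι * Fintype.card W =
      Fintype.card V + Fintype.card ι := by
  rw [image_copyLabel, Finset.card_union_of_disjoint (disjoint_compl_image Φ r),
    Finset.card_image_of_injective _ (fun a b h => by simpa using Φ.injective h),
    Finset.card_compl, Finset.card_map, Finset.card_univ, Finset.card_univ, Fintype.card_prod]
  have := Fintype.card_le_of_embedding Φ
  rw [Fintype.card_prod] at this
  omega

lemma prod_image_copyLabel [DecidableEq ι] (Φ : ι × W ↪ V) (r : W) (e : V → ℕ) :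
    ∏ l ∈ Finset.univ.image (copyLabel Φ r), ∑ x with copyLabel Φ r x = l, e x =
      (∏ x ∈ (Finset.univ.map Φ)ᶜ, e x) * ∏ a, ∑ i, e (Φ (a, i)) := by
  rw [image_copyLabel, Finset.prod_union (disjoint_compl_image Φ r),
    Finset.prod_image (fun a _ b _ h => by simpa using Φ.injective h)]
  congr 1
  · refine Finset.prod_congr rfl fun x hx => ?_
    have hx := notMem_range_of_mem hx
    have : (Finset.univ.filter fun y => copyLabel Φ r y = x) = {x} := by
      ext y
      simp only [Finset.mem_filter, Finset.mem_univ, true_and, Finset.mem_singleton]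
      constructor
      · intro h
        by_cases hy : y ∈ Set.range Φ
        · obtain ⟨⟨a, i⟩, rfl⟩ := hy
          rw [copyLabel_apply] at h
          exact absurd ⟨_, h⟩ hx
        · rwa [copyLabel_of_notMem Φ r hy] at h
      · rintro rfl
        exact copyLabel_of_notMem Φ r hx
    rw [this, Finset.sum_singleton]
  · refine Finset.prod_congr rfl fun a _ => ?_
    have : (Finset.univ.filter fun y => copyLabel Φ r y = Φ (a, r)) =
        Finset.univ.image fun i => Φ (a, i) := by
      ext y
      simp only [Finset.mem_filter, Finset.mem_univ, true_and, Finset.mem_image]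
      constructor
      · intro h
        by_cases hy : y ∈ Set.range Φ
        · obtain ⟨⟨b, i⟩, rfl⟩ := hy
          rw [copyLabel_apply] at h
          have := Φ.injective h
          simp only [Prod.mk.injEq, and_true] at this
          exact ⟨i, by rw [this]⟩
        · rw [copyLabel_of_notMem Φ r hy] at h
          exact absurd ⟨_, h.symm⟩ hy
      · rintro ⟨i, rfl⟩
        exact copyLabel_apply ..
    rw [this, Finset.sum_image (fun i _ j _ h => by simpa using Φ.injective h)]

end Copies

/-! ### Counting trees that contain given copies -/

section CopyCount

lemma deg_eq_degree {V : Type} (G : SimpleGraph V) (v : V) [Fintype (G.neighborSet v)] :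
    deg G v = G.degree v := by
  rw [deg, Set.ncard_eq_toFinset_card']
  rfl

lemma sum_deg_isTree {V : Type} [Fintype V] {T : SimpleGraph V} (hT : T.IsTree) :
    ∑ v, deg T v + 2 = 2 * Fintype.card V := by
  classical
  simp_rw [deg_eq_degree, SimpleGraph.sum_degrees_eq_twice_card_edges]
  rw [← hT.card_edgeFinset]
  ring

lemma one_le_deg_isTree {V : Type} [Finite V] [Nontrivial V] {T : SimpleGraph V} (hT : T.IsTree)
    (v : V) : 1 ≤ deg T v := by
  obtain ⟨w, hw⟩ := hT.connected.preconnected.exists_adj_of_nontrivial v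
  exact (Set.ncard_pos (Set.toFinite _)).2 ⟨w, hw⟩

variable {n : ℕ}

lemma sum_treeDegSeqs {d : Fin n → ℕ} (hd : d ∈ treeDegSeqs n) : ∑ i, d i + 2 = 2 * n := by
  obtain ⟨T, hT, h⟩ := hd
  simpa [h] using sum_deg_isTree hT

lemma one_le_treeDegSeqs (hn : 2 ≤ n) {d : Fin n → ℕ} (hd : d ∈ treeDegSeqs n) (i : Fin n) :
    1 ≤ d i := by
  obtain ⟨T, hT, h⟩ := hd
  have : Nontrivial (Fin n) := Fin.nontrivial_iff_two_le.2 hn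
  rw [← h]
  exact one_le_deg_isTree hT i

lemma extensionTrees_bot (d : Fin n → ℕ) : extensionTrees ⊥ d = treesWithDegrees d := by
  ext T
  have : ∀ i : Fin n, deg (⊥ : SimpleGraph (Fin n)) i = 0 :=
    fun i => deg_eq_zero_of_adj_false (by simp)
  simp [extensionTrees, treesWithDegrees, this]

lemma prod_factorial_eq {V : Type} (s : Finset V) {d : V → ℕ} (hd : ∀ i, 1 ≤ d i) :
    ∏ i ∈ s, (d i)! = (∏ i ∈ s, (d i - 1)!) * ∏ i ∈ s, d i := by
  rw [← Finset.prod_mul_distrib]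
  exact Finset.prod_congr rfl fun i _ => by
    rw [mul_comm, Nat.mul_factorial_pred (Nat.pos_iff_ne_zero.1 (hd i))]

/-- The number of labeled trees with a given degree sequence. -/
theorem ncard_treesWithDegrees (hn : 2 ≤ n) {d : Fin n → ℕ} (hd : d ∈ treeDegSeqs n) :
    (treesWithDegrees d).ncard * ∏ i, (d i - 1)! = (n - 2)! := by
  have h1 := one_le_treeDegSeqs hn hd
  -- Every vertex is a component of its own. Cancelling `∏ d i` turns the factorials of `d i` into
  -- those of `d i - 1`.
  have h := ncard_extensionTrees (n - 2) ⊥ d (id : Fin n → Fin n) SimpleGraph.isAcyclic_bot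
    (fun u v h => by simp at h) (fun u v h => by rw [id, id] at h; rw [h])
    (by rw [Finset.image_id, Finset.card_univ, Fintype.card_fin]; omega)
    (by have := sum_treeDegSeqs hd; omega)
  rw [extensionTrees_bot, prod_factorial_eq _ h1, ← mul_assoc, Finset.image_id] at h
  have h2 : ∏ j, ∑ v with id v = j, d v = ∏ i, d i :=
    Finset.prod_congr rfl fun j _ => by
      simp only [id]
      rw [Finset.sum_filter, Finset.sum_ite_eq' Finset.univ j d, if_pos (Finset.mem_univ j)]
  rw [h2] at h
  exact Nat.eq_of_mul_eq_mul_right (Finset.prod_pos fun i _ => h1 i) h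

variable {W ι : Type} [Fintype W] [Fintype ι]

/-- The labeled trees with degree sequence `d` that contain the copies `Φ` of `F`. -/
def treesWithCopies (F : SimpleGraph W) (Φ : ι × W ↪ Fin n) (d : Fin n → ℕ) :
    Set (SimpleGraph (Fin n)) :=
  {T | T ∈ treesWithDegrees d ∧ copies F Φ ≤ T}

/-- The number of labeled trees with a given degree sequence that contain given disjoint copies of
a tree `F`, where the vertices of `F` in `I` have no further neighbours, and the others are
leaves of `F`. -/
theorem ncard_treesWithCopies [DecidableEq W] (hn : 2 ≤ n) {d : Fin n → ℕ} (hd : d ∈ treeDegSeqs n)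
    {F : SimpleGraph W} (hF : F.IsTree) (I : Finset W) (hI : ∀ i ∉ I, deg F i = 1)
    (Φ : ι × W ↪ Fin n) (hΦ : ∀ a, ∀ i ∈ I, d (Φ (a, i)) = deg F i) {N : ℕ}
    (hN : N + 2 + Fintype.card ι * Fintype.card W = n + Fintype.card ι) :
    (treesWithCopies F Φ d).ncard * (n - 2)! = (treesWithDegrees d).ncard * (N ! *
      (∏ i ∈ I, (deg F i - 1)!) ^ Fintype.card ι *
        ∏ a, ∑ i ∈ Iᶜ, (d (Φ (a, i)) - 1)) := by
  classical
  have h1 := one_le_treeDegSeqs hn hd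
  obtain ⟨r⟩ := hF.connected.nonempty
  have hdeg : ∀ x, deg (copies F Φ) x ≤ d x := by
    intro x
    by_cases hx : x ∈ Set.range Φ
    · obtain ⟨⟨a, i⟩, rfl⟩ := hx
      rw [deg_copies_apply]
      by_cases hi : i ∈ I
      · exact (hΦ a i hi).ge
      · rw [hI i hi]
        exact h1 _
    · rw [deg_copies_of_notMem F Φ hx]
      exact Nat.zero_le _
  set e : Fin n → ℕ := fun x => d x - deg (copies F Φ) x with he
  have hS : treesWithCopies F Φ d = extensionTrees (copies F Φ) e := by
    ext T
    simp only [treesWithCopies, extensionTrees, treesWithDegrees, Set.mem_ofPred_eq, he,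
      Nat.add_sub_cancel' (hdeg _)]
    tauto
  have he1 : ∀ a, ∀ i ∈ I, e (Φ (a, i)) = 0 := fun a i hi => by
    rw [he]; dsimp only; rw [deg_copies_apply, hΦ a i hi, Nat.sub_self]
  have he2 : ∀ a, ∀ i ∉ I, e (Φ (a, i)) = d (Φ (a, i)) - 1 := fun a i hi => by
    rw [he]; dsimp only; rw [deg_copies_apply, hI i hi]
  have he3 : ∀ x ∈ (Finset.univ.map Φ)ᶜ, e x = d x := fun x hx => by
    rw [he]; dsimp only; rw [deg_copies_of_notMem F Φ (notMem_range_of_mem hx), Nat.sub_zero]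
  -- The prescribed degrees add up to `2 * n - 2`, of which each copy uses `2 * card W - 2`.
  have hsum : ∑ x, e x = 2 * (N + 1) := by
    have h3 : ∑ x, deg (copies F Φ) x = Fintype.card ι * ∑ i, deg F i := by
      rw [← Finset.sum_compl_add_sum (Finset.univ.map Φ), Finset.sum_map, Fintype.sum_prod_type,
        Finset.sum_eq_zero (fun x hx => deg_copies_of_notMem F Φ (notMem_range_of_mem hx))]
      simp [deg_copies_apply]
    have h4 := sum_deg_isTree hF
    have h5 := sum_treeDegSeqs hd
    rw [he, Finset.sum_tsub_distrib _ (fun x _ => hdeg x), h3]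
    zify [show Fintype.card ι * ∑ i, deg F i ≤ ∑ i, d i from
      h3 ▸ Finset.sum_le_sum fun x _ => hdeg x]
    zify at h4 h5 hN
    linear_combination h5 - 2 * hN - Fintype.card ι * h4
  have hc := card_image_copyLabel Φ r
  rw [Fintype.card_fin] at hc
  have h := ncard_extensionTrees N (copies F Φ) e (copyLabel Φ r) (isAcyclic_copies hF.2 Φ)
    (copyLabel_eq_of_adj r) (reachable_of_copyLabel_eq hF.connected r) (by omega) hsum
  rw [← hS, prod_image_copyLabel, Finset.prod_congr rfl he3] at h
  have h2 : ∀ a, ∑ i, e (Φ (a, i)) = ∑ i ∈ Iᶜ, (d (Φ (a, i)) - 1) := fun a => by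
    rw [← Finset.sum_compl_add_sum I, Finset.sum_eq_zero (he1 a), add_zero]
    exact Finset.sum_congr rfl fun i hi => he2 a i (Finset.mem_compl.1 hi)
  simp_rw [h2] at h
  -- Comparison with the factorials in the count of all trees: a vertex in `I` has `e = 0` and lacks
  -- the factor `(deg F i - 1)!`, a leaf of a copy has `e = d - 1`, and a vertex outside has `d! =
  -- (d - 1)! * d`.
  have h3 : (∏ x, (e x)!) * (∏ i ∈ I, (deg F i - 1)!) ^ Fintype.card ι =
      (∏ x, (d x - 1)!) * ∏ x ∈ (Finset.univ.map Φ)ᶜ, d x := by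
    rw [prod_eq_prod_range_mul Φ, prod_eq_prod_range_mul Φ (fun x => (d x - 1)!),
      Finset.prod_congr rfl (fun x hx => by rw [he3 x hx]), prod_factorial_eq _ h1,
      Fintype.prod_prod_type, Fintype.prod_prod_type, ← Finset.card_univ, ← Finset.prod_const]
    have : (∏ a, ∏ i, (e (Φ (a, i)))!) * ∏ a : ι, ∏ i ∈ I, (deg F i - 1)! =
        ∏ a, ∏ i, (d (Φ (a, i)) - 1)! := by
      rw [← Finset.prod_mul_distrib]
      refine Finset.prod_congr rfl fun a _ => ?_
      rw [← Finset.prod_compl_mul_prod I, ← Finset.prod_compl_mul_prod I,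
        Finset.prod_congr rfl (fun i hi => by rw [he2 a i (Finset.mem_compl.1 hi)]),
        Finset.prod_eq_one (s := I) (fun i hi => by rw [he1 a i hi, Nat.factorial_zero]), mul_one]
      congr 1
      exact Finset.prod_congr rfl fun i hi => by rw [hΦ a i hi]
    rw [← this]
    ring
  have h4 := ncard_treesWithDegrees hn hd
  have hpos : 0 < ∏ x ∈ (Finset.univ.map Φ)ᶜ, d x := Finset.prod_pos fun x _ => h1 x
  refine Nat.eq_of_mul_eq_mul_right hpos ?_
  rw [← h4]
  linear_combination (treesWithDegrees d).ncard *
    ((∏ i ∈ I, (deg F i - 1)!) ^ Fintype.card ι * h - (treesWithCopies F Φ d).ncard * h3)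

end CopyCount

/-! ### Balls and distances in trees -/

section Balls

variable {V W U : Type}

lemma exists_adj_of_edist_eq_succ {G : SimpleGraph V} {v u : V} {k : ℕ}
    (h : G.edist v u = (k + 1 : ℕ)) : ∃ w, G.Adj w u ∧ G.edist v w = k := by
  rw [SimpleGraph.edist_comm] at h
  obtain ⟨p, hp⟩ := SimpleGraph.exists_walk_of_edist_eq_coe h
  cases p with
  | nil => simp at hp
  | @cons _ w _ hw q =>
    refine ⟨w, hw.symm, le_antisymm ?_ ?_⟩
    · rw [SimpleGraph.edist_comm]
      refine (SimpleGraph.edist_le q).trans ?_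
      rw [SimpleGraph.Walk.length_cons] at hp
      exact_mod_cast (by omega : q.length ≤ k)
    · have h1 : G.edist u v ≤ G.edist u w + G.edist w v := SimpleGraph.edist_triangle
      rw [h, SimpleGraph.edist_eq_one_iff_adj.2 hw, add_comm, Nat.cast_add, Nat.cast_one,
        SimpleGraph.edist_comm (u := w)] at h1
      exact (ENat.add_le_add_iff_left ENat.one_ne_top).1 h1

lemma edist_le_succ_of_adj {G : SimpleGraph V} {v u w : V} {k : ℕ} (h : G.edist v u ≤ k)
    (huw : G.Adj u w) : G.edist v w ≤ (k + 1 : ℕ) := by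
  have h1 : G.edist v w ≤ G.edist v u + G.edist u w := SimpleGraph.edist_triangle
  rw [SimpleGraph.edist_eq_one_iff_adj.2 huw] at h1
  push_cast
  exact h1.trans (by gcongr)

lemma exists_edist_eq {G : SimpleGraph V} {v u : V} {k j : ℕ} (h : G.edist v u = k) (hj : j ≤ k) :
    ∃ w, G.edist v w = j := by
  induction k generalizing u with
  | zero => exact ⟨u, by rw [h, Nat.le_zero.1 hj]⟩
  | succ k ih =>
    rcases hj.lt_or_eq with hlt | rfl
    · obtain ⟨w, -, hw⟩ := exists_adj_of_edist_eq_succ h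
      exact ih hw (Nat.lt_succ_iff.1 hlt)
    · exact ⟨u, h⟩

lemma edist_hom_le {G : SimpleGraph V} {H : SimpleGraph W} (f : G →g H) (u v : V) :
    H.edist (f u) (f v) ≤ G.edist u v := by
  by_cases h : G.edist u v = ⊤
  · rw [h]
    exact le_top
  · obtain ⟨p, hp⟩ := SimpleGraph.exists_walk_of_edist_ne_top h
    rw [← hp, ← p.length_map f]
    exact SimpleGraph.edist_le _

lemma edist_iso {G : SimpleGraph V} {H : SimpleGraph W} (f : G ≃g H) (u v : V) :
    H.edist (f u) (f v) = G.edist u v := by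
  refine le_antisymm (edist_hom_le f.toHom u v) ?_
  have := edist_hom_le f.symm.toHom (f u) (f v)
  simpa using this

/-- Distances from the root are the same in a ball and in the whole graph. -/
lemma edist_ball (G : SimpleGraph V) (v : V) (R : ℕ) (u : {u : V // G.edist v u ≤ R}) :
    (ball G v R).graph.edist (ball G v R).root u = G.edist v u := by
  apply le_antisymm
  · obtain ⟨u, hu⟩ := u
    obtain ⟨k, hk⟩ := ENat.ne_top_iff_exists.1 (ne_top_of_le_ne_top (ENat.natCast_ne_top R) hu)
    dsimp only
    induction k generalizing u with
    | zero =>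
      have : v = u := by simpa using hk.symm
      subst this
      exact (SimpleGraph.edist_self).le.trans (zero_le)
    | succ k ih =>
      obtain ⟨w, hwu, hw⟩ := exists_adj_of_edist_eq_succ hk.symm
      have hwR : G.edist v w ≤ R := by
        rw [hw]
        refine le_trans ?_ (hk.trans_le hu)
        exact_mod_cast Nat.le_succ k
      rw [← hk]
      exact edist_le_succ_of_adj (u := ⟨w, hwR⟩) ((ih w hwR hw.symm).trans hw.le)
        (by simpa [ball] using hwu)
  · exact edist_hom_le (⟨Subtype.val, fun h => h⟩ : (ball G v R).graph →g G) _ _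

namespace RootedGraph

lemma Isomorphic.refl (G : RootedGraph V) : G.Isomorphic G := ⟨SimpleGraph.Iso.refl, rfl⟩

lemma Isomorphic.symm {G : RootedGraph V} {H : RootedGraph W} (h : G.Isomorphic H) :
    H.Isomorphic G := by
  obtain ⟨f, hf⟩ := h
  exact ⟨f.symm, by rw [← hf]; exact f.symm_apply_apply _⟩

lemma Isomorphic.trans {G : RootedGraph V} {H : RootedGraph W} {K : RootedGraph U}
    (h : G.Isomorphic H) (h' : H.Isomorphic K) : G.Isomorphic K := by
  obtain ⟨f, hf⟩ := h
  obtain ⟨g, hg⟩ := h'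
  exact ⟨f.trans g, by simp [hf, hg]⟩

lemma Isomorphic.card_eq {G : RootedGraph V} {H : RootedGraph W} (h : G.Isomorphic H) :
    Nat.card V = Nat.card W := by
  obtain ⟨f, -⟩ := h
  exact Nat.card_congr f.toEquiv

lemma Isomorphic.ball {G : RootedGraph V} {H : RootedGraph W} (h : G.Isomorphic H) (R : ℕ) :
    (ball G.graph G.root R).Isomorphic (RandomTreeLimit.ball H.graph H.root R) := by
  obtain ⟨f, hf⟩ := h
  refine ⟨⟨f.toEquiv.subtypeEquiv fun u => ?_, ?_⟩, ?_⟩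
  · rw [← hf]
    exact (edist_iso f _ _).symm ▸ Iff.rfl
  · intro a b
    exact f.map_rel_iff
  · exact Subtype.ext hf

lemma Isomorphic.isDeepTree {G : RootedGraph V} {H : RootedGraph W} (h : G.Isomorphic H) {R : ℕ}
    (hG : G.IsDeepTree R) : H.IsDeepTree R := by
  obtain ⟨f, hf⟩ := h
  obtain ⟨h1, h2, u, hu⟩ := hG
  refine ⟨f.isTree_iff.1 h1, fun w => ?_, f u, ?_⟩
  · rw [← hf, ← f.apply_symm_apply w]
    exact (edist_iso f _ _).le.trans (h2 _)
  · change H.graph.edist H.root (f u) = R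
    rw [← hf, edist_iso]
    exact hu

end RootedGraph

lemma ball_ball_isomorphic (G : SimpleGraph V) (v : V) {R S : ℕ} (h : R ≤ S) :
    (ball (ball G v S).graph (ball G v S).root R).Isomorphic (ball G v R) := by
  have hRS : ∀ u, G.edist v u ≤ R → G.edist v u ≤ S :=
    fun u hu => hu.trans (by exact_mod_cast h)
  refine ⟨⟨⟨fun u => ⟨u.1.1, (edist_ball G v S u.1).symm.trans_le u.2⟩,
    fun u => ⟨⟨u.1, hRS _ u.2⟩, (edist_ball G v S ⟨u.1, hRS _ u.2⟩).trans_le u.2⟩,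
    fun u => rfl, fun u => rfl⟩, ?_⟩, rfl⟩
  intro a b
  rfl

/-- The ball of a smaller radius depends only on the isomorphism class of the larger ball. -/
lemma isomorphic_ball_of_le {G : SimpleGraph V} {v : V} {H : RootedGraph W} {R S : ℕ}
    (h : (ball G v S).Isomorphic H) (hRS : R ≤ S) :
    (ball G v R).Isomorphic (ball H.graph H.root R) :=
  (ball_ball_isomorphic G v hRS).symm.trans (h.ball R)

lemma isTree_ball {T : SimpleGraph V} (hT : T.IsTree) (v : V) (R : ℕ) :
    (ball T v R).graph.IsTree := by
  refine ⟨?_, hT.2.comap ⟨Subtype.val, fun h => h⟩ Subtype.val_injective⟩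
  have h : ∀ u, (ball T v R).graph.Reachable (ball T v R).root u := fun u =>
    SimpleGraph.reachable_of_edist_ne_top (by
      rw [edist_ball]
      exact ne_top_of_le_ne_top (ENat.natCast_ne_top R) u.2)
  have : Nonempty {u : V // T.edist v u ≤ R} := ⟨(ball T v R).root⟩
  exact ⟨fun a b => (h a).symm.trans (h b)⟩

lemma coe_dist_isTree {T : SimpleGraph V} (hT : T.IsTree) (v u : V) :
    ((T.dist v u : ℕ) : ℕ∞) = T.edist v u := (hT.connected v u).coe_dist_eq_edist

/-- In a tree that is not equinumerous to `F`, the balls isomorphic to `F` reach the boundary. -/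
lemma isDeepTree_of_ball_isomorphic {T : SimpleGraph V} (hT : T.IsTree) {v : V} {R : ℕ}
    {F : RootedGraph W} (h : (ball T v R).Isomorphic F) (hVW : ¬ Nonempty (V ≃ W)) :
    F.IsDeepTree R := by
  refine h.isDeepTree ⟨isTree_ball hT v R, fun u => (edist_ball T v R u).trans_le u.2, ?_⟩
  by_contra hne
  -- A vertex beyond distance `R` would yield one at distance exactly `R`. Otherwise the ball is the
  -- whole tree, against `hVW`.
  have hall : ∀ u, T.edist v u ≤ R := by
    intro u
    by_contra hu
    rw [← coe_dist_isTree hT, not_le] at hu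
    obtain ⟨w, hw⟩ := exists_edist_eq (coe_dist_isTree hT v u).symm
      (Nat.le_of_lt (by exact_mod_cast hu : R < T.dist v u))
    exact hne ⟨⟨w, hw.le⟩, (edist_ball T v R ⟨w, hw.le⟩).trans hw⟩
  obtain ⟨f, -⟩ := h
  exact hVW ⟨(Equiv.subtypeUnivEquiv hall).symm.trans f.toEquiv⟩

/-- In a tree, a vertex has at most one neighbour closer to the root. -/
lemma parent_unique {T : SimpleGraph V} (hT : T.IsTree) {r u a b : V} (ha : T.Adj a u)
    (hb : T.Adj b u) (ha' : T.dist r a < T.dist r u) (hb' : T.dist r b < T.dist r u) : a = b := by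
  have key : ∀ c, T.Adj c u → T.dist r c < T.dist r u →
      ∃ p : T.Walk r u, p.IsPath ∧ p.penultimate = c := by
    intro c hc hc'
    obtain ⟨q, hq, hql⟩ := hT.connected.exists_path_of_dist r c
    refine ⟨q.concat hc, hq.concat (fun hu => ?_) hc, by simp⟩
    classical
    have h1 := SimpleGraph.dist_le (q.takeUntil u hu)
    have h2 := q.length_takeUntil_le_length hu
    omega
  obtain ⟨p, hp, rfl⟩ := key a ha ha'
  obtain ⟨q, hq, rfl⟩ := key b hb hb'
  rw [(hT.existsUnique_path r u).unique hp hq]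

/-- Adjacent vertices of a tree are never equidistant from the root, so all neighbours of a vertex
on the last level are closer to the root, and only one neighbour can be. -/
lemma deg_eq_one_of_mem_level [Finite W] {F : RootedGraph W} {R : ℕ} (hF : F.IsDeepTree R)
    (hR : 0 < R) {i : W} (hi : i ∈ F.level R) : deg F.graph i = 1 := by
  obtain ⟨k, rfl⟩ := Nat.exists_eq_succ_of_ne_zero hR.ne'
  obtain ⟨w, hw, hwk⟩ := exists_adj_of_edist_eq_succ hi
  have hdist : ∀ j, F.graph.Adj j i → F.graph.dist F.root j < F.graph.dist F.root i := by
    intro j hj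
    have h1 : F.graph.dist F.root j ≤ k + 1 := by
      have := hF.2.1 j
      rw [← coe_dist_isTree hF.1] at this
      exact_mod_cast this
    have h2 : F.graph.dist F.root i = k + 1 := by
      have : F.graph.edist F.root i = (k + 1 : ℕ) := hi
      rw [← coe_dist_isTree hF.1] at this
      exact_mod_cast this
    have := hF.1.dist_ne_of_adj F.root hj
    omega
  rw [deg, Set.ncard_eq_one]
  refine ⟨w, Set.eq_singleton_iff_unique_mem.2 ⟨hw.symm, fun j hj => ?_⟩⟩
  exact parent_unique hF.1 (SimpleGraph.Adj.symm hj) hw (hdist j (SimpleGraph.Adj.symm hj))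
    (hdist w hw)

/-- In a tree, a set `H` of vertices has at least `∑ v ∈ H, (deg v - 1)` neighbours. -/
lemma sum_deg_sub_one_le [Fintype V] {T : SimpleGraph V} (hT : T.IsTree)
    (H : Finset V) : ∑ v ∈ H, (deg T v - 1) ≤ {w | ∃ v ∈ H, T.Adj v w}.ncard := by
  classical
  obtain ⟨r⟩ := hT.connected.nonempty
  -- `C v` is the set of children of `v` with respect to the root `r`. All neighbours but at most
  -- one are children, and no vertex is a child of two.
  set C : V → Finset V := fun v => Finset.univ.filter fun w => T.Adj v w ∧ T.dist r v < T.dist r w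
    with hC
  have h1 : ∀ v, deg T v - 1 ≤ (C v).card := by
    intro v
    have : T.neighborSet v ⊆ ↑(C v) ∪ {w | T.Adj v w ∧ T.dist r w < T.dist r v} := by
      intro w hw
      have := hT.dist_ne_of_adj r hw
      simp only [hC, Finset.coe_filter, Finset.mem_univ, true_and, Set.mem_union,
        Set.mem_ofPred_eq]
      rcases lt_or_gt_of_ne this with h | h
      · exact Or.inl ⟨hw, h⟩
      · exact Or.inr ⟨hw, h⟩
    have h2 : {w | T.Adj v w ∧ T.dist r w < T.dist r v}.ncard ≤ 1 := by
      rw [Set.ncard_le_one]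
      intro a ha b hb
      exact parent_unique hT ha.1.symm hb.1.symm ha.2 hb.2
    have h3 := (Set.ncard_le_ncard this (Set.toFinite _)).trans (Set.ncard_union_le _ _)
    rw [Set.ncard_coe_finset] at h3
    rw [deg]
    omega
  calc ∑ v ∈ H, (deg T v - 1) ≤ ∑ v ∈ H, (C v).card := Finset.sum_le_sum fun v _ => h1 v
    _ = (H.biUnion C).card := by
        rw [Finset.card_biUnion]
        intro v _ v' _ hne
        rw [Function.onFun, Finset.disjoint_left]
        intro w hw hw'
        simp only [hC, Finset.mem_filter, Finset.mem_univ, true_and] at hw hw'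
        exact hne (parent_unique hT hw.1 hw'.1 hw.2 hw'.2)
    _ ≤ _ := by
        rw [← Set.ncard_coe_finset]
        refine Set.ncard_le_ncard (fun w hw => ?_) (Set.toFinite _)
        simp only [hC, Finset.coe_biUnion, Set.mem_iUnion, Finset.mem_coe, Finset.mem_filter] at hw
        obtain ⟨v, hv, hw⟩ := hw
        exact ⟨v, hv, hw.2.1⟩

end Balls

/-! ### Isomorphisms to balls as degree-preserving embeddings -/

section Embeddings

variable {V W : Type}

/-- The maps that are isomorphisms from `F` to the `R`-ball around the image of the root, in the
form of a condition on edges and degrees. -/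
def ballEmbeddings (F : RootedGraph W) (R : ℕ) (T : SimpleGraph V) : Set (W → V) :=
  {η | Function.Injective η ∧ (∀ i j, F.graph.Adj i j → T.Adj (η i) (η j)) ∧
    ∀ i ∉ F.level R, deg T (η i) = deg F.graph i}

lemma RootedGraph.numAut_pos [Finite W] (F : RootedGraph W) : 0 < F.numAut := by
  have : Finite (F.graph ≃g F.graph) :=
    Finite.of_injective (fun f => (f : W → W)) DFunLike.coe_injective
  have : Nonempty {f : F.graph ≃g F.graph // f F.root = F.root} := ⟨⟨SimpleGraph.Iso.refl, rfl⟩⟩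
  exact Nat.card_pos

lemma card_iso_ball {F : RootedGraph W} {R : ℕ} {T : SimpleGraph V} {v : V}
    (h : (ball T v R).Isomorphic F) :
    Nat.card {f : F.graph ≃g (ball T v R).graph // f F.root = (ball T v R).root} = F.numAut := by
  obtain ⟨g, hg⟩ := h
  refine Nat.card_congr ⟨fun f => ⟨f.1.trans g, by simp [f.2, hg]⟩,
    fun f => ⟨f.1.trans g.symm, ?_⟩, fun f => ?_, fun f => ?_⟩
  · change g.symm (f.1 F.root) = _
    rw [f.2, ← hg]
    exact g.symm_apply_apply _
  · ext i
    simp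
  · ext i
    simp

/-- A vertex off the last level is mapped to distance less than `R`, so all its neighbours in `T`
lie in the ball and its degree there is its degree in `T`. -/
lemma ballEmbedding_of_iso {F : RootedGraph W} {R : ℕ} {T : SimpleGraph V} {v : V}
    (hF : ∀ i, F.graph.edist F.root i ≤ R)
    (f : F.graph ≃g (ball T v R).graph) (hf : f F.root = (ball T v R).root) :
    (fun i => (f i).1) ∈ ballEmbeddings F R T := by
  refine ⟨Subtype.val_injective.comp f.injective, fun i j h => f.map_rel_iff.2 h, fun i hi => ?_⟩
  have hlt : F.graph.edist F.root i < R := lt_of_le_of_ne (hF i) hi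
  have h1 : T.edist v (f i).1 = F.graph.edist F.root i := by
    rw [← edist_ball, ← hf, edist_iso]
  have : T.neighborSet (f i).1 = (fun i => (f i).1) '' F.graph.neighborSet i := by
    ext u
    constructor
    · intro hu
      obtain ⟨k, hk⟩ := ENat.ne_top_iff_exists.1 hlt.ne_top
      rw [← hk] at h1 hlt
      have h2 := edist_le_succ_of_adj h1.le hu
      have huR : T.edist v u ≤ R := h2.trans (by
        have : k < R := by exact_mod_cast hlt
        exact_mod_cast this)
      refine ⟨f.symm ⟨u, huR⟩, ?_, by simp⟩
      rw [SimpleGraph.mem_neighborSet, ← f.map_rel_iff, f.apply_symm_apply]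
      exact hu
    · rintro ⟨j, hj, rfl⟩
      exact f.map_rel_iff.2 hj
  rw [deg, this]
  exact Set.ncard_image_of_injective _ (Subtype.val_injective.comp f.injective)

variable [Finite V]

lemma neighborSet_eq_image {F : RootedGraph W} {R : ℕ} {T : SimpleGraph V} {η : W → V}
    (hη : η ∈ ballEmbeddings F R T) {i : W} (hi : i ∉ F.level R) :
    T.neighborSet (η i) = η '' F.graph.neighborSet i := by
  refine (Set.eq_of_subset_of_ncard_le ?_ ?_ (Set.toFinite _)).symm
  · rintro _ ⟨j, hj, rfl⟩
    exact hη.2.1 i j hj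
  · rw [Set.ncard_image_of_injective _ hη.1]
    exact (hη.2.2 i hi).le

/-- Induction on the distance: the predecessor on a shortest walk is the image of a vertex off the
last level, and by the degree condition the image contains all its neighbours. -/
lemma exists_preimage_of_edist {F : RootedGraph W} {R : ℕ} {T : SimpleGraph V} {η : W → V}
    (hη : η ∈ ballEmbeddings F R T) {k : ℕ} (hk : k ≤ R) {u : V}
    (hu : T.edist (η F.root) u = k) : ∃ i, η i = u ∧ F.graph.edist F.root i ≤ k := by
  induction k generalizing u with
  | zero => exact ⟨F.root, by simpa using hu, by simp⟩
  | succ k ih =>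
    obtain ⟨w, hwu, hw⟩ := exists_adj_of_edist_eq_succ hu
    obtain ⟨i, rfl, hi⟩ := ih (Nat.le_of_succ_le hk) hw
    have hlev : i ∉ F.level R := by
      intro h
      have : F.graph.edist F.root i = R := h
      rw [this] at hi
      have : R ≤ k := by exact_mod_cast hi
      omega
    have : u ∈ T.neighborSet (η i) := hwu
    rw [neighborSet_eq_image hη hlev] at this
    obtain ⟨j, hj, rfl⟩ := this
    exact ⟨j, rfl, edist_le_succ_of_adj hi hj⟩

lemma edist_ballEmbedding {F : RootedGraph W} {R : ℕ} {T : SimpleGraph V} {η : W → V}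
    (hη : η ∈ ballEmbeddings F R T) (hF : ∀ i, F.graph.edist F.root i ≤ R) (i : W) :
    T.edist (η F.root) (η i) = F.graph.edist F.root i := by
  have h1 : T.edist (η F.root) (η i) ≤ F.graph.edist F.root i :=
    edist_hom_le (⟨η, fun h => hη.2.1 _ _ h⟩ : F.graph →g T) _ _
  refine le_antisymm h1 ?_
  obtain ⟨k, hk⟩ := ENat.ne_top_iff_exists.1
    (ne_top_of_le_ne_top (ENat.natCast_ne_top R) (h1.trans (hF i)))
  have hkR : k ≤ R := by
    have := (hk.trans_le h1).trans (hF i)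
    exact_mod_cast this
  obtain ⟨j, hj, hjk⟩ := exists_preimage_of_edist hη hkR hk.symm
  rw [← hη.1 hj, hj, ← hk]
  exact hjk

/-- An additional edge could only join two vertices of the last level, but these are equidistant
from the root of a tree. -/
lemma adj_of_adj_ballEmbedding {F : RootedGraph W} {R : ℕ} {T : SimpleGraph V} (hT : T.IsTree)
    {η : W → V} (hη : η ∈ ballEmbeddings F R T) (hF : ∀ i, F.graph.edist F.root i ≤ R) {i j : W}
    (hij : T.Adj (η i) (η j)) : F.graph.Adj i j := by
  have key : ∀ i j, i ∉ F.level R → T.Adj (η i) (η j) → F.graph.Adj i j := by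
    intro i j hi h
    have : η j ∈ T.neighborSet (η i) := h
    rw [neighborSet_eq_image hη hi] at this
    obtain ⟨k, hk, hkj⟩ := this
    rw [← hη.1 hkj]
    exact hk
  by_cases hi : i ∈ F.level R
  · by_cases hj : j ∈ F.level R
    · refine absurd ?_ (hT.dist_ne_of_adj (η F.root) hij)
      have h1 := edist_ballEmbedding hη hF i
      have h2 := edist_ballEmbedding hη hF j
      have h3 : F.graph.edist F.root i = R := hi
      have h4 : F.graph.edist F.root j = R := hj
      rw [h3, ← coe_dist_isTree hT] at h1
      rw [h4, ← coe_dist_isTree hT] at h2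
      exact_mod_cast h1.trans h2.symm
    · exact (key j i hj hij.symm).symm
  · exact key i j hi hij

lemma range_ballEmbedding {F : RootedGraph W} {R : ℕ} {T : SimpleGraph V} {η : W → V}
    (hη : η ∈ ballEmbeddings F R T) (hF : ∀ i, F.graph.edist F.root i ≤ R) :
    Set.range η = {u | T.edist (η F.root) u ≤ R} := by
  ext u
  constructor
  · rintro ⟨i, rfl⟩
    exact (edist_ballEmbedding hη hF i).trans_le (hF i)
  · intro hu
    obtain ⟨k, hk⟩ := ENat.ne_top_iff_exists.1 (ne_top_of_le_ne_top (ENat.natCast_ne_top R) hu)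
    have hkR : k ≤ R := by
      have : T.edist (η F.root) u ≤ R := hu
      rw [← hk] at this
      exact_mod_cast this
    obtain ⟨i, hi, -⟩ := exists_preimage_of_edist hη hkR hk.symm
    exact ⟨i, hi⟩

/-- The maps of `ballEmbeddings` with a given image of the root correspond to the isomorphisms. -/
lemma ncard_fiber_ballEmbeddings {F : RootedGraph W} {R : ℕ} {T : SimpleGraph V} (hT : T.IsTree)
    (hF : ∀ i, F.graph.edist F.root i ≤ R) (v : V) :
    {η | η ∈ ballEmbeddings F R T ∧ η F.root = v}.ncard =
      Nat.card {f : F.graph ≃g (ball T v R).graph // f F.root = (ball T v R).root} := by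
  symm
  refine Nat.card_congr (Equiv.ofBijective (fun f => ⟨fun i => (f.1 i).1,
    ballEmbedding_of_iso hF f.1 f.2, congrArg Subtype.val f.2⟩) ⟨?_, ?_⟩)
  · intro f g hfg
    ext i
    exact congrFun (congrArg Subtype.val hfg) i
  · rintro ⟨η, hη, rfl⟩
    have hr := range_ballEmbedding hη hF
    have hmem : ∀ i, T.edist (η F.root) (η i) ≤ R := fun i =>
      (edist_ballEmbedding hη hF i).trans_le (hF i)
    let e : W ≃ {u // T.edist (η F.root) u ≤ R} :=
      Equiv.ofBijective (fun i => ⟨η i, hmem i⟩)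
        ⟨fun i j h => hη.1 (congrArg Subtype.val h), fun u => by
          obtain ⟨i, hi⟩ : u.1 ∈ Set.range η := hr ▸ u.2
          exact ⟨i, Subtype.ext hi⟩⟩
    exact ⟨⟨⟨e, fun {i j} => ⟨fun h => adj_of_adj_ballEmbedding hT hη hF h,
      fun h => hη.2.1 i j h⟩⟩, rfl⟩, rfl⟩

lemma ncard_fiber_ballEmbeddings_eq {F : RootedGraph W} {R : ℕ} {T : SimpleGraph V}
    (hT : T.IsTree) (hF : ∀ i, F.graph.edist F.root i ≤ R) (v : V)
    [Decidable ((ball T v R).Isomorphic F)] :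
    {η | η ∈ ballEmbeddings F R T ∧ η F.root = v}.ncard =
      if (ball T v R).Isomorphic F then F.numAut else 0 := by
  rw [ncard_fiber_ballEmbeddings hT hF]
  split_ifs with h
  · exact card_iso_ball h
  · have : IsEmpty {f : F.graph ≃g (ball T v R).graph // f F.root = (ball T v R).root} :=
      ⟨fun f => h (RootedGraph.Isomorphic.symm ⟨f.1, f.2⟩)⟩
    exact Nat.card_of_isEmpty

/-- The number of isomorphisms from `F` to balls of radius `R`. -/
theorem ncard_ballEmbeddings [Finite W] {F : RootedGraph W} {R : ℕ} {T : SimpleGraph V}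
    (hT : T.IsTree) (hF : ∀ i, F.graph.edist F.root i ≤ R) :
    (ballEmbeddings F R T).ncard = F.numAut * {v | (ball T v R).Isomorphic F}.ncard := by
  classical
  have := Fintype.ofFinite V
  have := Fintype.ofFinite W
  rw [Set.ncard_eq_toFinset_card', Finset.card_eq_sum_card_fiberwise
    (f := fun η => η F.root) (t := Finset.univ) (fun _ _ => Finset.mem_coe.2 (Finset.mem_univ _)),
    Set.ncard_eq_toFinset_card', Set.toFinset_ofPred, Finset.card_filter, Finset.mul_sum]
  refine Finset.sum_congr rfl fun v _ => ?_
  rw [mul_ite, mul_one, mul_zero, ← ncard_fiber_ballEmbeddings_eq hT hF v,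
    Set.ncard_eq_toFinset_card']
  congr 1
  ext η
  simp

end Embeddings

/-! ### Overlapping balls -/

section Overlaps

variable {V W : Type}

/-- The pairs of isomorphisms from `F` to balls of radius `R` that are not disjoint. -/
theorem ncard_overlapping_le [Fintype V] [Finite W] {F : RootedGraph W} {R : ℕ}
    {T : SimpleGraph V} (hT : T.IsTree) (hF : ∀ i, F.graph.edist F.root i ≤ R) :
    {p : (W → V) × (W → V) | p.1 ∈ ballEmbeddings F R T ∧ p.2 ∈ ballEmbeddings F R T ∧
      ¬ Disjoint (Set.range p.1) (Set.range p.2)}.ncard ≤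
    F.numAut ^ 2 * ∑ v, {u | T.edist v u ≤ (2 * R : ℕ)}.ncard := by
  classical
  have := Fintype.ofFinite W
  have hfib : ∀ v, {η | η ∈ ballEmbeddings F R T ∧ η F.root = v}.ncard ≤ F.numAut := by
    intro v
    rw [ncard_fiber_ballEmbeddings_eq hT hF]
    split_ifs <;> simp
  have hsum : ∑ v, {u | T.edist v u ≤ (2 * R : ℕ)}.ncard =
      (Finset.univ.filter fun p : V × V => T.edist p.1 p.2 ≤ (2 * R : ℕ)).card := by
    rw [Finset.card_filter, Fintype.sum_prod_type]
    refine Finset.sum_congr rfl fun v _ => ?_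
    rw [← Finset.card_filter, Set.ncard_eq_toFinset_card', Set.toFinset_ofPred]
  rw [hsum, Set.ncard_eq_toFinset_card']
  -- Overlapping balls have roots at distance at most `2 * R`, and a given pair of roots belongs to
  -- at most `numAut ^ 2` pairs of isomorphisms.
  refine Finset.card_le_mul_card_image_of_maps_to (f := fun p => (p.1 F.root, p.2 F.root)) ?_ _ ?_
  · rintro ⟨η, θ⟩ hp
    simp only [Set.mem_toFinset, Set.mem_ofPred_eq] at hp
    obtain ⟨hη, hθ, hd⟩ := hp
    rw [range_ballEmbedding hη hF, range_ballEmbedding hθ hF, Set.not_disjoint_iff] at hd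
    obtain ⟨u, hu, hu'⟩ := hd
    simp only [Finset.mem_filter, Finset.mem_univ, true_and]
    refine (SimpleGraph.edist_triangle (v := u)).trans ?_
    rw [SimpleGraph.edist_comm (u := u), two_mul]
    push_cast
    exact add_le_add hu hu'
  · rintro ⟨v, w⟩ -
    rw [sq]
    refine le_trans ?_ (Nat.mul_le_mul (hfib v) (hfib w))
    rw [← Set.ncard_prod, Set.ncard_eq_toFinset_card']
    refine Finset.card_le_card fun p hp => ?_
    simp only [Finset.mem_filter, Set.mem_toFinset, Set.mem_ofPred_eq, Prod.mk.injEq] at hp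
    simp only [Set.mem_toFinset, Set.mem_prod, Set.mem_ofPred_eq]
    exact ⟨⟨hp.1.1, hp.2.1⟩, hp.1.2.1, hp.2.2⟩

end Overlaps

/-! ### Tightness of ball sizes and uniform integrability of degrees -/

section Tightness

variable {V : Type}

/-- The vertices whose `R`-ball has more than `M` vertices. -/
def bigBalls (G : SimpleGraph V) (R M : ℕ) : Set V := {v | M < {u | G.edist v u ≤ R}.ncard}

/-- The sum of the values of `d` that exceed `K`. -/
def tailSum [Fintype V] (d : V → ℕ) (K : ℕ) : ℕ := ∑ v with K < d v, d v

lemma card_filter_lt_le_tailSum [Fintype V] (d : V → ℕ) (K : ℕ) :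
    (Finset.univ.filter fun v => K < d v).card ≤ tailSum d K := by
  rw [Finset.card_eq_sum_ones]
  refine Finset.sum_le_sum fun v hv => ?_
  have := (Finset.mem_filter.1 hv).2
  omega

lemma sum_le_mul_card_add_tailSum [Fintype V] (d : V → ℕ) (K : ℕ) (A : Finset V) :
    ∑ v ∈ A, d v ≤ K * A.card + tailSum d K := by
  rw [← Finset.sum_filter_not_add_sum_filter A (fun v => K < d v)]
  refine add_le_add ?_ (Finset.sum_le_sum_of_subset (Finset.filter_subset_filter _
    (Finset.subset_univ A)))
  refine (Finset.sum_le_card_nsmul _ _ K fun v hv => ?_).trans ?_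
  · exact not_lt.1 (Finset.mem_filter.1 hv).2
  · rw [smul_eq_mul, mul_comm]
    exact Nat.mul_le_mul_left _ (Finset.card_filter_le _ _)

/-- The `(R + 1)`-ball is covered by the `R`-balls around `v` and its neighbours. There are at most
`K + 1` of them, so one has more than `M` vertices. -/
lemma mem_bigBalls_succ [Finite V] {G : SimpleGraph V} {R M K : ℕ} {v : V}
    (hv : v ∈ bigBalls G (R + 1) ((K + 1) * M)) (hK : deg G v ≤ K) :
    v ∈ bigBalls G R M ∨ ∃ u ∈ bigBalls G R M, G.Adj u v := by
  classical
  have := Fintype.ofFinite V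
  by_contra! h
  obtain ⟨h1, h2⟩ := h
  set A : Finset V := insert v (G.neighborSet v).toFinset with hA
  have hcard : A.card ≤ K + 1 := by
    refine (Finset.card_insert_le _ _).trans ?_
    rw [← Set.ncard_eq_toFinset_card']
    exact Nat.succ_le_succ hK
  have hsub : {u | G.edist v u ≤ (R + 1 : ℕ)} ⊆ ⋃ w ∈ A, {u | G.edist w u ≤ R} := by
    intro u hu
    simp only [Set.mem_iUnion, exists_prop]
    obtain ⟨k, hk⟩ := ENat.ne_top_iff_exists.1
      (ne_top_of_le_ne_top (ENat.natCast_ne_top (R + 1)) hu)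
    have hkR : k ≤ R + 1 := by
      have : G.edist v u ≤ (R + 1 : ℕ) := hu
      rw [← hk] at this
      exact_mod_cast this
    rcases k with _ | k
    · refine ⟨v, Finset.mem_insert_self _ _, ?_⟩
      change G.edist v u ≤ R
      rw [← hk]
      exact zero_le
    · rw [SimpleGraph.edist_comm] at hk
      obtain ⟨w, hw, hwk⟩ := exists_adj_of_edist_eq_succ hk.symm
      refine ⟨w, Finset.mem_insert_of_mem (by simpa using hw.symm), ?_⟩
      change G.edist w u ≤ R
      rw [SimpleGraph.edist_comm, hwk]
      exact_mod_cast Nat.le_of_succ_le_succ hkR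
  have h3 : ∀ w ∈ A, {u | G.edist w u ≤ R}.ncard ≤ M := by
    intro w hw
    rcases Finset.mem_insert.1 hw with rfl | hw
    · exact not_lt.1 h1
    · refine not_lt.1 fun h => h2 w h ?_
      have : G.Adj v w := by simpa using hw
      exact this.symm
  change (K + 1) * M < {u | G.edist v u ≤ (R + 1 : ℕ)}.ncard at hv
  refine absurd hv (not_lt.2 ?_)
  calc {u | G.edist v u ≤ (R + 1 : ℕ)}.ncard ≤ (⋃ w ∈ A, {u | G.edist w u ≤ R}).ncard :=
        Set.ncard_le_ncard hsub (Set.toFinite _)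
    _ ≤ ∑ w ∈ A, {u | G.edist w u ≤ R}.ncard := Finset.set_ncard_biUnion_le _ _
    _ ≤ ∑ w ∈ A, M := Finset.sum_le_sum h3
    _ = A.card * M := by rw [Finset.sum_const, smul_eq_mul]
    _ ≤ (K + 1) * M := Nat.mul_le_mul_right _ hcard

/-- A vertex on the left has degree above `K`, or a big `R`-ball, or a neighbour with a big
`R`-ball. The number of such neighbours is at most the total degree of the set of vertices with big
`R`-balls, which is split at the threshold `L`. -/
lemma ncard_bigBalls_succ_le [Fintype V] (G : SimpleGraph V) (R M K L : ℕ) :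
    (bigBalls G (R + 1) ((K + 1) * M)).ncard ≤
      tailSum (deg G) K + ((L + 1) * (bigBalls G R M).ncard + tailSum (deg G) L) := by
  classical
  set A := (bigBalls G R M).toFinset with hA
  have hAc : (bigBalls G R M).ncard = A.card := Set.ncard_eq_toFinset_card' _
  have hsub : bigBalls G (R + 1) ((K + 1) * M) ⊆
      ((Finset.univ.filter fun v => K < deg G v : Finset V) : Set V) ∪
        ((A : Set V) ∪ ⋃ u ∈ A, G.neighborSet u) := by
    intro v hv
    by_cases hK : K < deg G v
    · exact Or.inl (by simpa using hK)
    · rcases mem_bigBalls_succ hv (not_lt.1 hK) with h | ⟨u, hu, huv⟩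
      · exact Or.inr (Or.inl (by simpa [hA] using h))
      · refine Or.inr (Or.inr ?_)
        simp only [Set.mem_iUnion, exists_prop]
        exact ⟨u, by simpa [hA] using hu, huv⟩
  refine (Set.ncard_le_ncard hsub (Set.toFinite _)).trans ((Set.ncard_union_le _ _).trans ?_)
  rw [Set.ncard_coe_finset]
  refine add_le_add (card_filter_lt_le_tailSum _ K) ((Set.ncard_union_le _ _).trans ?_)
  rw [Set.ncard_coe_finset, hAc]
  have h1 : (⋃ u ∈ A, G.neighborSet u).ncard ≤ ∑ u ∈ A, deg G u :=
    Finset.set_ncard_biUnion_le _ _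
  have h2 := sum_le_mul_card_add_tailSum (deg G) L A
  nlinarith

lemma ncard_bigBalls_zero [Finite V] (G : SimpleGraph V) : bigBalls G 0 1 = ∅ := by
  refine Set.eq_empty_iff_forall_notMem.2 fun v hv => ?_
  have : {u | G.edist v u ≤ (0 : ℕ)} = {v} := by
    ext u
    simp [eq_comm (a := u)]
  rw [bigBalls, Set.mem_ofPred_eq, this, Set.ncard_singleton] at hv
  exact lt_irrefl _ hv

variable {X : Type*}

/-- Uniform integrability of the entries of the sequences `d x` along a filter. -/
def UnifIntegrableAlong (l : Filter X) {n : X → ℕ} (d : ∀ x, Fin (n x) → ℕ) : Prop :=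
  ∀ ε : ℝ, 0 < ε → ∃ K, ∀ᶠ x in l, (tailSum (d x) K : ℝ) ≤ ε * n x

/-- If the degrees are uniformly integrable, then the sizes of the balls are tight. -/
theorem tight_bigBalls {l : Filter X} {n : X → ℕ} {d : ∀ x, Fin (n x) → ℕ}
    (hd : UnifIntegrableAlong l d) (R : ℕ) : ∀ ε : ℝ, 0 < ε → ∃ M, ∀ᶠ x in l,
      ∀ T : SimpleGraph (Fin (n x)), (∀ i, deg T i = d x i) →
        ((bigBalls T R M).ncard : ℝ) ≤ ε * n x := by
  induction R with
  | zero =>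
    intro ε hε
    refine ⟨1, Filter.Eventually.of_forall fun x T _ => ?_⟩
    rw [ncard_bigBalls_zero, Set.ncard_empty, Nat.cast_zero]
    positivity
  | succ R ih =>
    intro ε hε
    -- The recursion is used with `L = K`; each of the two tail sums and the term with the `R`-balls
    -- receives `ε / 3`.
    obtain ⟨K, hK⟩ := hd (ε / 3) (by positivity)
    obtain ⟨M, hM⟩ := ih (ε / (3 * (K + 1))) (by positivity)
    refine ⟨(K + 1) * M, ?_⟩
    filter_upwards [hK, hM] with x hKx hMx T hT
    have h1 := ncard_bigBalls_succ_le T R M K K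
    have h2 : deg T = d x := funext hT
    rw [h2] at h1
    have h3 := hMx T hT
    have h4 : ((bigBalls T (R + 1) ((K + 1) * M)).ncard : ℝ) ≤
        tailSum (d x) K + ((K + 1) * (bigBalls T R M).ncard + tailSum (d x) K) := by
      exact_mod_cast h1
    have h5 : ((K : ℝ) + 1) * (bigBalls T R M).ncard ≤ ε / 3 * n x := by
      calc ((K : ℝ) + 1) * (bigBalls T R M).ncard
          ≤ (K + 1) * (ε / (3 * (K + 1)) * n x) := by gcongr
        _ = ε / 3 * n x := by field_simp
    linarith

lemma sum_ncard_ball_le [Fintype V] (G : SimpleGraph V) (R M : ℕ) :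
    ∑ v, {u | G.edist v u ≤ R}.ncard ≤
      Fintype.card V * M + (bigBalls G R M).ncard * Fintype.card V := by
  classical
  have h : ∀ v, {u | G.edist v u ≤ R}.ncard ≤
      M + if v ∈ bigBalls G R M then Fintype.card V else 0 := by
    intro v
    split_ifs with hv
    · exact (Set.ncard_le_card _).trans (by simp)
    · exact not_lt.1 hv
  refine (Finset.sum_le_sum fun v _ => h v).trans ?_
  rw [Finset.sum_add_distrib, Finset.sum_const, Finset.card_univ, smul_eq_mul, ← Finset.sum_filter,
    Finset.sum_const, smul_eq_mul, Set.ncard_eq_toFinset_card', Set.filter_mem_univ_eq_toFinset]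

/-- The vertices next to a vertex of high degree have a large ball of radius two. -/
lemma tailSum_le_bigBalls [Fintype V] {T : SimpleGraph V} (hT : T.IsTree) {M : ℕ} (hM : 1 ≤ M) :
    tailSum (deg T) M ≤ 2 * (bigBalls T 2 M).ncard := by
  classical
  -- The vertices of degree above `M` have at least `∑ (deg - 1)` neighbours altogether, and `deg ≤
  -- 2 * (deg - 1)` because `deg > M ≥ 1`; hence the factor two.
  have h1 := sum_deg_sub_one_le hT (Finset.univ.filter fun v => M < deg T v)
  have h2 : {w | ∃ v ∈ Finset.univ.filter (fun v => M < deg T v), T.Adj v w} ⊆ bigBalls T 2 M := by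
    rintro w ⟨v, hv, hvw⟩
    have hv : M < deg T v := by simpa using hv
    refine lt_of_lt_of_le hv (Set.ncard_le_ncard (fun u hu => ?_) (Set.toFinite _))
    have : T.edist w v ≤ (1 : ℕ) := by
      rw [SimpleGraph.edist_eq_one_iff_adj.2 hvw.symm]
      rfl
    exact edist_le_succ_of_adj this hu
  have h3 := h1.trans (Set.ncard_le_ncard h2 (Set.toFinite _))
  refine le_trans ?_ (Nat.mul_le_mul_left 2 h3)
  rw [tailSum, Finset.mul_sum]
  refine Finset.sum_le_sum fun v hv => ?_
  have := (Finset.mem_filter.1 hv).2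
  omega

end Tightness

/-! ### First and second moments of the number of balls -/

section Moments

variable {W : Type} [Fintype W]

open Classical in
/-- The vertices of `F` that are not at distance `R` from the root. -/
def RootedGraph.inner (F : RootedGraph W) (R : ℕ) : Finset W :=
  Finset.univ.filter fun i => i ∉ F.level R

lemma RootedGraph.mem_inner {F : RootedGraph W} {R : ℕ} {i : W} :
    i ∈ F.inner R ↔ i ∉ F.level R := by
  simp [RootedGraph.inner]

/-- The labeled trees with degree sequence `d`, as a finite set. -/
def treeFinset {n : ℕ} (d : Fin n → ℕ) : Finset (SimpleGraph (Fin n)) :=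
  (Set.toFinite (treesWithDegrees d)).toFinset

lemma mem_treeFinset {n : ℕ} {d : Fin n → ℕ} {T : SimpleGraph (Fin n)} :
    T ∈ treeFinset d ↔ T ∈ treesWithDegrees d := by
  simp [treeFinset]

lemma card_treeFinset {n : ℕ} (d : Fin n → ℕ) :
    (treeFinset d).card = (treesWithDegrees d).ncard :=
  (Set.ncard_eq_toFinset_card _ _).symm

/-- The disjoint families of isomorphisms from `F` to balls of radius `R`. -/
def copyEmbeddings (ι : Type) (F : RootedGraph W) (R : ℕ) {V : Type} (T : SimpleGraph V) :
    Set (ι × W ↪ V) :=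
  {Φ | copies F.graph Φ ≤ T ∧ ∀ a, ∀ i ∈ F.inner R, deg T (Φ (a, i)) = deg F.graph i}

lemma mem_copyEmbeddings_iff {ι V : Type} {F : RootedGraph W} {R : ℕ} {T : SimpleGraph V}
    {Φ : ι × W ↪ V} :
    Φ ∈ copyEmbeddings ι F R T ↔ ∀ a, (fun i => Φ (a, i)) ∈ ballEmbeddings F R T := by
  have hinj : ∀ a, Function.Injective fun i => Φ (a, i) :=
    fun a i j h => by simpa using Φ.injective h
  simp only [copyEmbeddings, ballEmbeddings, copies_le_iff, RootedGraph.mem_inner,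
    Set.mem_ofPred_eq, hinj, true_and]
  exact ⟨fun h a => ⟨h.1 a, h.2 a⟩, fun h => ⟨fun a => (h a).1, fun a => (h a).2⟩⟩

lemma ncard_copyEmbeddings_unit {V : Type} [Finite V] {F : RootedGraph W} {R : ℕ}
    {T : SimpleGraph V} :
    (copyEmbeddings Unit F R T).ncard = (ballEmbeddings F R T).ncard := by
  refine Set.ncard_congr (fun Φ _ i => Φ ((), i)) ?_ ?_ ?_
  · intro Φ hΦ
    exact mem_copyEmbeddings_iff.1 hΦ ()
  · intro Φ Φ' _ _ h
    ext ⟨⟨⟩, i⟩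
    exact congrFun h i
  · intro η hη
    refine ⟨⟨fun p => η p.2, fun p q h => Prod.ext rfl (hη.1 h)⟩, ?_, rfl⟩
    exact mem_copyEmbeddings_iff.2 fun _ => hη

lemma ncard_disjoint_pairs_le {V : Type} [Finite V] {F : RootedGraph W} {R : ℕ}
    {T : SimpleGraph V} :
    {p : (W → V) × (W → V) | p.1 ∈ ballEmbeddings F R T ∧ p.2 ∈ ballEmbeddings F R T ∧
      Disjoint (Set.range p.1) (Set.range p.2)}.ncard ≤ (copyEmbeddings (Fin 2) F R T).ncard := by
  have hinj : ∀ p : (W → V) × (W → V), p.1 ∈ ballEmbeddings F R T ∧ p.2 ∈ ballEmbeddings F R T ∧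
      Disjoint (Set.range p.1) (Set.range p.2) →
      Function.Injective fun q : Fin 2 × W => (![p.1, p.2] : Fin 2 → W → V) q.1 q.2 := by
    rintro ⟨η, θ⟩ ⟨hη, hθ, hd⟩ ⟨a, i⟩ ⟨b, j⟩ h
    have hd' : ∀ i j, η i ≠ θ j := fun i j h =>
      Set.disjoint_left.1 hd ⟨i, rfl⟩ ⟨j, h.symm⟩
    fin_cases a <;> fin_cases b <;> simp at h ⊢
    · exact hη.1 h
    · exact hd' i j h
    · exact hd' j i h.symm
    · exact hθ.1 h
  have hsub : {p : (W → V) × (W → V) | p.1 ∈ ballEmbeddings F R T ∧ p.2 ∈ ballEmbeddings F R T ∧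
      Disjoint (Set.range p.1) (Set.range p.2)} ⊆
      (fun Φ : Fin 2 × W ↪ V => (fun i => Φ (0, i), fun i => Φ (1, i))) ''
        copyEmbeddings (Fin 2) F R T := by
    intro p hp
    refine ⟨⟨_, hinj p hp⟩, mem_copyEmbeddings_iff.2 fun a => ?_, rfl⟩
    fin_cases a
    · exact hp.1
    · exact hp.2.1
  exact (Set.ncard_le_ncard hsub (Set.toFinite _)).trans (Set.ncard_image_le (Set.toFinite _))

variable [DecidableEq W]

/-- The number of free half-edges of a copy of `F`, if the degrees of the inner vertices fit. -/
def copyWeight {V : Type} (F : RootedGraph W) (R : ℕ) (d : V → ℕ) (η : W → V) : ℕ :=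
  if ∀ i ∈ F.inner R, d (η i) = deg F.graph i then ∑ i ∈ (F.inner R)ᶜ, (d (η i) - 1) else 0

/-- The product of `(deg i - 1)!` over the inner vertices. -/
def innerFactorial (F : RootedGraph W) (R : ℕ) : ℕ := ∏ i ∈ F.inner R, (deg F.graph i - 1)!

/-- Double counting: the sum over trees is exchanged with the sum over placements, and
`ncard_treesWithCopies` evaluates the number of trees for each placement whose inner degrees fit.
`Unit` gives the first moment, `Fin 2` the disjoint pairs in the second. -/
theorem sum_ncard_copyEmbeddings {ι : Type} [Fintype ι] {n : ℕ} (hn : 2 ≤ n) {d : Fin n → ℕ}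
    (hd : d ∈ treeDegSeqs n) {F : RootedGraph W} {R : ℕ} (hF : F.IsDeepTree R) (hR : 0 < R)
    {N : ℕ} (hN : N + 2 + Fintype.card ι * Fintype.card W = n + Fintype.card ι)
    [Fintype (ι × W ↪ Fin n)] :
    (∑ T ∈ treeFinset d, (copyEmbeddings ι F R T).ncard) * (n - 2)! =
      (treeFinset d).card * (N ! * innerFactorial F R ^ Fintype.card ι *
        ∑ Φ : ι × W ↪ Fin n, ∏ a, copyWeight F R d fun i => Φ (a, i)) := by
  classical
  have hI : ∀ i ∉ F.inner R, deg F.graph i = 1 := fun i hi => by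
    rw [RootedGraph.mem_inner, not_not] at hi
    exact deg_eq_one_of_mem_level hF hR hi
  have h1 : ∑ T ∈ treeFinset d, (copyEmbeddings ι F R T).ncard =
      ∑ Φ : ι × W ↪ Fin n, ∑ T ∈ treeFinset d, if Φ ∈ copyEmbeddings ι F R T then 1 else 0 := by
    rw [Finset.sum_comm]
    refine Finset.sum_congr rfl fun T _ => ?_
    rw [← Finset.card_filter, Set.ncard_eq_toFinset_card']
    congr 1
    ext Φ
    simp
  rw [h1, Finset.sum_mul, Finset.mul_sum, Finset.mul_sum]
  refine Finset.sum_congr rfl fun Φ _ => ?_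
  by_cases hΦ : ∀ a, ∀ i ∈ F.inner R, d (Φ (a, i)) = deg F.graph i
  · have h2 : ∑ T ∈ treeFinset d, (if Φ ∈ copyEmbeddings ι F R T then 1 else 0) =
        (treesWithCopies F.graph Φ d).ncard := by
      rw [← Finset.card_filter, ← Set.ncard_coe_finset]
      congr 1
      ext T
      rw [Finset.mem_coe, Finset.mem_filter, mem_treeFinset]
      constructor
      · exact fun h => ⟨h.1, h.2.1⟩
      · exact fun h => ⟨h.1, h.2, fun a i hi => (h.1.2 _).trans (hΦ a i hi)⟩
    rw [h2, ncard_treesWithCopies hn hd hF.1 (F.inner R) hI Φ hΦ hN, card_treeFinset]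
    congr 3
    ext a
    rw [copyWeight, if_pos (hΦ a)]
  · push Not at hΦ
    obtain ⟨a, i, hi, hne⟩ := hΦ
    rw [Finset.prod_eq_zero (Finset.mem_univ a), mul_zero, mul_zero, Finset.sum_eq_zero, zero_mul]
    · intro T hT
      rw [mem_treeFinset] at hT
      exact if_neg fun h => hne ((hT.2 _).symm.trans (h.2 a i hi))
    · exact if_neg fun h => hne (h i hi)

/-- The number of the balls of radius `R` that are isomorphic to `F`. -/
def ballCount {V W : Type} (F : RootedGraph W) (R : ℕ) (T : SimpleGraph V) : ℕ :=
  {v | (ball T v R).Isomorphic F}.ncard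

theorem sum_ballCount {n : ℕ} (hn : 2 ≤ n) {d : Fin n → ℕ}
    (hd : d ∈ treeDegSeqs n) {F : RootedGraph W} {R : ℕ} (hF : F.IsDeepTree R) (hR : 0 < R)
    {N : ℕ} (hN : N + 2 + Fintype.card W = n + 1) [DecidablePred (Function.Injective : (W → Fin n) → Prop)] :
    F.numAut * (∑ T ∈ treeFinset d, ballCount F R T) * (n - 2)! =
      (treeFinset d).card * (N ! * innerFactorial F R *
        ∑ η : W → Fin n with Function.Injective η, copyWeight F R d η) := by
  classical
  have h := sum_ncard_copyEmbeddings (ι := Unit) hn hd hF hR (N := N) (by simpa using hN)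
  have h1 : ∀ T ∈ treeFinset d, (copyEmbeddings Unit F R T).ncard = F.numAut * ballCount F R T :=
    fun T hT => by
      rw [ncard_copyEmbeddings_unit, ncard_ballEmbeddings (mem_treeFinset.1 hT).1 hF.2.1, ballCount]
  rw [Finset.sum_congr rfl h1, ← Finset.mul_sum] at h
  rw [h, Fintype.card_unit, pow_one]
  congr 2
  refine Finset.sum_bij (fun Φ _ i => Φ ((), i)) ?_ ?_ ?_ ?_
  · intro Φ _
    simp only [Finset.mem_filter, Finset.mem_univ, true_and]
    exact fun i j h => by simpa using Φ.injective h
  · intro Φ _ Φ' _ h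
    ext ⟨⟨⟩, i⟩
    exact congrArg Fin.val (congrFun h i)
  · intro η hη
    simp only [Finset.mem_filter, Finset.mem_univ, true_and] at hη
    exact ⟨⟨fun p => η p.2, fun p q h => Prod.ext rfl (hη h)⟩, Finset.mem_univ _, rfl⟩
  · intro Φ _
    simp

/-- The square counts pairs of isomorphisms. For the disjoint ones the sum over placements is
enlarged to all pairs of maps, where it factorizes into a square; the overlapping ones are bounded
by `B`. -/
theorem sum_ballCount_sq_le {n : ℕ} (hn : 2 ≤ n) {d : Fin n → ℕ}
    (hd : d ∈ treeDegSeqs n) {F : RootedGraph W} {R : ℕ} (hF : F.IsDeepTree R) (hR : 0 < R)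
    {N : ℕ} (hN : N + 2 + 2 * Fintype.card W = n + 2) {B : ℕ}
    (hB : ∀ T ∈ treeFinset d, ∑ v, {u | T.edist v u ≤ (2 * R : ℕ)}.ncard ≤ B) :
    F.numAut ^ 2 * (∑ T ∈ treeFinset d, ballCount F R T ^ 2) * (n - 2)! ≤
      (treeFinset d).card * (N ! * innerFactorial F R ^ 2 *
        (∑ η : W → Fin n, copyWeight F R d η) ^ 2 + F.numAut ^ 2 * B * (n - 2)!) := by
  classical
  have h := sum_ncard_copyEmbeddings (ι := Fin 2) hn hd hF hR (N := N) (by simpa using hN)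
  have h1 : ∀ T ∈ treeFinset d, F.numAut ^ 2 * ballCount F R T ^ 2 ≤
      (copyEmbeddings (Fin 2) F R T).ncard + F.numAut ^ 2 * B := by
    intro T hT
    have hT' := (mem_treeFinset.1 hT).1
    rw [← mul_pow, ballCount, ← ncard_ballEmbeddings hT' hF.2.1, sq, ← Set.ncard_prod]
    have hsub : ballEmbeddings F R T ×ˢ ballEmbeddings F R T ⊆
        {p : (W → Fin n) × (W → Fin n) | p.1 ∈ ballEmbeddings F R T ∧ p.2 ∈ ballEmbeddings F R T ∧
          Disjoint (Set.range p.1) (Set.range p.2)} ∪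
        {p : (W → Fin n) × (W → Fin n) | p.1 ∈ ballEmbeddings F R T ∧ p.2 ∈ ballEmbeddings F R T ∧
          ¬ Disjoint (Set.range p.1) (Set.range p.2)} := by
      rintro p ⟨hp1, hp2⟩
      by_cases hp : Disjoint (Set.range p.1) (Set.range p.2)
      · exact Or.inl ⟨hp1, hp2, hp⟩
      · exact Or.inr ⟨hp1, hp2, hp⟩
    refine (Set.ncard_le_ncard hsub (Set.toFinite _)).trans ((Set.ncard_union_le _ _).trans ?_)
    exact add_le_add ncard_disjoint_pairs_le ((ncard_overlapping_le hT' hF.2.1).trans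
      (Nat.mul_le_mul_left _ (hB T hT)))
  have h2 : ∑ Φ : Fin 2 × W ↪ Fin n, ∏ a, copyWeight F R d (fun i => Φ (a, i)) ≤
      (∑ η : W → Fin n, copyWeight F R d η) ^ 2 := by
    rw [Fintype.sum_pow]
    have hinj : Set.InjOn (fun (Φ : Fin 2 × W ↪ Fin n) (a : Fin 2) (i : W) => Φ (a, i))
        (Finset.univ : Finset (Fin 2 × W ↪ Fin n)) := by
      intro Φ _ Φ' _ h
      ext ⟨a, i⟩
      exact congrArg Fin.val (congrFun (congrFun h a) i)
    rw [← Finset.sum_image (f := fun p : Fin 2 → W → Fin n => ∏ a, copyWeight F R d (p a)) hinj]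
    exact Finset.sum_le_sum_of_subset (Finset.subset_univ _)
  have h3 := Finset.sum_le_sum h1
  rw [← Finset.mul_sum, Finset.sum_add_distrib, Finset.sum_const, smul_eq_mul] at h3
  calc F.numAut ^ 2 * (∑ T ∈ treeFinset d, ballCount F R T ^ 2) * (n - 2)!
      ≤ (∑ T ∈ treeFinset d, (copyEmbeddings (Fin 2) F R T).ncard +
          (treeFinset d).card * (F.numAut ^ 2 * B)) * (n - 2)! := Nat.mul_le_mul_right _ h3
    _ = (treeFinset d).card * (N ! * innerFactorial F R ^ 2 *
          (∑ Φ : Fin 2 × W ↪ Fin n, ∏ a, copyWeight F R d fun i => Φ (a, i)) +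
          F.numAut ^ 2 * B * (n - 2)!) := by
        rw [add_mul, h, Fintype.card_fin]
        ring
    _ ≤ _ := by gcongr

end Moments

/-! ### Asymptotics of sums over placements -/

section Asymptotics

variable {V W : Type} [Fintype V] [Fintype W] [DecidableEq W]

lemma sum_comp_apply (h : V → ℕ) (l : W) :
    ∑ η : W → V, h (η l) = (∑ x, h x) * Fintype.card V ^ (Fintype.card W - 1) := by
  have h1 : ∀ η : W → V, h (η l) = ∏ i, if i = l then h (η i) else 1 := fun η => by
    rw [Finset.prod_ite_eq' Finset.univ l fun i => h (η i), if_pos (Finset.mem_univ l)]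
  simp_rw [h1]
  rw [← Fintype.piFinset_univ, ← Finset.prod_univ_sum (fun _ => Finset.univ)
    (fun i x => if i = l then h x else 1), ← Finset.mul_prod_erase _ _ (Finset.mem_univ l)]
  simp only [if_true]
  congr 1
  rw [Finset.prod_congr rfl (g := fun _ => Fintype.card V), Finset.prod_const,
    Finset.card_erase_of_mem (Finset.mem_univ l), Finset.card_univ]
  intro i hi
  simp [Finset.ne_of_mem_erase hi]

/-- A map with a collision is determined without one of the two colliding coordinates. The dropped
coordinate is chosen different from `l`, so that `h (η l)` can still be read off. -/
lemma sum_collision_le [DecidableEq V] (h : V → ℕ) {a b l : W} (hab : a ≠ b) :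
    ∑ η : W → V with η a = η b, h (η l) ≤
      (∑ x, h x) * Fintype.card V ^ (Fintype.card W - 2) := by
  have key : ∀ a b : W, a ≠ b → b ≠ l → ∑ η : W → V with η a = η b, h (η l) ≤
      (∑ x, h x) * Fintype.card V ^ (Fintype.card W - 2) := by
    intro a b hab hbl
    have h1 := sum_comp_apply h (⟨l, hbl.symm⟩ : {i // i ≠ b})
    rw [Fintype.card_subtype_compl, Fintype.card_subtype_eq, Nat.sub_sub] at h1
    rw [← h1]
    have hinj : Set.InjOn (fun (η : W → V) (i : {i // i ≠ b}) => η i)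
        (Finset.univ.filter fun η : W → V => η a = η b) := by
      intro η hη θ hθ hηθ
      simp only [Finset.coe_filter, Finset.mem_univ, true_and, Set.mem_ofPred_eq] at hη hθ
      have h2 : ∀ i ≠ b, η i = θ i := fun i hi => congrFun hηθ ⟨i, hi⟩
      ext i
      by_cases hi : i = b
      · rw [hi, ← hη, ← hθ, h2 a hab]
      · rw [h2 i hi]
    rw [← Finset.sum_image (f := fun η : {i // i ≠ b} → V => h (η ⟨l, hbl.symm⟩)) hinj]
    exact Finset.sum_le_sum_of_subset (Finset.subset_univ _)
  by_cases hbl : b = l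
  · have := key b a hab.symm (by rw [← hbl]; exact hab)
    simpa only [eq_comm] using this
  · exact key a b hab hbl

/-- Over all maps, injective or not, the coordinates are independent, so the sum factorizes once the
vertex `l` that carries the term `d (η l) - 1` is fixed. Multiplying by `card V` keeps a truncated
exponent out of the statement. -/
lemma sum_copyWeight {F : RootedGraph W} {R : ℕ} (d : V → ℕ) :
    (∑ η : W → V, copyWeight F R d η) * Fintype.card V =
      (F.inner R)ᶜ.card * (∏ i ∈ F.inner R, (Finset.univ.filter fun x => d x = deg F.graph i).card) *
        (∑ x, (d x - 1)) * Fintype.card V ^ (F.inner R)ᶜ.card := by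
  classical
  set g : W → W → V → ℕ := fun l i x => if i ∈ F.inner R then (if d x = deg F.graph i then 1 else 0)
    else if i = l then d x - 1 else 1 with hg
  have h1 : ∀ η : W → V, copyWeight F R d η = ∑ l ∈ (F.inner R)ᶜ, ∏ i, g l i (η i) := by
    intro η
    rw [copyWeight]
    split_ifs with h
    · refine Finset.sum_congr rfl fun l hl => ?_
      have hl := Finset.mem_compl.1 hl
      rw [Finset.prod_eq_single l]
      · simp [hg, hl]
      · intro i _ hi
        by_cases hiI : i ∈ F.inner R
        · simp [hg, hiI, h i hiI]
        · simp [hg, hiI, hi]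
      · simp
    · push Not at h
      obtain ⟨i, hi, hne⟩ := h
      refine (Finset.sum_eq_zero fun l _ => Finset.prod_eq_zero (Finset.mem_univ i) ?_).symm
      simp [hg, hi, hne]
  have h2 : ∀ l ∈ (F.inner R)ᶜ, (∑ η : W → V, ∏ i, g l i (η i)) * Fintype.card V =
      (∏ i ∈ F.inner R, (Finset.univ.filter fun x => d x = deg F.graph i).card) *
        (∑ x, (d x - 1)) * Fintype.card V ^ (F.inner R)ᶜ.card := by
    intro l hl
    rw [← Fintype.piFinset_univ, ← Finset.prod_univ_sum (fun _ => Finset.univ) (g l),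
      ← Finset.prod_mul_prod_compl (F.inner R), ← Finset.mul_prod_erase _ _ hl]
    have h3 : ∏ i ∈ F.inner R, ∑ x, g l i x =
        ∏ i ∈ F.inner R, (Finset.univ.filter fun x => d x = deg F.graph i).card :=
      Finset.prod_congr rfl fun i hi => by simp [hg, hi]
    have h4 : ∏ i ∈ (F.inner R)ᶜ.erase l, ∑ x, g l i x =
        Fintype.card V ^ ((F.inner R)ᶜ.card - 1) := by
      rw [Finset.prod_congr rfl (g := fun _ => Fintype.card V), Finset.prod_const,
        Finset.card_erase_of_mem hl]
      intro i hi
      have h5 := Finset.mem_compl.1 (Finset.mem_of_mem_erase hi)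
      simp [hg, h5, Finset.ne_of_mem_erase hi]
    have h6 : ∑ x, g l l x = ∑ x, (d x - 1) := by
      simp [hg, Finset.mem_compl.1 hl]
    have h7 : 0 < (F.inner R)ᶜ.card := Finset.card_pos.2 ⟨l, hl⟩
    rw [h3, h4, h6, mul_assoc, mul_assoc, mul_assoc, ← pow_succ, Nat.sub_add_cancel h7]
  simp_rw [h1]
  rw [Finset.sum_comm, Finset.sum_mul, Finset.sum_congr rfl h2, Finset.sum_const, smul_eq_mul]
  ring

/-- The weight of a non-injective map is at most a sum over triples of a collision `(a, b)` and a
vertex `l`. Each of the `card W ^ 3` triples contributes one power of `card V` less than the main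
term. -/
lemma sum_copyWeight_le_add [DecidablePred (Function.Injective : (W → V) → Prop)]
    {F : RootedGraph W} {R : ℕ} (d : V → ℕ) :
    ∑ η : W → V, copyWeight F R d η ≤
      ∑ η : W → V with Function.Injective η, copyWeight F R d η +
        Fintype.card W ^ 3 * ((∑ x, (d x - 1)) * Fintype.card V ^ (Fintype.card W - 2)) := by
  classical
  rw [← Finset.sum_filter_add_sum_filter_not _ (fun η : W → V => Function.Injective η)]
  refine Nat.add_le_add_left ?_ _
  have h1 : ∀ η ∈ Finset.univ.filter (fun η : W → V => ¬ Function.Injective η),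
      copyWeight F R d η ≤ ∑ p : (W × W) × W,
        if p.1.1 ≠ p.1.2 ∧ η p.1.1 = η p.1.2 then d (η p.2) - 1 else 0 := by
    intro η hη
    have hη : ¬ Function.Injective η := by simpa using hη
    simp only [Function.Injective, not_forall] at hη
    obtain ⟨a, b, hab, hne⟩ := hη
    have h2 : copyWeight F R d η ≤ ∑ l, (d (η l) - 1) := by
      rw [copyWeight]
      split_ifs
      · exact Finset.sum_le_sum_of_subset (Finset.subset_univ _)
      · exact Nat.zero_le _
    refine h2.trans ?_
    rw [Fintype.sum_prod_type]
    refine le_trans ?_ (Finset.single_le_sum (f := fun p : W × W => ∑ l : W,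
      if p.1 ≠ p.2 ∧ η p.1 = η p.2 then d (η l) - 1 else 0) (fun _ _ => Nat.zero_le _)
      (Finset.mem_univ (a, b)))
    simp [hne, hab]
  have h2 : (Finset.univ.filter (fun η : W → V => ¬ Function.Injective η)) ⊆ Finset.univ :=
    Finset.subset_univ _
  refine (Finset.sum_le_sum h1).trans ((Finset.sum_le_sum_of_subset h2).trans ?_)
  rw [Finset.sum_comm]
  have h3 : ∀ p ∈ (Finset.univ : Finset ((W × W) × W)), ∑ η : W → V,
      (if p.1.1 ≠ p.1.2 ∧ η p.1.1 = η p.1.2 then d (η p.2) - 1 else 0) ≤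
      (∑ x, (d x - 1)) * Fintype.card V ^ (Fintype.card W - 2) := by
    rintro ⟨⟨a, b⟩, l⟩ -
    by_cases hab : a = b
    · simp [hab]
    · simp only [ne_eq, hab, not_false_eq_true, true_and]
      rw [← Finset.sum_filter]
      exact sum_collision_le (fun x => d x - 1) hab
  refine (Finset.sum_le_card_nsmul _ _ _ h3).trans ?_
  rw [Finset.card_univ, Fintype.card_prod, Fintype.card_prod, smul_eq_mul]
  exact le_of_eq (by ring)

lemma tendsto_factorial_ratio (p : ℕ) : Tendsto
    (fun n : ℕ => ((n - (p + 2))! * (n : ℝ) ^ p / (n - 2)! : ℝ)) atTop (𝓝 1) := by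
  induction p with
  | zero =>
    refine tendsto_const_nhds.congr fun n => ?_
    have : ((n - 2)! : ℝ) ≠ 0 := by positivity
    simp [this]
  | succ p ih =>
    have h1 : Tendsto (fun n : ℕ => (n : ℝ) / (n + (-(p + 2) : ℝ))) atTop (𝓝 1) :=
      tendsto_natCast_div_add_atTop _
    rw [← one_mul (1 : ℝ)]
    refine (ih.mul h1).congr' ?_
    filter_upwards [eventually_gt_atTop (p + 2)] with n hn
    obtain ⟨k, rfl⟩ := Nat.exists_eq_add_of_lt hn
    have h2 : p + 2 + k + 1 - (p + 2) = k + 1 := by omega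
    have h3 : p + 2 + k + 1 - (p + 1 + 2) = k := by omega
    rw [h2, h3, Nat.factorial_succ]
    have h4 : ((p + 2 + k + 1 : ℕ) : ℝ) + (-(p + 2) : ℝ) = k + 1 := by push_cast; ring
    rw [h4]
    have : ((k : ℝ) + 1) ≠ 0 := by positivity
    push_cast
    field_simp
    ring

end Asymptotics

/-! ### Concentration for uniform trees with given degrees -/

section Concentration

lemma two_le_card_of_isDeepTree {W : Type} [Fintype W] {F : RootedGraph W} {R : ℕ}
    (hF : F.IsDeepTree R) (hR : 0 < R) : 2 ≤ Fintype.card W := by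
  obtain ⟨u, hu⟩ := hF.2.2
  have : F.root ≠ u := by
    rintro rfl
    have h : F.graph.edist F.root F.root = R := hu
    rw [SimpleGraph.edist_self] at h
    exact hR.ne (by exact_mod_cast h)
  exact Fintype.one_lt_card_iff.2 ⟨_, _, this⟩

variable {X W : Type} [Fintype W] [DecidableEq W] {l : Filter X} {n : X → ℕ}
  {d : ∀ x, Fin (n x) → ℕ} {q : ℕ → ℝ} {F : RootedGraph W} {R : ℕ}

lemma sum_treeDegSeqs_sub_one {n : ℕ} (hn : 2 ≤ n) {d : Fin n → ℕ} (hd : d ∈ treeDegSeqs n) :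
    ∑ i, (d i - 1) = n - 2 := by
  rw [Finset.sum_tsub_distrib _ fun i _ => one_le_treeDegSeqs hn hd i]
  have := sum_treeDegSeqs hd
  simp
  omega

lemma tendsto_sub_two_div (hn : Tendsto n l atTop) :
    Tendsto (fun x => ((n x - 2 : ℕ) : ℝ) / n x) l (𝓝 1) := by
  have h1 : Tendsto (fun k : ℕ => ((k - 2 : ℕ) : ℝ) / k) atTop (𝓝 1) := by
    have h2 : Tendsto (fun k : ℕ => 1 - 2 * (k : ℝ)⁻¹) atTop (𝓝 (1 - 2 * 0)) :=
      tendsto_const_nhds.sub (tendsto_inv_atTop_nhds_zero_nat.const_mul 2)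
    rw [mul_zero, sub_zero] at h2
    refine h2.congr' ?_
    filter_upwards [eventually_ge_atTop 2] with k hk
    rw [Nat.cast_sub hk]
    have : (k : ℝ) ≠ 0 := by
      have : k ≠ 0 := by omega
      exact_mod_cast this
    field_simp
    norm_num
  exact h1.comp hn

lemma tendsto_sum_copyWeight (hn : Tendsto n l atTop) (hd : ∀ x, d x ∈ treeDegSeqs (n x))
    (hq : ∀ k, Tendsto (fun x => ((Finset.univ.filter fun i => d x i = k).card : ℝ) / n x) l
      (𝓝 (q k))) :
    Tendsto (fun x => ((∑ η : W → Fin (n x), copyWeight F R (d x) η : ℕ) : ℝ) /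
      (n x : ℝ) ^ Fintype.card W) l
      (𝓝 ((F.inner R)ᶜ.card * ∏ i ∈ F.inner R, q (deg F.graph i))) := by
  have h1 : Tendsto (fun x => ((F.inner R)ᶜ.card : ℝ) *
      (∏ i ∈ F.inner R, ((Finset.univ.filter fun j => d x j = deg F.graph i).card : ℝ) / n x) *
        (((n x - 2 : ℕ) : ℝ) / n x)) l
      (𝓝 ((F.inner R)ᶜ.card * (∏ i ∈ F.inner R, q (deg F.graph i)) * 1)) :=
    ((tendsto_finsetProd _ fun i _ => hq _).const_mul _).mul (tendsto_sub_two_div hn)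
  rw [mul_one] at h1
  refine h1.congr' ?_
  filter_upwards [hn.eventually_ge_atTop 2] with x hx
  have h2 := sum_copyWeight (F := F) (R := R) (d x)
  rw [sum_treeDegSeqs_sub_one hx (hd x), Fintype.card_fin] at h2
  have h3 : (F.inner R).card + (F.inner R)ᶜ.card = Fintype.card W := Finset.card_add_card_compl _
  have hx0 : (n x : ℝ) ≠ 0 := by
    have : n x ≠ 0 := by omega
    exact_mod_cast this
  rw [← h3, Finset.prod_div_distrib, Finset.prod_const, pow_add, eq_div_iff (by positivity)]
  have h4 := congrArg (Nat.cast : ℕ → ℝ) h2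
  rw [Nat.cast_mul, Nat.cast_mul, Nat.cast_mul, Nat.cast_mul, Nat.cast_prod, Nat.cast_pow] at h4
  field_simp
  linear_combination -h4

lemma tendsto_sum_copyWeight_injective (hn : Tendsto n l atTop)
    (hd : ∀ x, d x ∈ treeDegSeqs (n x))
    (hq : ∀ k, Tendsto (fun x => ((Finset.univ.filter fun i => d x i = k).card : ℝ) / n x) l
      (𝓝 (q k))) (hW : 2 ≤ Fintype.card W)
    [∀ x, DecidablePred (Function.Injective : (W → Fin (n x)) → Prop)] :
    Tendsto (fun x => ((∑ η : W → Fin (n x) with Function.Injective η,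
      copyWeight F R (d x) η : ℕ) : ℝ) / (n x : ℝ) ^ Fintype.card W) l
      (𝓝 ((F.inner R)ᶜ.card * ∏ i ∈ F.inner R, q (deg F.graph i))) := by
  have h1 := tendsto_sum_copyWeight (F := F) (R := R) hn hd hq
  have h2 : Tendsto (fun x => (Fintype.card W : ℝ) ^ 3 * (n x : ℝ)⁻¹) l (𝓝 (_ * 0)) :=
    (tendsto_inv_atTop_nhds_zero_nat.comp hn).const_mul _
  have h3 := h1.sub h2
  rw [mul_zero, sub_zero] at h3
  refine tendsto_of_tendsto_of_tendsto_of_le_of_le' h3 h1 ?_ ?_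
  · filter_upwards [hn.eventually_ge_atTop 2] with x hx
    have h4 := sum_copyWeight_le_add (F := F) (R := R) (d x)
    rw [sum_treeDegSeqs_sub_one hx (hd x), Fintype.card_fin] at h4
    obtain ⟨m, hm⟩ := Nat.exists_eq_add_of_le hW
    have hx0 : (0 : ℝ) < n x := by
      have : 0 < n x := by omega
      exact_mod_cast this
    rw [sub_le_iff_le_add, div_add' _ _ _ (by positivity), div_le_div_iff_of_pos_right (by positivity)]
    have h5 : ((∑ η : W → Fin (n x), copyWeight F R (d x) η : ℕ) : ℝ) ≤
        (∑ η : W → Fin (n x) with Function.Injective η, copyWeight F R (d x) η : ℕ) +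
        (Fintype.card W : ℝ) ^ 3 * (((n x - 2 : ℕ) : ℝ) * (n x : ℝ) ^ (Fintype.card W - 2)) := by
      exact_mod_cast h4
    refine h5.trans (add_le_add_right ?_ _)
    rw [mul_assoc]
    refine mul_le_mul_of_nonneg_left ?_ (by positivity)
    rw [hm, Nat.add_sub_cancel_left, pow_add]
    have h6 : ((n x - 2 : ℕ) : ℝ) ≤ n x := by exact_mod_cast Nat.sub_le _ _
    calc ((n x - 2 : ℕ) : ℝ) * (n x : ℝ) ^ m ≤ n x * (n x : ℝ) ^ m := by gcongr
      _ = (n x : ℝ)⁻¹ * ((n x : ℝ) ^ 2 * (n x : ℝ) ^ m) := by field_simp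
  · filter_upwards with x
    gcongr
    exact Finset.filter_subset _ _

/-- The limit of the neighbourhood statistics for a degree distribution with masses `q`. -/
def limitValue (q : ℕ → ℝ) (F : RootedGraph W) (R : ℕ) : ℝ :=
  innerFactorial F R / F.numAut * ((F.inner R)ᶜ.card * ∏ i ∈ F.inner R, q (deg F.graph i))

/-- With `card W = p + 2` the factor `N ! / (n - 2)!` is of order `n ^ (-(p + 1))`, and the weighted
sum over placements is of order `n ^ (p + 2)`. The count is thus linear in `n`. -/
lemma tendsto_mean_ballCount (hn : Tendsto n l atTop) (hd : ∀ x, d x ∈ treeDegSeqs (n x))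
    (hq : ∀ k, Tendsto (fun x => ((Finset.univ.filter fun i => d x i = k).card : ℝ) / n x) l
      (𝓝 (q k))) (hF : F.IsDeepTree R) (hR : 0 < R) :
    Tendsto (fun x => (∑ T ∈ treeFinset (d x), (ballCount F R T : ℝ) / n x) /
      (treeFinset (d x)).card) l (𝓝 (limitValue q F R)) := by
  classical
  have hW := two_le_card_of_isDeepTree hF hR
  have h1 := tendsto_sum_copyWeight_injective (F := F) (R := R) hn hd hq hW
  obtain ⟨p, hp⟩ := Nat.exists_eq_add_of_le hW
  have h2 := (tendsto_factorial_ratio (p + 1)).comp hn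
  have h3 := (h2.const_mul ((innerFactorial F R : ℝ) / F.numAut)).mul h1
  rw [mul_one] at h3
  refine h3.congr' ?_
  filter_upwards [hn.eventually_ge_atTop (p + 4)] with x hx
  have h4 := sum_ballCount (by omega) (hd x) hF hR (N := n x - (p + 1 + 2)) (by omega)
  have hT : ((treeFinset (d x)).card : ℝ) ≠ 0 := by
    obtain ⟨T, hT⟩ := hd x
    exact_mod_cast (Finset.card_pos.2 ⟨T, mem_treeFinset.2 hT⟩).ne'
  have hx0 : (n x : ℝ) ≠ 0 := by
    have : n x ≠ 0 := by omega
    exact_mod_cast this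
  have hA : (F.numAut : ℝ) ≠ 0 := by exact_mod_cast F.numAut_pos.ne'
  have hfac : ((n x - 2)! : ℝ) ≠ 0 := by positivity
  have h5 := congrArg (Nat.cast : ℕ → ℝ) h4
  simp only [Nat.cast_mul] at h5
  rw [Nat.cast_sum (treeFinset (d x))] at h5
  rw [← Finset.sum_div, Function.comp_apply, hp]
  rw [eq_div_iff hT, eq_div_iff hx0]
  field_simp
  rw [add_comm 2 p]
  linear_combination (-(n x : ℝ) ^ (p + 2)) * h5

/-- Disjoint pairs already give `limitValue q F R ^ 2` in the limit. By uniform integrability few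
vertices have a large `2 * R`-ball, so overlapping pairs cost at most `ε / 2 * n ^ 2` up to the
factor `numAut ^ 2`. -/
lemma eventually_sq_mean_ballCount_le (hn : Tendsto n l atTop)
    (hd : ∀ x, d x ∈ treeDegSeqs (n x))
    (hq : ∀ k, Tendsto (fun x => ((Finset.univ.filter fun i => d x i = k).card : ℝ) / n x) l
      (𝓝 (q k))) (hUI : UnifIntegrableAlong l d) (hF : F.IsDeepTree R) (hR : 0 < R)
    {ε : ℝ} (hε : 0 < ε) :
    ∀ᶠ x in l, (∑ T ∈ treeFinset (d x), ((ballCount F R T : ℝ) / n x) ^ 2) /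
      (treeFinset (d x)).card ≤ limitValue q F R ^ 2 + ε := by
  classical
  have hW := two_le_card_of_isDeepTree hF hR
  obtain ⟨p, hp⟩ := Nat.exists_eq_add_of_le hW
  obtain ⟨M, hM⟩ := tight_bigBalls hUI (2 * R) (ε / 4) (by positivity)
  have h1 := (tendsto_sum_copyWeight (F := F) (R := R) hn hd hq).pow 2
  have h2 := (tendsto_factorial_ratio (2 * p + 2)).comp hn
  have h3 := ((h2.const_mul (((innerFactorial F R : ℝ) / F.numAut) ^ 2)).mul h1).eventually_le_const
    (u := limitValue q F R ^ 2 + ε / 2) (by rw [mul_one, ← mul_pow, ← limitValue]; linarith)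
  have h4 : ∀ᶠ x in l, (M : ℝ) * (n x : ℝ)⁻¹ ≤ ε / 4 := by
    have : Tendsto (fun x => (M : ℝ) * (n x : ℝ)⁻¹) l (𝓝 (M * 0)) :=
      (tendsto_inv_atTop_nhds_zero_nat.comp hn).const_mul _
    exact this.eventually_le_const (by rw [mul_zero]; positivity)
  filter_upwards [h3, h4, hM, hn.eventually_ge_atTop (2 * p + 4)] with x h3 h4 hM hx
  -- Small balls contribute at most `M` each; the big ones, at most `ε / 4 * n` in number, at most
  -- `n` each.
  set B := n x * M + ⌊ε / 4 * n x⌋₊ * n x with hB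
  have hBx : ∀ T ∈ treeFinset (d x), ∑ v, {u | T.edist v u ≤ (2 * R : ℕ)}.ncard ≤ B := by
    intro T hT
    refine (sum_ncard_ball_le T (2 * R) M).trans ?_
    rw [Fintype.card_fin]
    exact Nat.add_le_add_left (Nat.mul_le_mul_right _
      (Nat.le_floor (hM T (mem_treeFinset.1 hT).2))) _
  have h5 := sum_ballCount_sq_le (by omega) (hd x) hF hR (N := n x - (2 * p + 2 + 2)) (by omega) hBx
  have hT : (0 : ℝ) < (treeFinset (d x)).card := by
    obtain ⟨T, hT⟩ := hd x
    exact_mod_cast Finset.card_pos.2 ⟨T, mem_treeFinset.2 hT⟩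
  have hx0 : (0 : ℝ) < n x := by
    have : 0 < n x := by omega
    exact_mod_cast this
  have hA : (0 : ℝ) < F.numAut := by exact_mod_cast F.numAut_pos
  have hfac : (0 : ℝ) < (n x - 2)! := by positivity
  have h6 : (B : ℝ) ≤ (ε / 2) * (n x : ℝ) ^ 2 := by
    have h7 : (⌊ε / 4 * n x⌋₊ : ℝ) ≤ ε / 4 * n x := Nat.floor_le (by positivity)
    have h8 : (M : ℝ) ≤ ε / 4 * n x := by
      rwa [← div_eq_mul_inv, div_le_iff₀ hx0] at h4
    rw [hB]
    push_cast
    nlinarith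
  have h7 : (F.numAut : ℝ) ^ 2 * (∑ T ∈ treeFinset (d x), (ballCount F R T : ℝ) ^ 2) * (n x - 2)! ≤
      (treeFinset (d x)).card * ((n x - (2 * p + 2 + 2))! * (innerFactorial F R : ℝ) ^ 2 *
        ((∑ η : W → Fin (n x), copyWeight F R (d x) η : ℕ) : ℝ) ^ 2 +
          (F.numAut : ℝ) ^ 2 * B * (n x - 2)!) := by
    exact_mod_cast h5
  simp_rw [div_pow]
  rw [← Finset.sum_div, div_div, div_le_iff₀ (by positivity)]
  rw [Function.comp_apply, hp] at h3
  set S : ℝ := ((∑ η : W → Fin (n x), copyWeight F R (d x) η : ℕ) : ℝ)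
  set Y : ℝ := ∑ T ∈ treeFinset (d x), (ballCount F R T : ℝ) ^ 2
  set t : ℝ := ((treeFinset (d x)).card : ℝ)
  set f : ℝ := ((n x - 2)! : ℝ)
  set g : ℝ := ((n x - (2 * p + 2 + 2))! : ℝ)
  set a : ℝ := (F.numAut : ℝ)
  set c : ℝ := (innerFactorial F R : ℝ)
  have h8 : (c / a) ^ 2 * (g * (n x : ℝ) ^ (2 * p + 2) / f) * (S / (n x : ℝ) ^ (2 + p)) ^ 2 =
      g * c ^ 2 * S ^ 2 / (a ^ 2 * f * (n x : ℝ) ^ 2) := by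
    rw [div_pow, div_pow, ← pow_mul, show (2 + p) * 2 = 2 * p + 2 + 2 by ring,
      pow_add _ (2 * p + 2) 2]
    field_simp
  rw [h8, div_le_iff₀ (by positivity)] at h3
  refine le_of_mul_le_mul_left (a := a ^ 2 * f) ?_ (by positivity)
  calc a ^ 2 * f * Y = a ^ 2 * Y * f := by ring
    _ ≤ t * (g * c ^ 2 * S ^ 2 + a ^ 2 * B * f) := h7
    _ ≤ t * ((limitValue q F R ^ 2 + ε / 2) * (a ^ 2 * f * (n x : ℝ) ^ 2) +
        a ^ 2 * ((ε / 2) * (n x : ℝ) ^ 2) * f) := by gcongr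
    _ = a ^ 2 * f * ((limitValue q F R ^ 2 + ε) * ((n x : ℝ) ^ 2 * t)) := by ring

/-- The neighbourhood statistics of the uniform tree with degree sequence `d x` are
concentrated around their limit. -/
theorem tendsto_deviation (hn : Tendsto n l atTop)
    (hd : ∀ x, d x ∈ treeDegSeqs (n x))
    (hq : ∀ k, Tendsto (fun x => ((Finset.univ.filter fun i => d x i = k).card : ℝ) / n x) l
      (𝓝 (q k))) (hUI : UnifIntegrableAlong l d) (hF : F.IsDeepTree R) (hR : 0 < R)
    {ε : ℝ} (hε : 0 < ε) :
    Tendsto (fun x => (((treeFinset (d x)).filter fun T =>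
      ε < |(ballCount F R T : ℝ) / n x - limitValue q F R|).card : ℝ) /
        (treeFinset (d x)).card) l (𝓝 0) := by
  set L := limitValue q F R with hL
  have h1 := tendsto_mean_ballCount hn hd hq hF hR
  rw [← hL] at h1
  rw [Metric.tendsto_nhds]
  intro δ hδ
  -- For Chebyshev's inequality: the bounds on the two moments cost `δ'` each, so the mean square
  -- deviation from `L` is at most `2 * δ'`, less than `δ * ε ^ 2`.
  set δ' := δ * ε ^ 2 / 4 with hδ'
  have hδ'0 : 0 < δ' := by positivity
  have h2 := eventually_sq_mean_ballCount_le hn hd hq hUI hF hR hδ'0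
  rw [← hL] at h2
  have h3 := (h1.const_mul (-(2 * L))).eventually_le_const (u := -(2 * L) * L + δ') (by linarith)
  filter_upwards [h2, h3] with x h2 h3
  have hT : (0 : ℝ) < (treeFinset (d x)).card := by
    obtain ⟨T, hT⟩ := hd x
    exact_mod_cast Finset.card_pos.2 ⟨T, mem_treeFinset.2 hT⟩
  rw [Real.dist_eq, sub_zero, abs_of_nonneg (by positivity), div_lt_iff₀ hT]
  rw [div_le_iff₀ hT] at h2
  rw [← mul_div_assoc, div_le_iff₀ hT] at h3
  have h4 : ε ^ 2 * (((treeFinset (d x)).filter fun T =>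
      ε < |(ballCount F R T : ℝ) / n x - L|).card : ℝ) ≤
      ∑ T ∈ treeFinset (d x), ((ballCount F R T : ℝ) / n x - L) ^ 2 := by
    rw [mul_comm, ← nsmul_eq_mul]
    refine (Finset.card_nsmul_le_sum _ (fun T => ((ballCount F R T : ℝ) / n x - L) ^ 2) _
      fun T hT => ?_).trans (Finset.sum_le_sum_of_subset_of_nonneg (Finset.filter_subset _ _)
        fun _ _ _ => sq_nonneg _)
    rw [← sq_abs (_ - L)]
    have := (Finset.mem_filter.1 hT).2
    gcongr
  have h5 : ∑ T ∈ treeFinset (d x), ((ballCount F R T : ℝ) / n x - L) ^ 2 =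
      ∑ T ∈ treeFinset (d x), ((ballCount F R T : ℝ) / n x) ^ 2 +
        -(2 * L) * (∑ T ∈ treeFinset (d x), (ballCount F R T : ℝ) / n x) +
          L ^ 2 * (treeFinset (d x)).card := by
    rw [Finset.mul_sum, ← Finset.sum_add_distrib, mul_comm (L ^ 2), ← nsmul_eq_mul,
      ← Finset.sum_const, ← Finset.sum_add_distrib]
    exact Finset.sum_congr rfl fun T _ => by ring
  have h6 : ε ^ 2 * (((treeFinset (d x)).filter fun T =>
      ε < |(ballCount F R T : ℝ) / n x - L|).card : ℝ) <
      ε ^ 2 * (δ * (treeFinset (d x)).card) := by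
    calc _ ≤ _ := h4
      _ ≤ (2 * δ') * (treeFinset (d x)).card := by rw [h5]; linarith
      _ < (4 * δ') * (treeFinset (d x)).card := by gcongr; norm_num
      _ = _ := by rw [hδ']; ring
  exact lt_of_mul_lt_mul_left (a := ε ^ 2) h6 (by positivity)

end Concentration

/-! ### Mean two and uniform integrability -/

section MeanDegree

variable {X : Type*} {l : Filter X} {n : X → ℕ} {d : ∀ x, Fin (n x) → ℕ} {q : ℕ → ℝ}

lemma sum_range_mul_card_add_tailSum {V : Type} [Fintype V] (d : V → ℕ) (K : ℕ) :
    ∑ k ∈ Finset.range (K + 1), k * (Finset.univ.filter fun v => d v = k).card + tailSum d K =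
      ∑ v, d v := by
  rw [← Finset.sum_filter_not_add_sum_filter _ (fun v => K < d v), tailSum]
  congr 1
  rw [← Finset.sum_fiberwise_of_maps_to (t := Finset.range (K + 1)) (g := d)]
  · refine Finset.sum_congr rfl fun k hk => ?_
    have hk := Finset.mem_range.1 hk
    rw [Finset.filter_filter, Finset.sum_congr rfl (g := fun _ => k), Finset.sum_const, smul_eq_mul,
      mul_comm]
    · congr 2
      ext v
      simp only [Finset.mem_filter, Finset.mem_univ, true_and]
      omega
    · intro v hv
      exact (Finset.mem_filter.1 hv).2.2
  · intro v hv
    have := (Finset.mem_filter.1 hv).2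
    simp only [Finset.mem_range]
    omega

/-- The average degree of a tree is `2 - 2 / n`, so whatever the degrees up to `K` do not account
for is in the tail. This makes small tails and mean two equivalent in the limit. -/
lemma tailSum_div_eq {n : ℕ} (hn : 0 < n) {d : Fin n → ℕ} (hd : d ∈ treeDegSeqs n) (K : ℕ) :
    (tailSum d K : ℝ) / n = 2 - 2 / n - ∑ k ∈ Finset.range (K + 1),
      (k : ℝ) * (((Finset.univ.filter fun v => d v = k).card : ℝ) / n) := by
  have h1 := sum_range_mul_card_add_tailSum d K
  have h2 := sum_treeDegSeqs hd
  rw [← h1] at h2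
  have h3 := congrArg (Nat.cast : ℕ → ℝ) h2
  push_cast at h3
  have : (n : ℝ) ≠ 0 := by exact_mod_cast hn.ne'
  simp_rw [← mul_div_assoc]
  rw [← Finset.sum_div]
  field_simp
  linarith

lemma tendsto_tailSum_div (hn : Tendsto n l atTop) (hd : ∀ x, d x ∈ treeDegSeqs (n x))
    (hq : ∀ k, Tendsto (fun x => ((Finset.univ.filter fun i => d x i = k).card : ℝ) / n x) l
      (𝓝 (q k))) (K : ℕ) :
    Tendsto (fun x => (tailSum (d x) K : ℝ) / n x) l
      (𝓝 (2 - ∑ k ∈ Finset.range (K + 1), k * q k)) := by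
  have h1 : Tendsto (fun x => (2 : ℝ) - 2 * (n x : ℝ)⁻¹ - ∑ k ∈ Finset.range (K + 1),
      (k : ℝ) * (((Finset.univ.filter fun v => d x v = k).card : ℝ) / n x)) l
      (𝓝 (2 - 2 * 0 - ∑ k ∈ Finset.range (K + 1), k * q k)) :=
    (tendsto_const_nhds.sub ((tendsto_inv_atTop_nhds_zero_nat.comp hn).const_mul 2)).sub
      (tendsto_finsetSum _ fun k _ => (hq k).const_mul _)
  rw [mul_zero, sub_zero] at h1
  refine h1.congr' ?_
  filter_upwards [hn.eventually_gt_atTop 0] with x hx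
  rw [tailSum_div_eq hx (hd x), div_eq_mul_inv 2]

/-- Mean two in the limit makes the degrees uniformly integrable. -/
theorem unifIntegrableAlong_of_hasSum (hn : Tendsto n l atTop)
    (hd : ∀ x, d x ∈ treeDegSeqs (n x))
    (hq : ∀ k, Tendsto (fun x => ((Finset.univ.filter fun i => d x i = k).card : ℝ) / n x) l
      (𝓝 (q k))) (hmean : HasSum (fun k : ℕ => (k : ℝ) * q k) 2) : UnifIntegrableAlong l d := by
  intro ε hε
  have h1 := (hmean.tendsto_sum_nat.comp (tendsto_add_atTop_nat 1)).eventually_const_lt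
    (u := 2 - ε) (by linarith)
  obtain ⟨K, hK⟩ := h1.exists
  rw [Function.comp_apply] at hK
  refine ⟨K, ?_⟩
  filter_upwards [(tendsto_tailSum_div hn hd hq K).eventually_le_const (u := ε) (by linarith),
    hn.eventually_gt_atTop 0] with x hx hx0
  rwa [div_le_iff₀ (by exact_mod_cast hx0)] at hx

/-- Uniform integrability of the degrees makes the limit have mean two. -/
theorem hasSum_of_unifIntegrableAlong [l.NeBot] (hn : Tendsto n l atTop)
    (hd : ∀ x, d x ∈ treeDegSeqs (n x)) (hq0 : ∀ k, 0 ≤ q k)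
    (hq : ∀ k, Tendsto (fun x => ((Finset.univ.filter fun i => d x i = k).card : ℝ) / n x) l
      (𝓝 (q k))) (hUI : UnifIntegrableAlong l d) : HasSum (fun k : ℕ => (k : ℝ) * q k) 2 := by
  have hnn : ∀ k : ℕ, 0 ≤ (k : ℝ) * q k := fun k => mul_nonneg (Nat.cast_nonneg k) (hq0 k)
  have hle : ∀ K, ∑ k ∈ Finset.range (K + 1), (k : ℝ) * q k ≤ 2 := by
    intro K
    have := ge_of_tendsto' (tendsto_tailSum_div hn hd hq K) (b := 0) fun x => by positivity
    linarith
  rw [hasSum_iff_tendsto_nat_of_nonneg hnn, ← tendsto_add_atTop_iff_nat 1, Metric.tendsto_atTop]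
  intro ε hε
  obtain ⟨K, hK⟩ := hUI (ε / 2) (by positivity)
  refine ⟨K, fun L hL => ?_⟩
  have h1 : 2 - ∑ k ∈ Finset.range (K + 1), (k : ℝ) * q k ≤ ε / 2 := by
    refine le_of_tendsto (tendsto_tailSum_div hn hd hq K) ?_
    filter_upwards [hK, hn.eventually_gt_atTop 0] with x hx hx0
    rwa [div_le_iff₀ (by exact_mod_cast hx0)]
  have h2 : ∑ k ∈ Finset.range (K + 1), (k : ℝ) * q k ≤ ∑ k ∈ Finset.range (L + 1), (k : ℝ) * q k :=
    Finset.sum_le_sum_of_subset_of_nonneg (Finset.range_mono (by omega)) fun k _ _ => hnn k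
  rw [Real.dist_eq, abs_lt]
  have h3 := hle L
  constructor <;> linarith

lemma mean_eq_two_iff (q : PMF ℕ) :
    mean q = 2 ↔ HasSum (fun k : ℕ => (k : ℝ) * (q k).toReal) 2 := by
  have h1 : mean q = ∑' k : ℕ, (k : ℝ≥0∞) * q k := by
    rw [mean, lintegral_countable']
    refine tsum_congr fun k => ?_
    rw [PMF.toMeasure_apply_singleton _ _ (measurableSet_singleton k)]
  have h2 : ∀ k : ℕ, (k : ℝ) * (q k).toReal = ((k : ℝ≥0∞) * q k).toReal := fun k => by
    rw [ENNReal.toReal_mul, ENNReal.toReal_natCast]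
  have h3 : ∀ k : ℕ, (k : ℝ≥0∞) * q k ≠ ∞ := fun k =>
    ENNReal.mul_ne_top (ENNReal.natCast_ne_top k) (q.apply_ne_top k)
  rw [h1]
  simp_rw [h2]
  constructor
  · intro h
    have h4 : ∑' k : ℕ, (k : ℝ≥0∞) * q k ≠ ∞ := by rw [h]; exact ENNReal.ofNat_ne_top
    have h5 := (ENNReal.hasSum_toReal h4)
    rwa [← ENNReal.tsum_toReal_eq h3, h] at h5
  · intro h
    have h4 := h.summable
    have h5 : ∑' k : ℕ, (k : ℝ≥0∞) * q k = ENNReal.ofReal 2 := by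
      rw [← h.tsum_eq, ENNReal.ofReal_tsum_of_nonneg (fun _ => ENNReal.toReal_nonneg) h4]
      exact tsum_congr fun k => (ENNReal.ofReal_toReal (h3 k)).symm
    rw [h5]
    exact ENNReal.ofReal_ofNat 2

end MeanDegree

/-! ### Convergence in probability as convergence along a filter -/

section HighProbability

variable {α : ℕ → Type*}

/-- The sets that contain a random element with law `τ n` with a probability that tends to one. -/
def whp (τ : ∀ n, PMF (α n)) : Filter (Σ n, α n) where
  sets := {A | Tendsto (fun n => (τ n).toOuterMeasure {x | (⟨n, x⟩ : Σ n, α n) ∉ A}) atTop (𝓝 0)}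
  univ_sets := by simp
  sets_of_superset := by
    intro A B hA hAB
    refine tendsto_of_tendsto_of_tendsto_of_le_of_le tendsto_const_nhds hA (fun _ => zero_le)
      fun n => ?_
    exact measure_mono fun x hx hxA => hx (hAB hxA)
  inter_sets := by
    intro A B hA hB
    have h := Tendsto.add hA hB
    rw [add_zero] at h
    refine tendsto_of_tendsto_of_tendsto_of_le_of_le tendsto_const_nhds h (fun _ => zero_le)
      fun n => ?_
    refine le_trans (measure_mono fun x hx => ?_) (measure_union_le _ _)
    by_cases hxA : (⟨n, x⟩ : Σ n, α n) ∈ A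
    · exact Or.inr fun hxB => hx ⟨hxA, hxB⟩
    · exact Or.inl hxA

lemma mem_whp {τ : ∀ n, PMF (α n)} {A : Set (Σ n, α n)} : A ∈ whp τ ↔
    Tendsto (fun n => (τ n).toOuterMeasure {x | (⟨n, x⟩ : Σ n, α n) ∉ A}) atTop (𝓝 0) := Iff.rfl

lemma eventually_whp {τ : ∀ n, PMF (α n)} {P : (Σ n, α n) → Prop} : (∀ᶠ x in whp τ, P x) ↔
    Tendsto (fun n => (τ n).toOuterMeasure {x | ¬ P ⟨n, x⟩}) atTop (𝓝 0) := Iff.rfl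

lemma PMF_toOuterMeasure_univ {β : Type*} (p : PMF β) : p.toOuterMeasure Set.univ = 1 :=
  (p.toOuterMeasure_apply_eq_one_iff _).2 (Set.subset_univ _)

lemma PMF_toOuterMeasure_le_one {β : Type*} (p : PMF β) (s : Set β) : p.toOuterMeasure s ≤ 1 :=
  (measure_mono (Set.subset_univ s)).trans (PMF_toOuterMeasure_univ p).le

instance (τ : ∀ n, PMF (α n)) : (whp τ).NeBot := by
  rw [neBot_iff]
  intro h
  have h1 : (∅ : Set (Σ n, α n)) ∈ whp τ := by rw [h]; exact mem_bot
  rw [mem_whp] at h1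
  simp only [Set.mem_empty_iff_false, not_false_eq_true, Set.ofPred_true,
    PMF_toOuterMeasure_univ] at h1
  exact one_ne_zero (tendsto_nhds_unique tendsto_const_nhds h1)

lemma tendsto_fst_whp (τ : ∀ n, PMF (α n)) : Tendsto Sigma.fst (whp τ) atTop := by
  rw [tendsto_atTop]
  intro N
  rw [eventually_whp]
  refine tendsto_const_nhds.congr' ?_
  filter_upwards [eventually_ge_atTop N] with n hn
  simp [hn]

/-- Convergence in probability is ordinary convergence along `whp`, so the results above for
deterministic degrees along an arbitrary filter apply to random ones. -/
lemma tendsto_whp_iff {τ : ∀ n, PMF (α n)} {f : (Σ n, α n) → ℝ} {c : ℝ} :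
    Tendsto f (whp τ) (𝓝 c) ↔ ∀ ε : ℝ, 0 < ε →
      Tendsto (fun n => (τ n).toOuterMeasure {x | ε < |f ⟨n, x⟩ - c|}) atTop (𝓝 0) := by
  rw [Metric.tendsto_nhds]
  simp_rw [Real.dist_eq, eventually_whp, not_lt]
  constructor
  · intro h ε hε
    refine tendsto_of_tendsto_of_tendsto_of_le_of_le tendsto_const_nhds (h ε hε)
      (fun _ => zero_le) fun n => measure_mono fun x hx => ?_
    exact (show ε < |f ⟨n, x⟩ - c| from hx).le
  · intro h ε hε
    refine tendsto_of_tendsto_of_tendsto_of_le_of_le tendsto_const_nhds (h (ε / 2) (by positivity))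
      (fun _ => zero_le) fun n => measure_mono fun x hx => ?_
    exact (half_lt_self hε).trans_le (show ε ≤ |f ⟨n, x⟩ - c| from hx)

end HighProbability

/-! ### Passing from random degree sequences to random trees -/

section RandomTrees

lemma toMeasure_eq_toOuterMeasure_of_finite {V : Type} [Finite V] (p : PMF (SimpleGraph V))
    (s : Set (SimpleGraph V)) : p.toMeasure s = p.toOuterMeasure s := by
  have : MeasurableSingletonClass (SimpleGraph V) := by
    refine ⟨fun G => ?_⟩
    have : ({G} : Set (SimpleGraph V)) = ⋂ (u : V) (v : V), {H | H.Adj u v ↔ G.Adj u v} := by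
      ext H
      simp only [Set.mem_singleton_iff, Set.mem_iInter, Set.mem_ofPred_eq]
      exact ⟨fun h u v => by rw [h], fun h => by ext u v; exact h u v⟩
    rw [this]
    refine MeasurableSet.iInter fun u => MeasurableSet.iInter fun v => ?_
    have hm : Measurable fun H : SimpleGraph V => H.Adj u v :=
      SimpleGraph.measurable_iff_adj.1 measurable_id u v
    by_cases h : G.Adj u v
    · simpa [h] using measurableSet_setOfPred.2 hm
    · have h1 : {H : SimpleGraph V | H.Adj u v ↔ G.Adj u v} = {H | H.Adj u v}ᶜ := by
        ext H
        simp [h]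
      rw [h1]
      exact (measurableSet_setOfPred.2 hm).compl
  exact p.toMeasure_apply_eq_toOuterMeasure s

lemma randomWeakLimit_iff {τ : ∀ n : ℕ, PMF (SimpleGraph (Fin (n + 1)))}
    {ρ : Measure InfRootedTree} : RandomWeakLimit τ ρ ↔
      ∀ R : ℕ, 0 < R → ∀ (m : ℕ) (F : RootedGraph (Fin m)),
        Tendsto (fun x : Σ n, SimpleGraph (Fin (n + 1)) => nbhdStat R F x.2) (whp τ)
          (𝓝 (ρ.real (nbhdEvent R F))) := by
  simp_rw [RandomWeakLimit, tendsto_whp_iff, toMeasure_eq_toOuterMeasure_of_finite]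
  exact ⟨fun h R hR m F ε hε => h ε hε R hR m F, fun h ε hε R hR m F => h R hR m F ε hε⟩

variable {ν : ∀ n : ℕ, PMF (treeDegSeqs (n + 1))}

/-- If the conditional probability of failure given the degrees is small with high probability, then
so is the total probability: `ε / 2` for typical degree sequences and `ε / 2` for the others. -/
lemma eventually_whp_randomTree_of_tendsto {P : (Σ n, SimpleGraph (Fin (n + 1))) → Prop}
    (h : Tendsto (fun x : Σ n, treeDegSeqs (n + 1) =>
      (uniformTree x.2).toOuterMeasure {T | ¬ P ⟨x.1, T⟩}) (whp ν) (𝓝 0)) :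
    ∀ᶠ x in whp fun n => randomTree (ν n), P x := by
  rw [eventually_whp, ENNReal.tendsto_nhds_zero]
  intro ε hε
  have h1 := ENNReal.tendsto_nhds_zero.1 h (ε / 2) (ENNReal.half_pos hε.ne')
  rw [eventually_whp] at h1
  filter_upwards [ENNReal.tendsto_nhds_zero.1 h1 (ε / 2) (ENNReal.half_pos hε.ne')] with n hn
  rw [randomTree, PMF.toOuterMeasure_bind_apply]
  rw [PMF.toOuterMeasure_apply] at hn
  calc ∑' d, ν n d * (uniformTree d).toOuterMeasure {T | ¬ P ⟨n, T⟩}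
      ≤ ∑' d, (ν n d * (ε / 2) + Set.indicator {d | ¬ (uniformTree d).toOuterMeasure
          {T | ¬ P ⟨n, T⟩} ≤ ε / 2} (ν n) d) := by
        refine ENNReal.tsum_le_tsum fun d => ?_
        by_cases hd : (uniformTree d).toOuterMeasure {T | ¬ P ⟨n, T⟩} ≤ ε / 2
        · exact (mul_le_mul_right hd _).trans le_self_add
        · rw [Set.indicator_of_mem (by exact hd)]
          exact (mul_le_of_le_one_right' (PMF_toOuterMeasure_le_one _ _)).trans le_add_self
    _ ≤ ε / 2 + ε / 2 := by
        rw [ENNReal.tsum_add, ENNReal.tsum_mul_right, PMF.tsum_coe, one_mul]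
        gcongr
    _ = ε := ENNReal.add_halves ε

lemma uniformTree_toOuterMeasure {n : ℕ} (d : treeDegSeqs n) (P : SimpleGraph (Fin n) → Prop)
    [DecidablePred P] : (uniformTree d).toOuterMeasure {T | P T} =
      (((treeFinset d.1).filter P).card : ℝ≥0∞) / (treeFinset d.1).card := by
  classical
  rw [uniformTree, PMF.toOuterMeasure_uniformOfFinset_apply]
  congr!

lemma uniformTree_toOuterMeasure_of_forall {n : ℕ} (d : treeDegSeqs n)
    (P : SimpleGraph (Fin n) → Prop) (h : ∀ T ∈ treesWithDegrees d.1, ¬ P T) :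
    (uniformTree d).toOuterMeasure {T | P T} = 0 := by
  classical
  rw [uniformTree_toOuterMeasure, Finset.filter_false_of_mem fun T hT => h T (mem_treeFinset.1 hT)]
  simp

lemma eventually_whp_isTree : ∀ᶠ x in whp fun n => randomTree (ν n), x.2.IsTree := by
  refine eventually_whp_randomTree_of_tendsto (tendsto_const_nhds.congr fun x => ?_)
  exact (uniformTree_toOuterMeasure_of_forall _ _ fun T hT => not_not.2 hT.1).symm

lemma randomTree_toOuterMeasure_deg {n : ℕ} (ν : PMF (treeDegSeqs n)) (P : (Fin n → ℕ) → Prop) :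
    (randomTree ν).toOuterMeasure {T | P (deg T)} = ν.toOuterMeasure {d | P d.1} := by
  classical
  rw [randomTree, PMF.toOuterMeasure_bind_apply, PMF.toOuterMeasure_apply]
  refine tsum_congr fun d => ?_
  have h1 : ∀ T ∈ treesWithDegrees d.1, deg T = d.1 := fun T hT => funext hT.2
  by_cases hd : P d.1
  · rw [Set.indicator_of_mem (by exact hd),
      (PMF.toOuterMeasure_apply_eq_one_iff _ _).2, mul_one]
    intro T hT
    have hT : T ∈ treesWithDegrees d.1 := by simpa [uniformTree] using hT
    change P (deg T)
    rwa [h1 T hT]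
  · rw [Set.indicator_of_notMem (by exact hd),
      uniformTree_toOuterMeasure_of_forall d (fun T => P (deg T)), mul_zero]
    intro T hT
    rwa [h1 T hT]

lemma eventually_whp_randomTree_deg_iff {P : ∀ n, (Fin (n + 1) → ℕ) → Prop} :
    (∀ᶠ x in whp fun n => randomTree (ν n), P x.1 (deg x.2)) ↔ ∀ᶠ x in whp ν, P x.1 x.2.1 := by
  rw [eventually_whp, eventually_whp]
  simp_rw [randomTree_toOuterMeasure_deg (ν _) (fun d => ¬ P _ d)]

lemma tendsto_whp_randomTree_deg_iff {f : ∀ n, (Fin (n + 1) → ℕ) → ℝ} {c : ℝ} :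
    Tendsto (fun x : Σ n, SimpleGraph (Fin (n + 1)) => f x.1 (deg x.2))
      (whp fun n => randomTree (ν n)) (𝓝 c) ↔
    Tendsto (fun x : Σ n, treeDegSeqs (n + 1) => f x.1 x.2.1) (whp ν) (𝓝 c) := by
  simp_rw [Metric.tendsto_nhds]
  refine forall₂_congr fun ε _ => ?_
  exact eventually_whp_randomTree_deg_iff (P := fun n d => dist (f n d) c < ε)

end RandomTrees

/-! ### Exchangeable degree sequences -/

section Exchangeability

open Classical in
/-- The degree sequences of the labeled trees are finitely many. -/
instance (n : ℕ) : Fintype (treeDegSeqs n) :=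
  ((Set.finite_range fun T : SimpleGraph (Fin n) => deg T).subset (by
    rintro d ⟨T, hT⟩
    exact ⟨T, funext hT.2⟩)).fintype

/-- The expectation of a function of a random degree sequence. -/
def expect {n : ℕ} (p : PMF (treeDegSeqs n)) (f : (Fin n → ℕ) → ℝ) : ℝ :=
  ∑ d, (p d).toReal * f d.1

open Classical in
/-- The probability of an event for a random degree sequence. -/
def prob {n : ℕ} (p : PMF (treeDegSeqs n)) (P : (Fin n → ℕ) → Prop) : ℝ :=
  expect p fun d => if P d then 1 else 0

variable {n : ℕ} {p : PMF (treeDegSeqs n)}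

lemma expect_mono {f g : (Fin n → ℕ) → ℝ} (h : ∀ d, f d ≤ g d) : expect p f ≤ expect p g :=
  Finset.sum_le_sum fun _ _ => mul_le_mul_of_nonneg_left (h _) ENNReal.toReal_nonneg

lemma expect_const (c : ℝ) : expect p (fun _ => c) = c := by
  rw [expect, ← Finset.sum_mul, ← ENNReal.toReal_sum fun d _ => p.apply_ne_top d,
    (tsum_fintype _).symm.trans p.tsum_coe, ENNReal.toReal_one, one_mul]

lemma expect_add (f g : (Fin n → ℕ) → ℝ) :
    expect p (fun d => f d + g d) = expect p f + expect p g := by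
  simp [expect, mul_add, Finset.sum_add_distrib]

lemma expect_const_mul (c : ℝ) (f : (Fin n → ℕ) → ℝ) :
    expect p (fun d => c * f d) = c * expect p f := by
  rw [expect, expect, Finset.mul_sum]
  exact Finset.sum_congr rfl fun d _ => by ring

lemma expect_sum {ι : Type*} (s : Finset ι) (f : ι → (Fin n → ℕ) → ℝ) :
    expect p (fun d => ∑ i ∈ s, f i d) = ∑ i ∈ s, expect p (f i) := by
  simp_rw [expect, Finset.mul_sum]
  exact Finset.sum_comm

lemma prob_nonneg (P : (Fin n → ℕ) → Prop) : 0 ≤ prob p P := by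
  classical
  rw [← expect_const (p := p) 0]
  exact expect_mono fun d => by split_ifs <;> norm_num

lemma prob_le_one (P : (Fin n → ℕ) → Prop) : prob p P ≤ 1 := by
  classical
  rw [← expect_const (p := p) 1]
  exact expect_mono fun d => by split_ifs <;> norm_num

lemma prob_eq_toReal (P : (Fin n → ℕ) → Prop) :
    prob p P = (p.toOuterMeasure {d | P d.1}).toReal := by
  classical
  rw [PMF.toOuterMeasure_apply_fintype, ENNReal.toReal_sum, prob, expect]
  · refine Finset.sum_congr rfl fun d _ => ?_
    by_cases h : P d.1
    · rw [Set.indicator_of_mem (by exact h), if_pos h, mul_one]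
    · rw [Set.indicator_of_notMem (by exact h), if_neg h, mul_zero, ENNReal.toReal_zero]
  · intro d _
    exact ne_top_of_le_ne_top (p.apply_ne_top d) (Set.indicator_le_self _ _ _)

lemma prob_congr {P Q : (Fin n → ℕ) → Prop} (h : ∀ d, P d ↔ Q d) : prob p P = prob p Q := by
  have : P = Q := funext fun d => propext (h d)
  rw [this]

lemma Exchangeable.prob_perm (hp : Exchangeable p) (σ : Equiv.Perm (Fin n))
    (P : (Fin n → ℕ) → Prop) : prob p (fun d => P fun i => d (σ i)) = prob p P := by
  have h := congrArg (fun q : PMF (Fin n → ℕ) => q.toOuterMeasure {d | P d}) (hp σ)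
  simp only [PMF.toOuterMeasure_map_apply] at h
  rw [prob_eq_toReal, prob_eq_toReal]
  exact congrArg ENNReal.toReal h

lemma markov_prob {f : (Fin n → ℕ) → ℝ} (hf : ∀ d, 0 ≤ f d) {P : (Fin n → ℕ) → Prop} {c : ℝ}
    (h : ∀ d, P d → c ≤ f d) : c * prob p P ≤ expect p f := by
  classical
  rw [prob, ← expect_const_mul]
  refine expect_mono fun d => ?_
  by_cases hd : P d
  · simpa [hd] using h d hd
  · simpa [hd] using hf d

/-- The proportion of the entries equal to `k`. -/
def freq {n : ℕ} (k : ℕ) (d : Fin n → ℕ) : ℝ :=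
  ((Finset.univ.filter fun i => d i = k).card : ℝ) / n

lemma freq_nonneg (k : ℕ) (d : Fin n → ℕ) : 0 ≤ freq k d := by
  unfold freq; positivity

lemma freq_le_one (k : ℕ) (d : Fin n → ℕ) : freq k d ≤ 1 := by
  refine div_le_one_of_le₀ ?_ (Nat.cast_nonneg n)
  have := Finset.card_filter_le Finset.univ (fun i => d i = k)
  rw [Finset.card_univ, Fintype.card_fin] at this
  exact_mod_cast this

lemma freq_eq_sum (k : ℕ) (d : Fin n → ℕ) :
    freq k d = (n : ℝ)⁻¹ * ∑ i, if d i = k then (1 : ℝ) else 0 := by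
  rw [freq, Finset.sum_boole, div_eq_inv_mul]

lemma expect_indicator_mul_freq (P : (Fin n → ℕ) → Prop) (k : ℕ) [DecidablePred P] :
    expect p (fun d => (if P d then 1 else 0) * freq k d) =
      (n : ℝ)⁻¹ * ∑ i, prob p fun d => P d ∧ d i = k := by
  classical
  have h : ∀ d : Fin n → ℕ, (if P d then 1 else 0) * freq k d =
      (n : ℝ)⁻¹ * ∑ i, if P d ∧ d i = k then 1 else 0 := fun d => by
    by_cases hd : P d <;> simp [hd, freq_eq_sum]
  simp_rw [h]
  rw [expect_const_mul, expect_sum]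
  refine congrArg _ (Finset.sum_congr rfl fun i _ => ?_)
  rw [prob]
  congr!

lemma expect_freq (k : ℕ) : expect p (freq k) = (n : ℝ)⁻¹ * ∑ i, prob p fun d => d i = k := by
  have := expect_indicator_mul_freq (p := p) (fun _ => True) k
  simpa only [if_true, one_mul, true_and] using this

lemma expect_freq_sq (k : ℕ) : expect p (fun d => freq k d * freq k d) =
    (n : ℝ)⁻¹ * ∑ i, ((n : ℝ)⁻¹ * ∑ j, prob p fun d => d i = k ∧ d j = k) := by
  classical
  have h : ∀ d : Fin n → ℕ, freq k d * freq k d =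
      (n : ℝ)⁻¹ * ∑ i, (if d i = k then 1 else 0) * freq k d := fun d => by
    rw [← Finset.sum_mul, ← mul_assoc, ← freq_eq_sum]
  simp_rw [h]
  rw [expect_const_mul, expect_sum]
  congr 1
  exact Finset.sum_congr rfl fun i _ => expect_indicator_mul_freq (fun d => d i = k) k

lemma exists_perm_pair {a b i j : Fin n} (hab : a ≠ b) (hij : i ≠ j) :
    ∃ σ : Equiv.Perm (Fin n), σ a = i ∧ σ b = j := by
  refine ⟨Equiv.swap (Equiv.swap a i b) j * Equiv.swap a i, ?_, ?_⟩
  · rw [Equiv.Perm.mul_apply, Equiv.swap_apply_left]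
    exact Equiv.swap_apply_of_ne_of_ne
      (fun h => hab ((Equiv.swap a i).injective ((Equiv.swap_apply_left a i).trans h))) hij
  · rw [Equiv.Perm.mul_apply, Equiv.swap_apply_left]

/-- The mean square deviation of the proportion of the entries equal to `k` from `c`. -/
lemma expect_sq_freq_sub {n : ℕ} {p : PMF (treeDegSeqs (n + 2))} (hp : Exchangeable p) (k : ℕ)
    (c : ℝ) : expect p (fun d => (freq k d - c) ^ 2) ≤
      ((n + 2 : ℕ) : ℝ)⁻¹ + (prob p (fun d => d 0 = k ∧ d 1 = k) - 2 * c * prob p (fun d => d 0 = k)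
        + c ^ 2) := by
  have h1 : ∀ i : Fin (n + 2), prob p (fun d => d i = k) = prob p fun d => d 0 = k := fun i => by
    rw [← hp.prob_perm (Equiv.swap 0 i) fun d => d 0 = k]
    simp
  -- Off the diagonal every pair of entries has the law of the entries `0` and `1`; the diagonal
  -- gives the error `1 / (n + 2)` after averaging.
  have h2 : ∀ i j : Fin (n + 2), prob p (fun d => d i = k ∧ d j = k) ≤
      prob p (fun d => d 0 = k ∧ d 1 = k) + if i = j then 1 else 0 := by
    intro i j
    split_ifs with hij
    · exact (prob_le_one _).trans (le_add_of_nonneg_left (prob_nonneg _))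
    · obtain ⟨σ, rfl, rfl⟩ := exists_perm_pair (zero_ne_one : (0 : Fin (n + 2)) ≠ 1) hij
      rw [← hp.prob_perm σ fun d => d 0 = k ∧ d 1 = k, add_zero]
  have hn : ((n + 2 : ℕ) : ℝ) ≠ 0 := by positivity
  have h3 : expect p (freq k) = prob p fun d => d 0 = k := by
    rw [expect_freq, Finset.sum_congr rfl fun i _ => h1 i, Finset.sum_const, Finset.card_univ,
      Fintype.card_fin, nsmul_eq_mul, inv_mul_cancel_left₀ hn]
  have h4 : expect p (fun d => freq k d * freq k d) ≤
      ((n + 2 : ℕ) : ℝ)⁻¹ + prob p (fun d => d 0 = k ∧ d 1 = k) := by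
    rw [expect_freq_sq]
    have : ∀ i : Fin (n + 2), ((n + 2 : ℕ) : ℝ)⁻¹ * ∑ j, prob p (fun d => d i = k ∧ d j = k) ≤
        ((n + 2 : ℕ) : ℝ)⁻¹ + prob p (fun d => d 0 = k ∧ d 1 = k) := by
      intro i
      calc ((n + 2 : ℕ) : ℝ)⁻¹ * ∑ j, prob p (fun d => d i = k ∧ d j = k)
          ≤ ((n + 2 : ℕ) : ℝ)⁻¹ * ∑ j : Fin (n + 2), (prob p (fun d => d 0 = k ∧ d 1 = k) +
            if i = j then 1 else 0) := by
            gcongr with j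
            exact h2 i j
        _ = _ := by
            rw [Finset.sum_add_distrib, Finset.sum_const, Finset.card_univ, Fintype.card_fin,
              nsmul_eq_mul, Finset.sum_ite_eq, if_pos (Finset.mem_univ i)]
            field_simp
            ring
    calc _ ≤ ((n + 2 : ℕ) : ℝ)⁻¹ * ∑ i : Fin (n + 2),
          (((n + 2 : ℕ) : ℝ)⁻¹ + prob p (fun d => d 0 = k ∧ d 1 = k)) := by
          gcongr with i
          exact this i
      _ = _ := by
          rw [Finset.sum_const, Finset.card_univ, Fintype.card_fin, nsmul_eq_mul,
            inv_mul_cancel_left₀ hn]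
  have h5 : expect p (fun d => (freq k d - c) ^ 2) =
      expect p (fun d => freq k d * freq k d) + (-(2 * c) * expect p (freq k) + c ^ 2) := by
    have : ∀ d : Fin (n + 2) → ℕ, (freq k d - c) ^ 2 =
        freq k d * freq k d + (-(2 * c) * freq k d + c ^ 2) := fun d => by ring
    simp_rw [this]
    rw [expect_add, expect_add, expect_const_mul, expect_const]
  rw [h5, h3]
  linarith

/-- The event that the first `m` entries agree with those of `a`. -/
def StartsWith {n : ℕ} (m : ℕ) (a : ℕ → ℕ) (d : Fin n → ℕ) : Prop :=
  ∀ j : Fin n, j.1 < m → d j = a j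

lemma startsWith_succ {n m : ℕ} (hm : m < n) (a : ℕ → ℕ) (d : Fin n → ℕ) :
    StartsWith (m + 1) a d ↔ StartsWith m a d ∧ d ⟨m, hm⟩ = a m := by
  constructor
  · exact fun h => ⟨fun j hj => h j (by omega), h ⟨m, hm⟩ (Nat.lt_succ_self m)⟩
  · rintro ⟨h1, h2⟩ j hj
    rcases Nat.lt_succ_iff_lt_or_eq.1 hj with h | h
    · exact h1 j h
    · have : j = ⟨m, hm⟩ := Fin.ext h
      rw [this, h2]

/-- Swapping the entry `m` with an entry `i ≥ m` leaves the first `m` entries alone. Averaging over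
all `i` produces the frequency, and the `m` indices below `m` cost at most `m / n`. -/
lemma abs_prob_startsWith_succ_sub {m : ℕ} (hp : Exchangeable p) (hm : m < n) (a : ℕ → ℕ)
    [DecidablePred (StartsWith (n := n) m a)] :
    |prob p (StartsWith (m + 1) a) -
      expect p (fun d => (if StartsWith m a d then 1 else 0) * freq (a m) d)| ≤ m / n := by
  have hn : (0 : ℝ) < n := by exact_mod_cast (Nat.zero_le m).trans_lt hm
  rw [expect_indicator_mul_freq, prob_congr (startsWith_succ hm a)]
  set P : Fin n → ℝ := fun i => prob p fun d => StartsWith m a d ∧ d i = a m with hP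
  have h1 : ∀ i : Fin n, |P ⟨m, hm⟩ - P i| ≤ if i.1 < m then 1 else 0 := by
    intro i
    split_ifs with hi
    · have h2 : 0 ≤ P i := prob_nonneg _
      have h3 : P i ≤ 1 := prob_le_one _
      have h4 : 0 ≤ P ⟨m, hm⟩ := prob_nonneg _
      have h5 : P ⟨m, hm⟩ ≤ 1 := prob_le_one _
      rw [abs_le]
      constructor <;> linarith
    · have : P i = P ⟨m, hm⟩ := by
        simp only [hP]
        rw [← hp.prob_perm (Equiv.swap ⟨m, hm⟩ i) fun d => StartsWith m a d ∧ d ⟨m, hm⟩ = a m]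
        refine prob_congr fun d => ?_
        simp only [Equiv.swap_apply_left]
        refine and_congr_left fun _ => forall_congr' fun j => forall_congr' fun hj => ?_
        beta_reduce
        rw [Equiv.swap_apply_of_ne_of_ne]
        · rintro rfl
          exact lt_irrefl _ hj
        · rintro rfl
          exact hi hj
      rw [this, sub_self, abs_zero]
  have h2 : P ⟨m, hm⟩ - (n : ℝ)⁻¹ * ∑ i, P i = (n : ℝ)⁻¹ * ∑ i, (P ⟨m, hm⟩ - P i) := by
    rw [Finset.sum_sub_distrib, Finset.sum_const, Finset.card_univ, Fintype.card_fin, nsmul_eq_mul]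
    field_simp
  change |P ⟨m, hm⟩ - (n : ℝ)⁻¹ * ∑ i, P i| ≤ _
  rw [h2, abs_mul, abs_of_pos (inv_pos.2 hn), div_eq_inv_mul]
  refine mul_le_mul_of_nonneg_left ?_ (inv_pos.2 hn).le
  refine (Finset.abs_sum_le_sum_abs _ _).trans ((Finset.sum_le_sum fun i _ => h1 i).trans ?_)
  rw [Finset.sum_boole]
  have : (Finset.univ.filter fun i : Fin n => i.1 < m).card ≤ (Finset.range m).card :=
    Finset.card_le_card_of_injOn Fin.val (fun i hi => by simpa using hi) Fin.val_injective.injOn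
  rw [Finset.card_range] at this
  exact_mod_cast this

/-- Replacing the random frequency by `c` costs at most `δ` where they are close, and at most one
elsewhere since both lie in `[0, 1]`. -/
lemma abs_expect_indicator_freq_sub_le (P : (Fin n → ℕ) → Prop) [DecidablePred P] (k : ℕ) {c δ : ℝ}
    (hc0 : 0 ≤ c) (hc1 : c ≤ 1) (hδ : 0 ≤ δ) :
    |expect p (fun d => (if P d then 1 else 0) * freq k d) - c * prob p P| ≤
      δ + prob p fun d => δ < |freq k d - c| := by
  classical
  have h1 : expect p (fun d => (if P d then 1 else 0) * freq k d) - c * prob p P =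
      expect p (fun d => (if P d then 1 else 0) * (freq k d - c)) := by
    have : ∀ d : Fin n → ℕ, ((if P d then 1 else 0) * (freq k d - c) : ℝ) =
        (if P d then 1 else 0) * freq k d + -c * (if P d then 1 else 0) := fun d => by ring
    simp_rw [this]
    rw [expect_add, expect_const_mul, prob]
    simp only [neg_mul, sub_eq_add_neg]
    congr!
  have h2 : ∀ d : Fin n → ℕ, |(if P d then 1 else 0) * (freq k d - c)| ≤
      δ + if δ < |freq k d - c| then 1 else 0 := by
    intro d
    have h3 : |(if P d then 1 else 0) * (freq k d - c)| ≤ |freq k d - c| := by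
      split_ifs
      · rw [one_mul]
      · rw [zero_mul, abs_zero]; exact abs_nonneg _
    refine h3.trans ?_
    split_ifs with h
    · have := freq_nonneg k d
      have := freq_le_one k d
      have : |freq k d - c| ≤ 1 := abs_le.2 ⟨by linarith, by linarith⟩
      linarith
    · linarith [not_lt.1 h]
  have h4 : expect p (fun d => δ + if δ < |freq k d - c| then 1 else 0) =
      δ + prob p fun d => δ < |freq k d - c| := by
    rw [expect_add, expect_const, prob]
  rw [h1, ← h4, abs_le]
  constructor
  · rw [neg_le, ← neg_one_mul, ← expect_const_mul]
    exact expect_mono fun d => by linarith [neg_abs_le ((if P d then 1 else 0) * (freq k d - c)), h2 d]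
  · exact expect_mono fun d => (le_abs_self _).trans (h2 d)

end Exchangeability

/-! ### Convergence of degree sequences and of degree frequencies -/

section DegreeSequences

/-- In a countable discrete space the singletons, with the empty set, form a π-system that contains
a neighbourhood of every point inside each open set, so convergence on it suffices. -/
lemma tendsto_probabilityMeasure_iff_singleton {E : Type*} [TopologicalSpace E] [DiscreteTopology E]
    [Countable E] [MeasurableSpace E] [DiscreteMeasurableSpace E] {μ : ℕ → ProbabilityMeasure E}
    {μ' : ProbabilityMeasure E} : Tendsto μ atTop (𝓝 μ') ↔
      ∀ b, Tendsto (fun n => (μ n : Measure E).real {b}) atTop (𝓝 ((μ' : Measure E).real {b})) := by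
  have h0 : ∀ (p : ProbabilityMeasure E) (s : Set E), (p : Measure E).real s = (p s : ℝ) :=
    fun _ _ => rfl
  simp_rw [h0, NNReal.tendsto_coe]
  constructor
  · exact fun h b => ProbabilityMeasure.tendsto_measure_of_isClopen_of_tendsto h (isClopen_discrete _)
  · intro h
    let S : Set (Set E) := {s | s = ∅ ∨ ∃ b, s = {b}}
    have hS : IsPiSystem S := by
      rintro s hs t ht ⟨b, hbs, hbt⟩
      rcases hs with rfl | ⟨c, rfl⟩
      · exact absurd hbs (Set.notMem_empty _)
      rcases ht with rfl | ⟨c', rfl⟩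
      · exact absurd hbt (Set.notMem_empty _)
      obtain rfl := Set.mem_singleton_iff.1 hbs
      obtain rfl := Set.mem_singleton_iff.1 hbt
      exact Or.inr ⟨b, Set.inter_self _⟩
    refine hS.tendsto_probabilityMeasure_of_tendsto_of_mem (fun s _ => .of_discrete) ?_ ?_
    · intro u _ x hx
      exact ⟨{x}, Or.inr ⟨x, rfl⟩, (isOpen_discrete _).mem_nhds rfl, by simpa using hx⟩
    · rintro s (rfl | ⟨b, rfl⟩)
      · simp
      · exact h b

variable {ν : ∀ n : ℕ, PMF (treeDegSeqs (n + 1))}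

lemma initial_eq_iff {n k : ℕ} (hk : k ≤ n) (a : ℕ → ℕ) (d : Fin n → ℕ) :
    initial k d = (fun i : Fin k => a i) ↔ StartsWith k a d := by
  constructor
  · intro h j hj
    have := congrFun h ⟨j.1, hj⟩
    simpa [initial] using this
  · intro h
    ext i
    have hi : i.1 < n := i.2.trans_le hk
    rw [initial, dif_pos hi]
    exact h ⟨i.1, hi⟩ i.2

lemma iidLaw_real_initial (q : PMF ℕ) (m : ℕ) (a : ℕ → ℕ) :
    ((iidLaw q).map fun (x : ℕ → ℕ) (i : Fin m) => x i).real {fun i : Fin m => a i} =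
      ∏ j ∈ Finset.range m, (q (a j)).toReal := by
  have h1 : (fun (x : ℕ → ℕ) (i : Fin m) => x i) ⁻¹' {fun i : Fin m => a i} =
      Set.pi (Finset.range m) fun j => {a j} := by
    ext x
    simp only [Set.mem_preimage, Set.mem_singleton_iff, funext_iff, Set.mem_pi, Finset.coe_range,
      Set.mem_Iio]
    exact ⟨fun h i hi => h ⟨i, hi⟩, fun h i => h i i.2⟩
  rw [measureReal_def, Measure.map_apply (by fun_prop) (measurableSet_singleton _), h1, iidLaw,
    Measure.infinitePi_pi _ fun _ _ => measurableSet_singleton _, ENNReal.toReal_prod]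
  refine Finset.prod_congr rfl fun j _ => ?_
  rw [PMF.toMeasure_apply_singleton _ _ (measurableSet_singleton _)]

lemma degSeqTendsto_iff {q : PMF ℕ} : DegSeqTendsto ν (iidLaw q) ↔ ∀ (m : ℕ) (a : ℕ → ℕ),
    Tendsto (fun n => prob (ν n) (StartsWith m a)) atTop
      (𝓝 (∏ j ∈ Finset.range m, (q (a j)).toReal)) := by
  have hmeas : ∀ n m, Measurable fun d : treeDegSeqs (n + 1) => initial m d.1 :=
    fun n m => .of_discrete
  have h1 : ∀ m, TendstoInDistribution
      (fun (n : ℕ) (d : treeDegSeqs (n + 1)) => initial m d.1) atTop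
      (fun (x : ℕ → ℕ) (i : Fin m) => x i) (fun n => (ν n).toMeasure) (iidLaw q) ↔
      ∀ b : Fin m → ℕ, Tendsto
        (fun n => ((ν n).toMeasure.map fun d => initial m d.1).real {b}) atTop
        (𝓝 (((iidLaw q).map fun (x : ℕ → ℕ) (i : Fin m) => x i).real {b})) := by
    intro m
    constructor
    · exact fun h => tendsto_probabilityMeasure_iff_singleton.1 h.tendsto
    · exact fun h => ⟨fun n => (hmeas n m).aemeasurable,
        (show Measurable fun (x : ℕ → ℕ) (i : Fin m) => x i by fun_prop).aemeasurable,
        tendsto_probabilityMeasure_iff_singleton.2 h⟩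
  have h2 : ∀ m (a : ℕ → ℕ), (fun n => ((ν n).toMeasure.map fun d => initial m d.1).real
      {fun i : Fin m => a i}) =ᶠ[atTop] fun n => prob (ν n) (StartsWith m a) := by
    intro m a
    filter_upwards [eventually_ge_atTop m] with n hn
    rw [measureReal_def, Measure.map_apply (hmeas n m) (measurableSet_singleton _),
      PMF.toMeasure_apply_eq_toOuterMeasure, prob_eq_toReal]
    congr 2
    ext d
    exact initial_eq_iff (by omega) a d.1
  unfold DegSeqTendsto
  simp_rw [h1]
  constructor
  · intro h m a
    have := h m fun i => a i
    rw [iidLaw_real_initial] at this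
    exact this.congr' (h2 m a)
  · intro h m b
    obtain ⟨a, rfl⟩ : ∃ a : ℕ → ℕ, b = fun i : Fin m => a i :=
      ⟨fun i => if hi : i < m then b ⟨i, hi⟩ else 0, by ext i; simp⟩
    rw [iidLaw_real_initial]
    exact (h m a).congr' (h2 m a).symm

lemma tendsto_whp_iff_prob {f : ∀ n, (Fin (n + 1) → ℕ) → ℝ} {c : ℝ} :
    Tendsto (fun x : Σ n, treeDegSeqs (n + 1) => f x.1 x.2.1) (whp ν) (𝓝 c) ↔
      ∀ ε : ℝ, 0 < ε → Tendsto (fun n => prob (ν n) fun d => ε < |f n d - c|) atTop (𝓝 0) := by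
  rw [tendsto_whp_iff]
  refine forall₂_congr fun ε _ => ?_
  simp_rw [prob_eq_toReal]
  rw [← ENNReal.toReal_zero, ENNReal.tendsto_toReal_iff _ ENNReal.zero_ne_top]
  exact fun n => ne_top_of_le_ne_top ENNReal.one_ne_top (PMF_toOuterMeasure_le_one _ _)

/-- Only the laws of the first entry and of the first two enter. The probabilities tend to `c` and
`c * c`, so the mean square deviation tends to `c ^ 2 - 2 * c ^ 2 + c ^ 2 = 0`. -/
lemma tendsto_freq_of_degSeqTendsto (hν : ∀ n, Exchangeable (ν n)) {q : PMF ℕ}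
    (h : DegSeqTendsto ν (iidLaw q)) (k : ℕ) :
    Tendsto (fun x : Σ n, treeDegSeqs (n + 1) => freq k x.2.1) (whp ν) (𝓝 (q k).toReal) := by
  rw [degSeqTendsto_iff] at h
  refine (tendsto_whp_iff_prob (f := fun n d => freq k d)).2 fun ε hε => ?_
  -- The shift ensures that the entries `0` and `1` both exist.
  rw [← tendsto_add_atTop_iff_nat 1]
  set c := (q k).toReal
  have h1 : Tendsto (fun n => prob (ν (n + 1)) fun d => d 0 = k) atTop (𝓝 c) := by
    have := (tendsto_add_atTop_iff_nat 1).2 (h 1 fun _ => k)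
    rw [Finset.prod_range_one] at this
    refine this.congr fun n => prob_congr fun d => ?_
    rw [startsWith_succ (Nat.succ_pos _)]
    exact and_iff_right fun j hj => absurd hj (Nat.not_lt_zero _)
  have h2 : Tendsto (fun n => prob (ν (n + 1)) fun d => d 0 = k ∧ d 1 = k) atTop (𝓝 (c * c)) := by
    have := (tendsto_add_atTop_iff_nat 1).2 (h 2 fun _ => k)
    rw [Finset.prod_range_succ, Finset.prod_range_one] at this
    refine this.congr fun n => prob_congr fun d => ?_
    rw [startsWith_succ (by omega), startsWith_succ (Nat.succ_pos _)]
    refine and_congr (and_iff_right fun j hj => absurd hj (Nat.not_lt_zero _)) Iff.rfl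
  have h3 : Tendsto (fun n : ℕ => (ε ^ 2)⁻¹ * (((n + 2 : ℕ) : ℝ)⁻¹ +
      (prob (ν (n + 1)) (fun d => d 0 = k ∧ d 1 = k) -
        2 * c * prob (ν (n + 1)) (fun d => d 0 = k) + c ^ 2))) atTop (𝓝 0) := by
    have h4 : Tendsto (fun n : ℕ => ((n + 2 : ℕ) : ℝ)⁻¹) atTop (𝓝 0) :=
      (tendsto_add_atTop_iff_nat 2).2 tendsto_inv_atTop_nhds_zero_nat
    have h5 := ((h4.add ((h2.sub (h1.const_mul (2 * c))).add_const (c ^ 2))).const_mul (ε ^ 2)⁻¹)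
    convert h5 using 2
    ring
  refine squeeze_zero (fun n => prob_nonneg _) (fun n => ?_) h3
  rw [inv_mul_eq_div, le_div_iff₀ (by positivity), mul_comm]
  refine (markov_prob (fun d => sq_nonneg (freq k d - c)) fun d hd => ?_).trans
    (expect_sq_freq_sub (hν (n + 1)) k c)
  rw [← sq_abs (freq k d - c)]
  gcongr

/-- Up to an error `m / n`, the next entry behaves like a uniformly chosen one, whatever the first
`m` are. It equals `a m` with a probability close to the frequency, hence to a constant, and the
joint law factorizes in the limit. -/
lemma degSeqTendsto_of_tendsto_freq (hν : ∀ n, Exchangeable (ν n)) {q : PMF ℕ}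
    (h : ∀ k, Tendsto (fun x : Σ n, treeDegSeqs (n + 1) => freq k x.2.1) (whp ν)
      (𝓝 (q k).toReal)) : DegSeqTendsto ν (iidLaw q) := by
  classical
  rw [degSeqTendsto_iff]
  intro m a
  induction m with
  | zero =>
    rw [Finset.prod_range_zero]
    refine tendsto_const_nhds.congr fun n => ?_
    rw [← expect_const (p := ν n) 1, prob]
    congr 1
    ext d
    exact (if_pos fun j hj => absurd hj (Nat.not_lt_zero _)).symm
  | succ m ih =>
    set c := (q (a m)).toReal
    have hc0 : 0 ≤ c := ENNReal.toReal_nonneg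
    have hc1 : c ≤ 1 := ENNReal.toReal_le_of_le_ofReal zero_le_one (by simpa using q.coe_le_one _)
    rw [Finset.prod_range_succ]
    set b := ∏ j ∈ Finset.range m, (q (a j)).toReal
    have h1 : Tendsto (fun n => prob (ν n) (StartsWith (m + 1) a) - c * prob (ν n) (StartsWith m a))
        atTop (𝓝 0) := by
      rw [Metric.tendsto_nhds]
      intro ε hε
      have h2 := (tendsto_whp_iff_prob (f := fun n d => freq (a m) d)).1 (h (a m)) (ε / 4)
        (by positivity)
      have h3 : Tendsto (fun n : ℕ => (m : ℝ) / ((n + 1 : ℕ) : ℝ)) atTop (𝓝 0) :=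
        (tendsto_add_atTop_iff_nat 1).2 (tendsto_const_div_atTop_nhds_zero_nat (m : ℝ))
      filter_upwards [h2.eventually (gt_mem_nhds (by positivity : (0 : ℝ) < ε / 4)),
        h3.eventually (gt_mem_nhds (by positivity : (0 : ℝ) < ε / 4)), eventually_ge_atTop m]
        with n h4 h5 hn
      have h6 := abs_prob_startsWith_succ_sub (hν n) (Nat.lt_succ_of_le hn) a
      have h7 := abs_expect_indicator_freq_sub_le (p := ν n) (StartsWith m a) (a m) hc0 hc1
        (by positivity : 0 ≤ ε / 4)
      rw [Real.dist_eq, sub_zero]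
      refine (abs_sub_le _ _ _).trans_lt ((add_le_add h6 h7).trans_lt ?_)
      linarith
    have h8 := h1.add (ih.const_mul c)
    simpa [mul_comm c] using h8

end DegreeSequences

/-! ### Stars and degrees -/

section Star

/-- The star with `k` leaves, rooted at its centre. -/
def star (k : ℕ) : RootedGraph (Fin (k + 1)) where
  graph := SimpleGraph.fromRel fun i _ => i = 0
  root := 0

variable {V : Type}

lemma card_ball_one {G : SimpleGraph V} {v : V} (hfin : (G.neighborSet v).Finite) :
    Nat.card {u : V // G.edist v u ≤ (1 : ℕ)} = deg G v + 1 := by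
  have h : {u : V | G.edist v u ≤ (1 : ℕ)} = insert v (G.neighborSet v) := by
    ext u
    rw [Set.mem_ofPred_eq, Nat.cast_one, SimpleGraph.edist_le_one_iff_adj_or_eq, Set.mem_insert_iff,
      SimpleGraph.mem_neighborSet, or_comm, eq_comm]
  change Nat.card ({u : V | G.edist v u ≤ (1 : ℕ)} : Set V) = _
  rw [Nat.card_coe_set_eq, h, Set.ncard_insert_of_notMem (by simp) hfin, deg]

/-- The neighbours of `v` are equidistant from `v`, so in a tree no two of them are adjacent, and
the `1`-ball is a star. -/
lemma ball_isomorphic_star_iff {T : SimpleGraph V} (hT : T.IsTree) {v : V}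
    (hfin : (T.neighborSet v).Finite) (k : ℕ) :
    (ball T v 1).Isomorphic (star k) ↔ deg T v = k := by
  classical
  constructor
  · intro h
    have := h.card_eq
    rw [card_ball_one hfin, Nat.card_eq_fintype_card, Fintype.card_fin] at this
    omega
  · rintro rfl
    have hcard := card_ball_one hfin
    have : Finite {u : V // T.edist v u ≤ (1 : ℕ)} :=
      Nat.finite_of_card_ne_zero (by rw [hcard]; exact Nat.succ_ne_zero _)
    let e₀ := Finite.equivFinOfCardEq hcard
    let e := e₀.trans (Equiv.swap (e₀ (ball T v 1).root) 0)
    have he : e (ball T v 1).root = 0 := by simp [e]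
    have hadj : ∀ a b : {u : V // T.edist v u ≤ (1 : ℕ)},
        T.Adj a b ↔ a ≠ b ∧ (a = (ball T v 1).root ∨ b = (ball T v 1).root) := by
      have hroot : ∀ c : {u : V // T.edist v u ≤ (1 : ℕ)}, c ≠ (ball T v 1).root → T.Adj v c := by
        intro c hc
        have : T.edist v c ≤ 1 := c.2
        rw [SimpleGraph.edist_le_one_iff_adj_or_eq] at this
        exact this.resolve_right fun h => hc (Subtype.ext h.symm)
      intro a b
      constructor
      · intro h
        refine ⟨fun hab => h.ne (congrArg Subtype.val hab), ?_⟩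
        by_contra! hne
        have h1 := hT.dist_ne_of_adj v h
        rw [SimpleGraph.dist_eq_one_iff_adj.2 (hroot a hne.1),
          SimpleGraph.dist_eq_one_iff_adj.2 (hroot b hne.2)] at h1
        exact h1 rfl
      · rintro ⟨hab, rfl | rfl⟩
        · exact hroot b hab.symm
        · exact (hroot a hab).symm
    refine ⟨⟨e, fun {a b} => ?_⟩, he⟩
    change (SimpleGraph.fromRel fun (i _ : Fin (deg T v + 1)) => i = 0).Adj (e a) (e b) ↔ T.Adj a b
    rw [hadj, SimpleGraph.fromRel_adj, e.injective.ne_iff, ← he, e.apply_eq_iff_eq,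
      e.apply_eq_iff_eq]

/-- Degree frequencies are neighbourhood statistics, so a limit of the trees determines the limit
law of a degree. -/
lemma nbhdStat_star {n : ℕ} {T : SimpleGraph (Fin n)} (hT : T.IsTree) (k : ℕ) :
    nbhdStat 1 (star k) T = freq k (deg T) := by
  rw [nbhdStat, freq, Nat.card_eq_fintype_card, Fintype.card_fin]
  simp_rw [ball_isomorphic_star_iff hT (Set.toFinite _)]
  rw [Set.ncard_eq_toFinset_card']
  simp

end Star

/-! ### Gluing balls to an infinite tree -/

section Gluing

variable {m : ℕ → ℕ}

/-- Stage `n` receives exactly the labels below `m n`: a permutation of `Fin (m n)` is extended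
along `ι n` to one of `Fin (m (n + 1))`. As `m` increases strictly, all of `ℕ` is used, which the
vertex set of an `InfRootedTree` requires. -/
lemma exists_labels (ι : ∀ n, Fin (m n) ↪ Fin (m (n + 1))) (hm : StrictMono m) :
    ∃ η : ∀ n, Fin (m n) → ℕ, (∀ n, Function.Injective (η n)) ∧
      (∀ n u, η (n + 1) (ι n u) = η n u) ∧ ∀ a, ∃ n, a ∈ Set.range (η n) := by
  classical
  have step : ∀ n (s : Equiv.Perm (Fin (m n))), ∃ t : Equiv.Perm (Fin (m (n + 1))),
      ∀ u, t (ι n u) = Fin.castLE (hm (Nat.lt_succ_self n)).le (s u) := by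
    intro n s
    let f : Fin (m n) → Fin (m (n + 1)) := fun u => Fin.castLE (hm (Nat.lt_succ_self n)).le (s u)
    have hinj : Function.Injective f := (Fin.castLE_injective _).comp s.injective
    let e : {x // x ∈ Set.range (ι n)} ≃ {x // x ∈ Set.range f} :=
      (Equiv.ofInjective _ (ι n).injective).symm.trans (Equiv.ofInjective _ hinj)
    refine ⟨e.extendSubtype, fun u => ?_⟩
    rw [e.extendSubtype_apply_of_mem _ ⟨u, rfl⟩]
    exact congrArg f ((Equiv.ofInjective _ (ι n).injective).symm_apply_apply u)
  choose next hnext using step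
  let s : ∀ n, Equiv.Perm (Fin (m n)) := fun n => Nat.rec 1 (fun n s => next n s) n
  refine ⟨fun n u => s n u, fun n => Fin.val_injective.comp (s n).injective, fun n u => ?_,
    fun a => ?_⟩
  · exact congrArg Fin.val (hnext n (s n) u)
  · have ha : a < m (a + 1) := hm.le_apply.trans_lt (hm (Nat.lt_succ_self a))
    exact ⟨a + 1, (s (a + 1)).symm ⟨a, ha⟩, by simp⟩

/-- A sequence of rooted trees each of which is a ball of the next one is the sequence of the
balls of an infinite rooted tree. -/
lemma exists_infRootedTree (H : ∀ n, RootedGraph (Fin (m n))) (hdeep : ∀ n, (H n).IsDeepTree (n + 1))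
    (hcomp : ∀ n, (ball (H (n + 1)).graph (H (n + 1)).root (n + 1)).Isomorphic (H n)) :
    ∃ T : InfRootedTree, ∀ n, (ball T.graph T.root (n + 1)).Isomorphic (H n) := by
  classical
  choose g hg using fun n => (hcomp n).symm
  let ι : ∀ n, Fin (m n) ↪ Fin (m (n + 1)) := fun n =>
    (g n).toEquiv.toEmbedding.trans (Function.Embedding.subtype _)
  have hιadj : ∀ n u v, (H (n + 1)).graph.Adj (ι n u) (ι n v) ↔ (H n).graph.Adj u v :=
    fun n u v => (g n).map_rel_iff
  have hιroot : ∀ n, ι n (H n).root = (H (n + 1)).root := fun n => congrArg Subtype.val (hg n)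
  have hιrange : ∀ n w, (H (n + 1)).graph.edist (H (n + 1)).root w ≤ (n + 1 : ℕ) →
      ∃ u, ι n u = w := fun n w hw => ⟨(g n).symm ⟨w, hw⟩, by simp [ι]⟩
  -- Stage `n + 1` has a vertex at distance `n + 2` from the root, outside the image of stage `n`.
  have hm : StrictMono m := by
    refine strictMono_nat_of_lt_succ fun n => ?_
    by_contra! hle
    have hbij : Function.Bijective (ι n) := by
      rw [Fintype.bijective_iff_injective_and_card]
      refine ⟨(ι n).injective, le_antisymm ?_ ?_⟩
      · exact Fintype.card_le_of_injective _ (ι n).injective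
      · simpa using hle
    obtain ⟨w, hw⟩ := (hdeep (n + 1)).2.2
    obtain ⟨u, rfl⟩ := hbij.2 w
    have h1 : (H (n + 1)).graph.edist (H (n + 1)).root (ι n u) ≤ (n + 1 : ℕ) := ((g n) u).2
    rw [show (H (n + 1)).graph.edist _ _ = ((n + 1 + 1 : ℕ) : ℕ∞) from hw] at h1
    have h2 : n + 1 + 1 ≤ n + 1 := by exact_mod_cast h1
    omega
  obtain ⟨η, hinj, hη, hsurj⟩ := exists_labels ι hm
  -- Stage `n` embeds in each later stage compatibly with the labels and fills the ball of radius `n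
  -- + 1` there.
  have hlift : ∀ n k, n ≤ k → ∃ κ : (H n).graph ↪g (H k).graph, κ (H n).root = (H k).root ∧
      (∀ u, η k (κ u) = η n u) ∧ ∀ w, (H k).graph.edist (H k).root w ≤ (n + 1 : ℕ) →
        ∃ u, κ u = w := by
    intro n k hnk
    induction k, hnk using Nat.le_induction with
    | base => exact ⟨SimpleGraph.Embedding.refl, rfl, fun u => rfl, fun w _ => ⟨w, rfl⟩⟩
    | succ k hnk ih =>
      obtain ⟨κ, h1, h2, h3⟩ := ih
      let ι' : (H k).graph ↪g (H (k + 1)).graph := ⟨ι k, fun {u v} => hιadj k u v⟩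
      refine ⟨κ.trans ι', ?_, fun u => (hη k (κ u)).trans (h2 u), fun w hw => ?_⟩
      · change ι k (κ _) = _
        rw [h1, hιroot]
      · obtain ⟨w', rfl⟩ := hιrange k w (hw.trans (by exact_mod_cast Nat.succ_le_succ hnk))
        obtain ⟨u, rfl⟩ := h3 w' (by
          have h4 : (H k).graph.edist (H k).root w' =
              (H (k + 1)).graph.edist (H (k + 1)).root (ι k w') := by
            have h5 := edist_iso (g k) (H k).root w'
            rw [← h5, hg k, edist_ball]
            rfl
          rw [h4]
          exact hw)
        exact ⟨u, rfl⟩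
  let G : SimpleGraph ℕ :=
    { Adj := fun a b => ∃ n u v, (H n).graph.Adj u v ∧ η n u = a ∧ η n v = b
      symm := ⟨fun a b ⟨n, u, v, h, ha, hb⟩ => ⟨n, v, u, h.symm, hb, ha⟩⟩
      loopless := ⟨fun a ⟨n, u, v, h, ha, hb⟩ => h.ne (hinj n (ha.trans hb.symm))⟩ }
  let f : ∀ n, (H n).graph →g G := fun n => ⟨η n, fun {u v} h => ⟨n, u, v, h, rfl, rfl⟩⟩
  have hGadj : ∀ n u v, G.Adj (η n u) (η n v) ↔ (H n).graph.Adj u v := by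
    refine fun n u v => ⟨?_, fun h => ⟨n, u, v, h, rfl, rfl⟩⟩
    rintro ⟨k, u', v', h, hu, hv⟩
    obtain ⟨κ, -, h2, -⟩ := hlift k (max k n) (le_max_left _ _)
    obtain ⟨κ', -, h3, -⟩ := hlift n (max k n) (le_max_right _ _)
    rw [← κ'.map_adj_iff, ← hinj _ ((h2 u').trans (hu.trans (h3 u).symm)),
      ← hinj _ ((h2 v').trans (hv.trans (h3 v).symm))]
    exact κ.map_adj_iff.2 h
  have hmono : ∀ n k, n ≤ k → ∀ a, a ∈ Set.range (η n) → a ∈ Set.range (η k) := by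
    rintro n k hnk _ ⟨u, rfl⟩
    obtain ⟨κ, -, h2, -⟩ := hlift n k hnk
    exact ⟨κ u, h2 u⟩
  have hroot : ∀ n, η n (H n).root = η 0 (H 0).root := fun n => by
    obtain ⟨κ, h1, h2, -⟩ := hlift 0 n (Nat.zero_le n)
    rw [← h1, h2]
  set r := η 0 (H 0).root
  have hdist : ∀ (j : ℕ) a, G.edist r a = j →
      ∃ n u, η n u = a ∧ (H n).graph.edist (H n).root u ≤ j := by
    intro j
    induction j with
    | zero =>
      intro a ha
      rw [Nat.cast_zero, SimpleGraph.edist_eq_zero_iff] at ha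
      exact ⟨0, (H 0).root, ha, by simp⟩
    | succ j ih =>
      intro a ha
      obtain ⟨w, hwa, hw⟩ := exists_adj_of_edist_eq_succ ha
      obtain ⟨n, u, rfl, hu⟩ := ih w hw
      obtain ⟨k, x, rfl⟩ := hsurj a
      obtain ⟨κ, h1, h2, -⟩ := hlift n (max n k) (le_max_left _ _)
      obtain ⟨κ', -, h2', -⟩ := hlift k (max n k) (le_max_right _ _)
      refine ⟨max n k, κ' x, h2' x, edist_le_succ_of_adj (u := κ u) ?_ ?_⟩
      · rw [← h1]
        exact (edist_hom_le κ.toHom _ _).trans hu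
      · rwa [← hGadj, h2, h2']
  have hball : ∀ n a, G.edist r a ≤ (n + 1 : ℕ) ↔ a ∈ Set.range (η n) := by
    intro n a
    constructor
    · intro ha
      obtain ⟨j, hj⟩ := ENat.ne_top_iff_exists.1 (ne_top_of_le_ne_top (ENat.natCast_ne_top _) ha)
      obtain ⟨k, u, rfl, hu⟩ := hdist j a hj.symm
      obtain ⟨κ, h1, h2, -⟩ := hlift k (max k n) (le_max_left _ _)
      obtain ⟨κ', -, h2', h3⟩ := hlift n (max k n) (le_max_right _ _)
      obtain ⟨w, hw⟩ := h3 (κ u) (by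
        rw [← h1]
        exact (edist_hom_le κ.toHom _ _).trans (hu.trans (hj.trans_le ha)))
      exact ⟨w, by rw [← h2', hw, h2]⟩
    · rintro ⟨u, rfl⟩
      rw [← hroot n]
      exact (edist_hom_le (f n) _ _).trans ((hdeep n).2.1 u)
  have hconn : G.Connected := by
    have : ∀ a, G.Reachable r a := fun a => by
      obtain ⟨n, u, rfl⟩ := hsurj a
      rw [← hroot n]
      exact ((hdeep n).1.connected _ u).map (f n)
    exact ⟨fun a b => (this a).symm.trans (this b)⟩
  -- The support of a cycle is finite, so the cycle lies in a single stage, which is a tree.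
  have hacyc : G.IsAcyclic := by
    intro a c hc
    obtain ⟨n, hn⟩ : ∃ n, ∀ x ∈ c.support, x ∈ Set.range (η n) := by
      have : ∀ l : List ℕ, ∃ n, ∀ x ∈ l, x ∈ Set.range (η n) := by
        intro l
        induction l with
        | nil => exact ⟨0, fun x hx => absurd hx List.not_mem_nil⟩
        | cons x l ih =>
          obtain ⟨n, hn⟩ := ih
          obtain ⟨k, hk⟩ := hsurj x
          refine ⟨max n k, fun y hy => ?_⟩
          rcases List.mem_cons.1 hy with rfl | hy
          · exact hmono k _ (le_max_right _ _) _ hk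
          · exact hmono n _ (le_max_left _ _) _ (hn y hy)
      exact this c.support
    have h1 : (G.induce (Set.range (η n))).IsAcyclic := by
      let e := Equiv.ofInjective _ (hinj n)
      refine ((hdeep n).1.isAcyclic).embedding ⟨e.symm.toEmbedding, fun {a b} => ?_⟩
      obtain ⟨u, rfl⟩ := e.surjective a
      obtain ⟨v, rfl⟩ := e.surjective b
      simp only [Equiv.coe_toEmbedding, Equiv.symm_apply_apply]
      exact (hGadj n u v).symm
    refine h1 (c.induce _ hn) ?_
    refine (SimpleGraph.Walk.isCycle_map_iff_of_injective
      (f := (SimpleGraph.Embedding.induce (G := G) (Set.range (η n))).toHom)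
      Subtype.val_injective).1 ?_
    rw [SimpleGraph.Walk.map_induce]
    exact hc
  have hfin : ∀ a, (G.neighborSet a).Finite := by
    intro a
    obtain ⟨n, ha⟩ := hsurj a
    refine (Set.finite_range (η (n + 1))).subset fun b hb => ?_
    exact (hball (n + 1) b).1 (edist_le_succ_of_adj ((hball n a).2 ha) hb)
  refine ⟨⟨⟨G, r⟩, ⟨hconn, hacyc⟩, hfin⟩, fun n => RootedGraph.Isomorphic.symm ?_⟩
  let e : Fin (m n) ≃ {a // G.edist r a ≤ (n + 1 : ℕ)} :=
    (Equiv.ofInjective _ (hinj n)).trans (Equiv.subtypeEquivRight fun a => (hball n a).symm)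
  exact ⟨⟨e, fun {u v} => hGadj n u v⟩, Subtype.ext (hroot n)⟩

end Gluing

/-! ### Random compatible sequences in a countable space -/

section InverseLimit

/-- The conditional law of a point of a countable space with law `p`, given its image under `f`. -/
lemma exists_conditional_pmf {Y : Type} [DecidableEq Y] {p p' : PMF Y} {f : Y → Y} (h : p'.map f = p) :
    ∃ κ : Y → PMF Y, ∀ y z, κ y z * p y = if f z = y then p' z else 0 := by
  classical
  -- Where the conditioning event has no mass, `p y = 0` and any law will do.
  refine ⟨fun y => if hy : ∃ z ∈ {z | f z = y}, z ∈ p'.support then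
    p'.filter {z | f z = y} hy else PMF.pure y, fun y z => ?_⟩
  have hp : p y = ∑' z, ({z | f z = y} : Set Y).indicator p' z := by
    rw [← h, PMF.map_apply]
    refine tsum_congr fun z => ?_
    rw [Set.indicator_apply]
    by_cases hz : f z = y
    · rw [if_pos hz.symm, if_pos (by exact hz)]
    · rw [if_neg (Ne.symm hz), if_neg (by exact hz)]
  dsimp only
  split_ifs with hy hz hz
  · have h1 : p y ≠ 0 := by
      obtain ⟨w, hw, hw'⟩ := hy
      rw [hp]
      exact ENNReal.summable.tsum_ne_zero_iff.2 ⟨w, by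
        rw [Set.indicator_of_mem hw]; exact (PMF.mem_support_iff _ _).1 hw'⟩
    rw [PMF.filter_apply, ← hp, Set.indicator_of_mem (by exact hz), mul_assoc,
      ENNReal.inv_mul_cancel h1 (p.apply_ne_top y), mul_one]
  · rw [PMF.filter_apply_eq_zero_of_notMem _ (by exact hz), zero_mul]
  · have h1 : p' z = 0 := by
      by_contra h2
      exact hy ⟨z, hz, (PMF.mem_support_iff _ _).2 h2⟩
    have h2 : p y = 0 := by
      rw [hp, ENNReal.tsum_eq_zero]
      intro w
      rw [Set.indicator_apply_eq_zero]
      intro hw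
      by_contra h3
      exact hy ⟨w, hw, (PMF.mem_support_iff _ _).2 h3⟩
    rw [h1, h2, mul_zero]
  · have h2 : p y = 0 := by
      rw [hp, ENNReal.tsum_eq_zero]
      intro w
      rw [Set.indicator_apply_eq_zero]
      intro hw
      by_contra h3
      exact hy ⟨w, hw, (PMF.mem_support_iff _ _).2 h3⟩
    rw [h2, mul_zero]

variable {Y : Type} [Countable Y] [MeasurableSpace Y] [DiscreteMeasurableSpace Y]

lemma lintegral_pmf_toMeasure (p : PMF Y) (g : Y → ℝ≥0∞) :
    ∫⁻ y, g y ∂p.toMeasure = ∑' y, g y * p y := by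
  rw [lintegral_countable']
  refine tsum_congr fun y => ?_
  rw [PMF.toMeasure_apply_singleton _ _ (measurableSet_singleton y)]

/-- A compatible sequence of laws on a countable space comes from a random compatible sequence. -/
lemma exists_inverse_limit (p : ℕ → PMF Y) (f : ℕ → Y → Y) (h : ∀ n, (p (n + 1)).map (f n) = p n) :
    ∃ μ : Measure (ℕ → Y), IsProbabilityMeasure μ ∧
      (∀ n, μ.map (fun x => x n) = (p n).toMeasure) ∧ ∀ᵐ x ∂μ, ∀ n, f n (x (n + 1)) = x n := by
  classical
  choose κ hκ using fun n => exists_conditional_pmf (h n)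
  -- The Ionescu-Tulcea construction: a Markov chain whose next point is drawn from the conditional
  -- law given the current one.
  let K : (n : ℕ) → Kernel (Π _ : Finset.Iic n, Y) Y := fun n =>
    Kernel.ofFunOfCountable fun x => (κ n (x ⟨n, Finset.mem_Iic.2 le_rfl⟩)).toMeasure
  have hK : ∀ n, IsMarkovKernel (K n) := fun n => ⟨fun x => by
    change IsProbabilityMeasure (κ n (x ⟨n, Finset.mem_Iic.2 le_rfl⟩)).toMeasure
    infer_instance⟩
  let μ := Kernel.trajMeasure (X := fun _ => Y) (p 0).toMeasure K
  have hμ : IsProbabilityMeasure μ := inferInstance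
  have hstep : ∀ n (s : Set (Y × Y)), μ {x | (x n, x (n + 1)) ∈ s} =
      ∫⁻ y, (κ n y).toMeasure {z | (y, z) ∈ s} ∂(μ.map fun x => x n) := by
    intro n s
    have h1 := Kernel.map_frestrictLe_trajMeasure_compProd_eq_map_trajMeasure (X := fun _ => Y)
      (μ₀ := (p 0).toMeasure) (κ := K) (a := n)
    let S : Set ((Π _ : Finset.Iic n, Y) × Y) := {x | (x.1 ⟨n, Finset.mem_Iic.2 le_rfl⟩, x.2) ∈ s}
    have hS : MeasurableSet S := .of_discrete
    have h2 := congrArg (fun m => m S) h1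
    rw [Measure.compProd_apply hS, Measure.map_apply (by fun_prop) hS,
      lintegral_map (.of_discrete) (by fun_prop)] at h2
    rw [lintegral_map (.of_discrete) (by fun_prop)]
    exact h2.symm
  have hmarg : ∀ n, μ.map (fun x => x n) = (p n).toMeasure := by
    intro n
    induction n with
    | zero =>
      have h1 : μ.map (Preorder.frestrictLe (π := fun _ => Y) 0) =
          (p 0).toMeasure.map (MeasurableEquiv.piUnique fun _ : Finset.Iic 0 => Y).symm := by
        simp only [μ, Kernel.trajMeasure]
        rw [Measure.map_comp _ _ (by fun_prop), Kernel.traj_map_frestrictLe,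
          Kernel.partialTraj_self, Measure.id_comp]
      have h2 := congrArg (fun m => Measure.map
        (fun x : (Π _ : Finset.Iic 0, Y) => x ⟨0, Finset.mem_Iic.2 le_rfl⟩) m) h1
      rw [Measure.map_map (by fun_prop) (by fun_prop),
        Measure.map_map (by fun_prop) (by fun_prop)] at h2
      exact h2.trans Measure.map_id
    | succ n ih =>
      refine Measure.ext_of_singleton fun z => ?_
      rw [Measure.map_apply (by fun_prop) (measurableSet_singleton z),
        PMF.toMeasure_apply_singleton _ _ (measurableSet_singleton z)]
      have h1 := hstep n {y | y.2 = z}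
      rw [ih, lintegral_pmf_toMeasure] at h1
      refine h1.trans ?_
      have h2 : ∀ y, (κ n y).toMeasure {w | w = z} * p n y = if f n z = y then p (n + 1) z else 0 :=
        fun y => by rw [← hκ]; congr 1; exact PMF.toMeasure_apply_singleton _ _ (measurableSet_singleton z)
      exact (tsum_congr h2).trans (tsum_ite_eq' _ _)
  refine ⟨μ, hμ, hmarg, ae_all_iff.2 fun n => ?_⟩
  rw [ae_iff]
  have h1 := hstep n {y | ¬ f n y.2 = y.1}
  refine h1.trans ?_
  rw [hmarg, lintegral_pmf_toMeasure, ENNReal.tsum_eq_zero]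
  intro y
  rw [mul_eq_zero, or_iff_not_imp_right]
  intro hy
  rw [PMF.toMeasure_apply_eq_zero_iff _ .of_discrete, Set.disjoint_left]
  intro z hz hz'
  have h2 := hκ n y z
  rw [if_neg (by exact hz'), mul_eq_zero] at h2
  exact (PMF.mem_support_iff _ _).1 hz (h2.resolve_right hy)

end InverseLimit

/-! ### Isomorphism classes of finite rooted graphs -/

section GraphClasses

variable {V W : Type}

instance (m : ℕ) : Finite (RootedGraph (Fin m)) :=
  Finite.of_injective (fun F : RootedGraph (Fin m) => (F.graph, F.root)) fun F F' h => by
    cases F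
    cases F'
    simp_all

/-- Rooted isomorphism of finite rooted graphs. -/
instance rootedIsoSetoid : Setoid (Σ m, RootedGraph (Fin m)) where
  r F F' := F.2.Isomorphic F'.2
  iseqv := ⟨fun F => .refl F.2, .symm, .trans⟩

/-- The isomorphism classes of the finite rooted graphs. -/
def GraphClass : Type := Quotient rootedIsoSetoid

namespace GraphClass

instance : Countable GraphClass := inferInstanceAs (Countable (Quotient rootedIsoSetoid))

instance : MeasurableSpace GraphClass := ⊤

instance : DiscreteMeasurableSpace GraphClass := ⟨fun _ => trivial⟩

/-- The number of vertices of the graphs in a class. -/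
def size (c : GraphClass) : ℕ := (Quotient.out c).1

/-- A representative of a class. -/
def rep (c : GraphClass) : RootedGraph (Fin c.size) := (Quotient.out c).2

lemma eq_of_isomorphic {c c' : GraphClass} (h : c.rep.Isomorphic c'.rep) : c = c' :=
  Quotient.out_equiv_out.1 h

lemma exists_isomorphic_rep [Finite V] (G : RootedGraph V) :
    ∃ c : GraphClass, G.Isomorphic c.rep := by
  let e := Finite.equivFin V
  let F : RootedGraph (Fin (Nat.card V)) := ⟨G.graph.map e.toEmbedding, e G.root⟩
  have h1 : G.Isomorphic F := ⟨SimpleGraph.Iso.map e G.graph, rfl⟩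
  refine ⟨(⟦⟨_, F⟩⟧ : Quotient rootedIsoSetoid), h1.trans ?_⟩
  exact RootedGraph.Isomorphic.symm (Quotient.mk_out (s := rootedIsoSetoid) ⟨_, F⟩)

/-- The class of a finite rooted graph. -/
def of [Finite V] (G : RootedGraph V) : GraphClass := (exists_isomorphic_rep G).choose

lemma isomorphic_rep_of [Finite V] (G : RootedGraph V) : G.Isomorphic (of G).rep :=
  (exists_isomorphic_rep G).choose_spec

lemma of_eq_iff [Finite V] {G : RootedGraph V} {c : GraphClass} :
    of G = c ↔ G.Isomorphic c.rep :=
  ⟨fun h => h ▸ isomorphic_rep_of G, fun h => eq_of_isomorphic ((isomorphic_rep_of G).symm.trans h)⟩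

lemma finite_size_le (M : ℕ) : {c : GraphClass | c.size ≤ M}.Finite := by
  have h : {F : Σ m, RootedGraph (Fin m) | F.1 ≤ M}.Finite := by
    refine ((Set.finite_Iic M).biUnion fun m _ =>
      Set.finite_range (Sigma.mk (β := fun m => RootedGraph (Fin m)) m)).subset ?_
    rintro ⟨m, F⟩ hm
    exact Set.mem_biUnion (show m ∈ Set.Iic M from hm) ⟨F, rfl⟩
  exact h.preimage (f := Quotient.out) Quotient.out_injective.injOn

/-- The class of the `R`-ball around the root. -/
def trunc (R : ℕ) (c : GraphClass) : GraphClass := of (RandomTreeLimit.ball c.rep.graph c.rep.root R)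

lemma trunc_of_ball [Finite V] (G : SimpleGraph V) (v : V) {R S : ℕ} (h : R ≤ S) :
    trunc R (of (ball G v S)) = of (ball G v R) :=
  (of_eq_iff.2 (((isomorphic_ball_of_le (isomorphic_rep_of _) h).symm.trans
    (isomorphic_rep_of _))))

end GraphClass

open Classical in
lemma sum_nbhdStat_rep [Fintype V] (R : ℕ) (G : SimpleGraph V) (S : Finset GraphClass) :
    ∑ c ∈ S, nbhdStat R c.rep G =
      ((Finset.univ.filter fun v => GraphClass.of (ball G v R) ∈ S).card : ℝ) / Nat.card V := by
  rw [← Finset.sum_card_fiberwise_eq_card_filter, Nat.cast_sum, Finset.sum_div]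
  refine Finset.sum_congr rfl fun c _ => ?_
  rw [nbhdStat, Set.ncard_eq_toFinset_card']
  simp [GraphClass.of_eq_iff]

lemma nbhdStat_congr {F : RootedGraph V} {F' : RootedGraph W} (h : F.Isomorphic F') (R : ℕ)
    {U : Type} (G : SimpleGraph U) : nbhdStat R F G = nbhdStat R F' G := by
  have : ∀ v, (ball G v R).Isomorphic F ↔ (ball G v R).Isomorphic F' :=
    fun v => ⟨fun h' => h'.trans h, fun h' => h'.trans h.symm⟩
  simp_rw [nbhdStat, this]

lemma nbhdStat_nonneg (R : ℕ) (F : RootedGraph W) (G : SimpleGraph V) : 0 ≤ nbhdStat R F G := by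
  unfold nbhdStat
  positivity

lemma sum_nbhdStat_rep_le_one [Finite V] (R : ℕ) (G : SimpleGraph V) (S : Finset GraphClass) :
    ∑ c ∈ S, nbhdStat R c.rep G ≤ 1 := by
  classical
  have := Fintype.ofFinite V
  rw [sum_nbhdStat_rep]
  refine div_le_one_of_le₀ ?_ (Nat.cast_nonneg _)
  rw [Nat.card_eq_fintype_card]
  exact_mod_cast Finset.card_filter_le _ _

/-- The `S`-ball determines the class of the `R`-ball. For finite `A` this is only an inequality;
equality of the limit laws is recovered from their total mass. -/
lemma sum_nbhdStat_rep_of_trunc_le [Finite V] {R S : ℕ} (h : R ≤ S) (G : SimpleGraph V)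
    (A : Finset GraphClass) (c : GraphClass) (hA : ∀ c' ∈ A, c'.trunc R = c) :
    ∑ c' ∈ A, nbhdStat S c'.rep G ≤ nbhdStat R c.rep G := by
  classical
  have := Fintype.ofFinite V
  have h1 := sum_nbhdStat_rep R G {c}
  rw [Finset.sum_singleton] at h1
  rw [sum_nbhdStat_rep, h1]
  gcongr with v
  intro hv
  rw [Finset.mem_singleton, ← hA _ hv, GraphClass.trunc_of_ball G v h]

/-- Only finitely many classes have size at most `M`, and they miss only the vertices with big
balls, so no mass escapes in a limit. -/
lemma one_sub_le_sum_nbhdStat_rep [Finite V] [Nonempty V] (R M : ℕ) (G : SimpleGraph V) {ε : ℝ}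
    (h : ((bigBalls G R M).ncard : ℝ) ≤ ε * Nat.card V) :
    1 - ε ≤ ∑ c ∈ (GraphClass.finite_size_le M).toFinset, nbhdStat R c.rep G := by
  classical
  have := Fintype.ofFinite V
  rw [sum_nbhdStat_rep, le_div_iff₀ (by exact_mod_cast Nat.card_pos), sub_mul, one_mul]
  have h1 : Nat.card V ≤ (Finset.univ.filter fun v => GraphClass.of (ball G v R) ∈
      (GraphClass.finite_size_le M).toFinset).card + (bigBalls G R M).ncard := by
    rw [Set.ncard_eq_toFinset_card', Nat.card_eq_fintype_card, ← Finset.card_univ]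
    refine (Finset.card_le_card ?_).trans (Finset.card_union_le _ _)
    intro v _
    rw [Finset.mem_union, or_iff_not_imp_right]
    intro hv
    rw [Set.mem_toFinset] at hv
    simp only [Finset.mem_filter, Finset.mem_univ, true_and, Set.Finite.mem_toFinset,
      Set.mem_ofPred_eq]
    have h2 := (GraphClass.isomorphic_rep_of (ball G v R)).card_eq
    rw [Nat.card_eq_fintype_card (α := Fin _), Fintype.card_fin] at h2
    rw [← h2]
    exact not_lt.1 hv
  have h2 : (Nat.card V : ℝ) ≤ _ := Nat.cast_le.2 h1
  push_cast at h2 ⊢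
  linarith

lemma nbhdStat_eq_zero_of_not_isDeepTree {n m R : ℕ} {T : SimpleGraph (Fin n)} (hT : T.IsTree)
    {F : RootedGraph (Fin m)} (hF : ¬ F.IsDeepTree R) (h : m < n) : nbhdStat R F T = 0 := by
  have : {v | (ball T v R).Isomorphic F} = ∅ := by
    refine Set.eq_empty_of_forall_notMem fun v hv => hF (isDeepTree_of_ball_isomorphic hT hv ?_)
    rintro ⟨e⟩
    have := Fintype.card_congr e
    rw [Fintype.card_fin, Fintype.card_fin] at this
    omega
  rw [nbhdStat, this, Set.ncard_empty, Nat.cast_zero, zero_div]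

end GraphClasses

/-! ### The limit law on infinite rooted trees -/

section LimitMeasure

lemma PMF_eq_of_le {Y : Type} {p q : PMF Y} (h : ∀ y, p y ≤ q y) : p = q := by
  ext y
  by_contra hne
  have h1 := ENNReal.tsum_lt_tsum p.tsum_coe_ne_top h (lt_of_le_of_ne (h y) hne)
  rw [p.tsum_coe, q.tsum_coe] at h1
  exact lt_irrefl _ h1

/-- A compatible random sequence of rooted isomorphism classes of deep trees is the sequence of the
balls of a random infinite rooted tree. -/
lemma exists_measure_infRootedTree (p : ℕ → PMF GraphClass)
    (hp : ∀ n, (p (n + 1)).map (GraphClass.trunc (n + 1)) = p n)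
    (hdeep : ∀ n c, p n c ≠ 0 → c.rep.IsDeepTree (n + 1)) :
    ∃ ρ : Measure InfRootedTree, IsProbabilityMeasure ρ ∧
      ∀ n (c : GraphClass), ρ (nbhdEvent (n + 1) c.rep) = p n c := by
  classical
  obtain ⟨μ, hμ, hmarg, hcomp⟩ := exists_inverse_limit p (fun n => GraphClass.trunc (n + 1)) hp
  let Good : Set (ℕ → GraphClass) :=
    {x | ∀ n, (x n).rep.IsDeepTree (n + 1) ∧
      (x (n + 1)).trunc (n + 1) = x n}
  have hGood : ∀ᵐ x ∂μ, x ∈ Good := by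
    have h1 : ∀ᵐ x ∂μ, ∀ n, (x n).rep.IsDeepTree (n + 1) := by
      rw [ae_all_iff]
      intro n
      rw [ae_iff]
      have h2 := congrArg (fun m => m {c : GraphClass | ¬ c.rep.IsDeepTree (n + 1)}) (hmarg n)
      rw [Measure.map_apply (by fun_prop) .of_discrete] at h2
      refine h2.trans ?_
      rw [PMF.toMeasure_apply_eq_zero_iff _ .of_discrete, Set.disjoint_left]
      exact fun c hc hc' => hc' (hdeep n c ((PMF.mem_support_iff _ _).1 hc))
    filter_upwards [h1, hcomp] with x h2 h3
    exact fun n => ⟨h2 n, h3 n⟩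
  have hGoodMeas : MeasurableSet Good := by
    have : Good = ⋂ n, (fun x : ℕ → GraphClass => (x n, x (n + 1))) ⁻¹'
        {y | y.1.rep.IsDeepTree (n + 1) ∧
          y.2.trunc (n + 1) = y.1} := by
      ext x
      simp [Good]
    rw [this]
    exact MeasurableSet.iInter fun n =>
      (show Measurable fun x : ℕ → GraphClass => (x n, x (n + 1)) by fun_prop) .of_discrete
  have hex : ∀ x : Good, ∃ T : InfRootedTree, ∀ n,
      (ball T.graph T.root (n + 1)).Isomorphic (x.1 n).rep := fun x =>
    exists_infRootedTree (fun n => (x.1 n).rep) (fun n => (x.2 n).1) fun n =>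
      GraphClass.of_eq_iff.1 (x.2 n).2
  choose Θ hΘ using hex
  obtain ⟨x₀, hx₀⟩ := hGood.exists
  -- On the null set of sequences that cannot be glued a fixed good sequence is substituted.
  let g : (ℕ → GraphClass) → (ℕ → GraphClass) := fun x => if x ∈ Good then x else x₀
  have hg : ∀ x, g x ∈ Good := fun x => by
    by_cases hx : x ∈ Good
    · simp [g, hx]
    · simpa [g, hx] using hx₀
  have hgMeas : Measurable g := Measurable.ite hGoodMeas measurable_id measurable_const
  let Φ : (ℕ → GraphClass) → InfRootedTree := fun x => Θ ⟨g x, hg x⟩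
  have hΦ : ∀ x (R m : ℕ) (F : RootedGraph (Fin m)), Φ x ∈ nbhdEvent R F ↔
      (ball (g x R).rep.graph (g x R).rep.root R).Isomorphic F := by
    intro x R m F
    have h1 := isomorphic_ball_of_le (hΘ ⟨g x, hg x⟩ R) (Nat.le_succ R)
    exact ⟨fun h => h1.symm.trans h, fun h => h1.trans h⟩
  -- The trees are picked by choice, yet `Φ` is measurable: the `R`-ball depends only on the
  -- coordinate `R`, which is the ball of radius `R + 1`, and such events generate the σ-algebra.
  have hΦMeas : Measurable Φ := by
    refine measurable_generateFrom ?_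
    rintro _ ⟨R, m, F, rfl⟩
    have : Φ ⁻¹' nbhdEvent R F = (fun x => g x R) ⁻¹'
        {c : GraphClass | (ball c.rep.graph c.rep.root R).Isomorphic F} := by
      ext x
      exact hΦ x R m F
    rw [this]
    exact ((measurable_pi_apply R).comp hgMeas) .of_discrete
  have hmeas : ∀ R m (F : RootedGraph (Fin m)), MeasurableSet (nbhdEvent R F) :=
    fun R m F => MeasurableSpace.measurableSet_generateFrom ⟨R, m, F, rfl⟩
  refine ⟨μ.map Φ, Measure.isProbabilityMeasure_map hΦMeas.aemeasurable, fun n c => ?_⟩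
  rw [Measure.map_apply hΦMeas (hmeas _ _ _),
    ← PMF.toMeasure_apply_singleton _ _ (measurableSet_singleton c), ← hmarg n,
    Measure.map_apply (by fun_prop) (measurableSet_singleton c)]
  refine measure_congr ?_
  filter_upwards [hGood] with x hx
  refine propext ?_
  have h1 := hΘ ⟨g x, hg x⟩ n
  have h2 : g x = x := if_pos hx
  change (ball (Φ x).graph (Φ x).root (n + 1)).Isomorphic c.rep ↔ x n = c
  have h3 : (ball (Φ x).graph (Φ x).root (n + 1)).Isomorphic (x n).rep := by
    have h4 : (ball (Φ x).graph (Φ x).root (n + 1)).Isomorphic (g x n).rep := h1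
    rwa [congrFun h2 n] at h4
  exact ⟨fun h => GraphClass.eq_of_isomorphic (h3.symm.trans h), fun h => h ▸ h3⟩

/-- If all the neighbourhood statistics of a sequence of finite trees converge, and the sizes of
the neighbourhoods are tight, then the limits are those of a random infinite rooted tree. -/
theorem exists_measure_of_tendsto_nbhdStat {l : Filter (Σ n, SimpleGraph (Fin (n + 1)))} [l.NeBot]
    (hn : Tendsto Sigma.fst l atTop) (hT : ∀ᶠ x in l, x.2.IsTree)
    (htight : ∀ R : ℕ, ∀ ε : ℝ, 0 < ε → ∃ M : ℕ, ∀ᶠ x in l,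
      ((bigBalls x.2 R M).ncard : ℝ) ≤ ε * (x.1 + 1 : ℕ))
    (hlim : ∀ R : ℕ, 0 < R → ∀ (m : ℕ) (F : RootedGraph (Fin m)),
      ∃ c, Tendsto (fun x => nbhdStat R F x.2) l (𝓝 c)) :
    ∃ ρ : Measure InfRootedTree, IsProbabilityMeasure ρ ∧ ∀ R : ℕ, 0 < R →
      ∀ (m : ℕ) (F : RootedGraph (Fin m)),
        Tendsto (fun x => nbhdStat R F x.2) l (𝓝 (ρ.real (nbhdEvent R F))) := by
  classical
  choose q hq using fun (n : ℕ) (c : GraphClass) => hlim (n + 1) n.succ_pos c.size c.rep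
  have hq0 : ∀ n c, 0 ≤ q n c := fun n c =>
    ge_of_tendsto (hq n c) (Eventually.of_forall fun x => nbhdStat_nonneg _ _ _)
  have hsum : ∀ n, HasSum (q n) 1 := by
    intro n
    refine hasSum_of_isLUB_of_nonneg _ (hq0 n) ⟨?_, ?_⟩
    · rintro _ ⟨S, rfl⟩
      exact le_of_tendsto (tendsto_finsetSum S fun c _ => hq n c)
        (Eventually.of_forall fun x => sum_nbhdStat_rep_le_one _ _ _)
    -- By tightness a finite set of classes carries all but `ε` of the vertices.
    · intro b hb
      refine le_of_forall_pos_sub_le fun ε hε => ?_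
      obtain ⟨M, hM⟩ := htight (n + 1) ε hε
      refine le_trans ?_ (hb ⟨(GraphClass.finite_size_le M).toFinset, rfl⟩)
      refine ge_of_tendsto (tendsto_finsetSum _ fun c _ => hq n c) ?_
      filter_upwards [hM] with x hx
      refine one_sub_le_sum_nbhdStat_rep (n + 1) M x.2 ?_
      rwa [Nat.card_eq_fintype_card, Fintype.card_fin]
  let p : ℕ → PMF GraphClass := fun n => ⟨fun c => ENNReal.ofReal (q n c), by
    have h1 := (ENNReal.summable (f := fun c => ENNReal.ofReal (q n c))).hasSum
    rwa [← ENNReal.ofReal_tsum_of_nonneg (hq0 n) (hsum n).summable, (hsum n).tsum_eq,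
      ENNReal.ofReal_one] at h1⟩
  have hp : ∀ n c, p n c = ENNReal.ofReal (q n c) := fun n c => rfl
  have hcomp : ∀ n, (p (n + 1)).map (GraphClass.trunc (n + 1)) = p n := by
    -- Finite sums pass to the limit and give one inequality, which suffices as both sides have
    -- total mass one.
    refine fun n => PMF_eq_of_le fun c => ?_
    rw [PMF.map_apply, ENNReal.tsum_eq_iSup_sum]
    refine iSup_le fun S => ?_
    have h1 : ∑ c' ∈ S with c'.trunc (n + 1) = c, q (n + 1) c' ≤ q n c := by
      refine le_of_tendsto_of_tendsto (tendsto_finsetSum _ fun c' _ => hq (n + 1) c') (hq n c)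
        (Eventually.of_forall fun x => ?_)
      exact sum_nbhdStat_rep_of_trunc_le (Nat.le_succ _) _ _ _ fun c' hc' =>
        (Finset.mem_filter.1 hc').2
    rw [hp]
    refine le_trans (le_of_eq ?_) (ENNReal.ofReal_le_ofReal h1)
    rw [ENNReal.ofReal_sum_of_nonneg fun c' _ => hq0 _ _, Finset.sum_filter]
    exact Finset.sum_congr rfl fun c' _ => if_congr eq_comm rfl rfl
  have hdeep : ∀ n c, p n c ≠ 0 → c.rep.IsDeepTree (n + 1) := by
    intro n c hc
    by_contra hne
    refine hc ?_
    rw [hp]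
    -- A ball isomorphic to the representative is not the whole tree once the tree has more
    -- vertices, so it must reach its boundary.
    have h1 : Tendsto (fun x : Σ n, SimpleGraph (Fin (n + 1)) => nbhdStat (n + 1) c.rep x.2) l
        (𝓝 0) := by
      refine tendsto_const_nhds.congr' ?_
      filter_upwards [hT, hn.eventually_ge_atTop c.size] with x hx hx'
      exact (nbhdStat_eq_zero_of_not_isDeepTree hx hne (Nat.lt_succ_of_le hx')).symm
    rw [tendsto_nhds_unique (hq n c) h1, ENNReal.ofReal_zero]
  obtain ⟨ρ, hρ, h⟩ := exists_measure_infRootedTree p hcomp hdeep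
  refine ⟨ρ, hρ, fun R hR m F => ?_⟩
  obtain ⟨n, rfl⟩ := Nat.exists_eq_succ_of_ne_zero hR.ne'
  have h1 := GraphClass.isomorphic_rep_of F
  have h2 : nbhdEvent (n + 1) F = nbhdEvent (n + 1) (GraphClass.of F).rep := by
    ext T
    exact ⟨fun h' => RootedGraph.Isomorphic.trans h' h1,
      fun h' => RootedGraph.Isomorphic.trans h' h1.symm⟩
  rw [Nat.succ_eq_add_one, h2, measureReal_def, h, hp, ENNReal.toReal_ofReal (hq0 _ _)]
  simp_rw [nbhdStat_congr h1]
  exact hq n _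

end LimitMeasure

/-! ### The two implications and the formula for the limit -/

section RandomLimits

variable {V : Type} {ν : ∀ n : ℕ, PMF (treeDegSeqs (n + 1))}

lemma limitValue_eq_limitProb (q : PMF ℕ) (R : ℕ) {m : ℕ} (F : RootedGraph (Fin m)) :
    limitValue (fun k => (q k).toReal) F R = limitProb q R F := by
  classical
  have h1 : ((F.inner R)ᶜ.card : ℝ) = ((F.level R).ncard : ℝ) := by
    rw [Set.ncard_eq_toFinset_card']
    congr 2
    ext i
    simp [RootedGraph.mem_inner]
  rw [limitValue, limitProb, h1, Finset.prod_mul_distrib, innerFactorial]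
  have h2 : (Finset.univ.filter fun i => i ∉ F.level R) = F.inner R := by
    ext i
    simp [RootedGraph.mem_inner]
  rw [h2]
  push_cast
  ring

/-- The neighbourhood statistics of the random trees when the proportions of the degrees converge to
a law with mean two. -/
theorem tendsto_nbhdStat_randomTree {q : ℕ → ℝ} (hq : ∀ k,
      Tendsto (fun x : Σ n, treeDegSeqs (n + 1) => freq k x.2.1) (whp ν) (𝓝 (q k)))
    (hmean : HasSum (fun k : ℕ => (k : ℝ) * q k) 2) {R m : ℕ} (hR : 0 < R) (F : RootedGraph (Fin m))
    (hF : F.IsDeepTree R) :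
    Tendsto (fun x : Σ n, SimpleGraph (Fin (n + 1)) => nbhdStat R F x.2)
      (whp fun n => randomTree (ν n)) (𝓝 (limitValue q F R)) := by
  classical
  have hn : Tendsto (fun x : Σ n, treeDegSeqs (n + 1) => x.1 + 1) (whp ν) atTop :=
    (tendsto_add_atTop_nat 1).comp (tendsto_fst_whp ν)
  have hUI := unifIntegrableAlong_of_hasSum (d := fun x : Σ n, treeDegSeqs (n + 1) => x.2.1)
    hn (fun x => x.2.2) hq hmean
  rw [Metric.tendsto_nhds]
  intro ε hε
  refine eventually_whp_randomTree_of_tendsto ?_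
  have h1 := ENNReal.tendsto_ofReal (tendsto_deviation hn (fun x => x.2.2) hq hUI hF hR
    (half_pos hε))
  rw [ENNReal.ofReal_zero] at h1
  refine tendsto_of_tendsto_of_tendsto_of_le_of_le tendsto_const_nhds h1 (fun _ => zero_le)
    fun x => ?_
  have h2 : 0 < (treeFinset x.2.1).card :=
    Finset.card_pos.2 (x.2.2.imp fun T hT => mem_treeFinset.2 hT)
  dsimp only
  rw [ENNReal.ofReal_div_of_pos (by exact_mod_cast h2), ENNReal.ofReal_natCast,
    ENNReal.ofReal_natCast, ← uniformTree_toOuterMeasure]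
  refine measure_mono fun T hT => ?_
  have h3 : ε ≤ |nbhdStat R F T - limitValue q F R| := not_lt.1 hT
  rw [nbhdStat, Nat.card_eq_fintype_card, Fintype.card_fin] at h3
  exact (half_lt_self hε).trans_le h3

lemma exists_tight_randomTree {q : ℕ → ℝ} (hq : ∀ k,
      Tendsto (fun x : Σ n, treeDegSeqs (n + 1) => freq k x.2.1) (whp ν) (𝓝 (q k)))
    (hmean : HasSum (fun k : ℕ => (k : ℝ) * q k) 2) (R : ℕ) {ε : ℝ} (hε : 0 < ε) :
    ∃ M : ℕ, ∀ᶠ x in whp fun n => randomTree (ν n),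
      ((bigBalls x.2 R M).ncard : ℝ) ≤ ε * (x.1 + 1 : ℕ) := by
  have hn : Tendsto (fun x : Σ n, treeDegSeqs (n + 1) => x.1 + 1) (whp ν) atTop :=
    (tendsto_add_atTop_nat 1).comp (tendsto_fst_whp ν)
  have hUI := unifIntegrableAlong_of_hasSum (d := fun x : Σ n, treeDegSeqs (n + 1) => x.2.1)
    hn (fun x => x.2.2) hq hmean
  obtain ⟨M, hM⟩ := tight_bigBalls hUI R ε hε
  refine ⟨M, eventually_whp_randomTree_of_tendsto (tendsto_const_nhds.congr' ?_)⟩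
  filter_upwards [hM] with x hx
  exact (uniformTree_toOuterMeasure_of_forall _ _ fun T hT => not_not.2 (hx T hT.2)).symm

/-- If the degree sequences converge to independent random variables with a law of mean two, then
the random trees have a random weak limit. -/
theorem exists_randomWeakLimit (hν : ∀ n, Exchangeable (ν n)) {q : PMF ℕ}
    (h : DegSeqTendsto ν (iidLaw q)) (hmean : mean q = 2) :
    ∃ ρ : Measure InfRootedTree, IsProbabilityMeasure ρ ∧
      RandomWeakLimit (fun n => randomTree (ν n)) ρ := by
  have hq := tendsto_freq_of_degSeqTendsto hν h
  have hm := (mean_eq_two_iff q).1 hmean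
  obtain ⟨ρ, hρ, hlim⟩ := exists_measure_of_tendsto_nbhdStat
    (tendsto_fst_whp fun n => randomTree (ν n)) eventually_whp_isTree
    (fun R ε hε => exists_tight_randomTree hq hm R hε) fun R hR m F => by
      by_cases hF : F.IsDeepTree R
      · exact ⟨_, tendsto_nbhdStat_randomTree hq hm hR F hF⟩
      · refine ⟨0, tendsto_const_nhds.congr' ?_⟩
        filter_upwards [eventually_whp_isTree,
          (tendsto_fst_whp fun n => randomTree (ν n)).eventually_ge_atTop m] with x hx hx'
        exact (nbhdStat_eq_zero_of_not_isDeepTree hx hF (Nat.lt_succ_of_le hx')).symm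
  exact ⟨ρ, hρ, randomWeakLimit_iff.2 hlim⟩

lemma InfRootedTree.finite_ball (T : InfRootedTree) (v R : ℕ) :
    {u | T.graph.edist v u ≤ R}.Finite := by
  induction R with
  | zero =>
    refine (Set.finite_singleton v).subset fun u hu => ?_
    simpa using hu
  | succ R ih =>
    refine (ih.union (ih.biUnion fun w _ => T.locallyFinite w)).subset fun u hu => ?_
    rcases (show T.graph.edist v u ≤ (R + 1 : ℕ) from hu).lt_or_eq with h | h
    · left
      exact ENat.lt_natCast_add_one_iff.1 (by exact_mod_cast h)
    · obtain ⟨w, hwu, hw⟩ := exists_adj_of_edist_eq_succ h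
      exact Or.inr (Set.mem_biUnion (show T.graph.edist v w ≤ R from hw.le) hwu)

lemma measurableSet_nbhdEvent (R m : ℕ) (F : RootedGraph (Fin m)) :
    MeasurableSet (nbhdEvent R F) :=
  MeasurableSpace.measurableSet_generateFrom ⟨R, m, F, rfl⟩

lemma hasSum_real_of_partition {Ω ι : Type} [MeasurableSpace Ω] [Countable ι] (ρ : Measure Ω)
    [IsProbabilityMeasure ρ] {E : ι → Set Ω} (hE : ∀ i, MeasurableSet (E i))
    (h : ∀ x, ∃! i, x ∈ E i) : HasSum (fun i => ρ.real (E i)) 1 := by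
  have h1 : ∑' i, ρ (E i) = 1 := by
    rw [← measure_iUnion _ hE, Set.iUnion_eq_univ_iff.2 fun x => (h x).exists, measure_univ]
    intro i j hij
    exact Set.disjoint_left.2 fun x hi hj => hij ((h x).unique hi hj)
  have h2 := ENNReal.hasSum_toReal (h1.trans_ne ENNReal.one_ne_top)
  rwa [← ENNReal.tsum_toReal_eq fun i => measure_ne_top _ _, h1, ENNReal.toReal_one] at h2

/-- Balls of a locally finite tree are finite, so their classes partition the space of trees. This
is the source of tightness in the converse direction. -/
lemma hasSum_nbhdEvent_rep (ρ : Measure InfRootedTree) [IsProbabilityMeasure ρ] (R : ℕ) :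
    HasSum (fun c : GraphClass => ρ.real (nbhdEvent R c.rep)) 1 := by
  refine hasSum_real_of_partition ρ (fun c => measurableSet_nbhdEvent _ _ _) fun T => ?_
  have : Finite {u // T.graph.edist T.root u ≤ R} := T.finite_ball T.root R
  exact ⟨GraphClass.of (ball T.graph T.root R), GraphClass.isomorphic_rep_of _,
    fun c hc => (GraphClass.of_eq_iff.2 hc).symm⟩

lemma hasSum_nbhdEvent_star (ρ : Measure InfRootedTree) [IsProbabilityMeasure ρ] :
    HasSum (fun k => ρ.real (nbhdEvent 1 (star k))) 1 := by
  refine hasSum_real_of_partition ρ (fun k => measurableSet_nbhdEvent _ _ _) fun T => ?_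
  have h := fun k => ball_isomorphic_star_iff T.isTree (T.locallyFinite T.root) k
  exact ⟨deg T.graph T.root, (h _).2 rfl, fun k hk => ((h k).1 hk).symm⟩

lemma ncard_bigBalls_le [Finite V] [Nonempty V] {R M : ℕ} {G : SimpleGraph V}
    {S : Finset GraphClass} (hS : ∀ c ∈ S, c.size ≤ M) {ε : ℝ}
    (h : 1 - ε ≤ ∑ c ∈ S, nbhdStat R c.rep G) :
    ((bigBalls G R M).ncard : ℝ) ≤ ε * Nat.card V := by
  classical
  have := Fintype.ofFinite V
  rw [sum_nbhdStat_rep, le_div_iff₀ (by exact_mod_cast Nat.card_pos), sub_mul, one_mul] at h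
  have h1 : (Finset.univ.filter fun v => GraphClass.of (ball G v R) ∈ S).card +
      (bigBalls G R M).ncard ≤ Nat.card V := by
    rw [Set.ncard_eq_toFinset_card', ← Finset.card_union_of_disjoint, Nat.card_eq_fintype_card]
    · exact Finset.card_le_univ _
    · rw [Finset.disjoint_left]
      intro v hv hv'
      have h2 := hS _ (Finset.mem_filter.1 hv).2
      have h3 := (GraphClass.isomorphic_rep_of (ball G v R)).card_eq
      rw [Nat.card_eq_fintype_card (α := Fin _), Fintype.card_fin] at h3
      rw [← h3] at h2
      have h4 : v ∈ bigBalls G R M := Set.mem_toFinset.1 hv'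
      exact absurd h2 (not_le.2 h4)
  have h2 := (Nat.cast_le (α := ℝ)).2 h1
  push_cast at h2
  linarith

/-- If the random trees have a random weak limit, then the degree sequences converge to independent
random variables with a law of mean two. -/
theorem exists_degSeqTendsto (hν : ∀ n, Exchangeable (ν n)) {ρ : Measure InfRootedTree}
    [IsProbabilityMeasure ρ] (h : RandomWeakLimit (fun n => randomTree (ν n)) ρ) :
    ∃ q : PMF ℕ, DegSeqTendsto ν (iidLaw q) ∧ mean q = 2 := by
  rw [randomWeakLimit_iff] at h
  have hsum := hasSum_nbhdEvent_star ρ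
  have hq0 : ∀ k, 0 ≤ ρ.real (nbhdEvent 1 (star k)) := fun k => measureReal_nonneg
  let q : PMF ℕ := ⟨fun k => ENNReal.ofReal (ρ.real (nbhdEvent 1 (star k))), by
    have h1 := (ENNReal.summable
      (f := fun k => ENNReal.ofReal (ρ.real (nbhdEvent 1 (star k))))).hasSum
    rwa [← ENNReal.ofReal_tsum_of_nonneg hq0 hsum.summable, hsum.tsum_eq,
      ENNReal.ofReal_one] at h1⟩
  have hq : ∀ k, (q k).toReal = ρ.real (nbhdEvent 1 (star k)) := fun k =>
    ENNReal.toReal_ofReal (hq0 k)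
  have hfreq : ∀ k, Tendsto (fun x : Σ n, treeDegSeqs (n + 1) => freq k x.2.1) (whp ν)
      (𝓝 (q k).toReal) := by
    intro k
    rw [← tendsto_whp_randomTree_deg_iff (f := fun n d => freq k d), hq]
    refine (h 1 one_pos _ (star k)).congr' ?_
    filter_upwards [eventually_whp_isTree] with x hx
    exact nbhdStat_star hx k
  refine ⟨q, degSeqTendsto_of_tendsto_freq hν hfreq, (mean_eq_two_iff q).2 ?_⟩
  refine hasSum_of_unifIntegrableAlong (l := whp ν)
    (d := fun x : Σ n, treeDegSeqs (n + 1) => x.2.1)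
    ((tendsto_add_atTop_nat 1).comp (tendsto_fst_whp ν)) (fun x => x.2.2)
    (fun k => ENNReal.toReal_nonneg) hfreq ?_
  intro ε hε
  -- Radius two and `ε / 2` are dictated by `tailSum_le_bigBalls`, which loses a factor two and also
  -- needs `M ≥ 1`.
  obtain ⟨S, hS⟩ := ((hasSum_nbhdEvent_rep ρ 2).eventually_const_lt
    (show 1 - ε / 2 < 1 by linarith)).exists
  let M := max 1 (S.sup GraphClass.size)
  refine ⟨M, ?_⟩
  rw [← eventually_whp_randomTree_deg_iff
    (P := fun n d => (tailSum d M : ℝ) ≤ ε * (n + 1 : ℕ))]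
  filter_upwards [(tendsto_finsetSum S fun c _ => h 2 two_pos _ c.rep).eventually_const_lt hS,
    eventually_whp_isTree] with x hx hT
  have h1 := ncard_bigBalls_le (M := M)
    (fun c hc => (Finset.le_sup (f := GraphClass.size) hc).trans (le_max_right _ _)) hx.le
  have h2 := (Nat.cast_le (α := ℝ)).2 (tailSum_le_bigBalls hT (le_max_left 1 _ : 1 ≤ M))
  rw [Nat.card_eq_fintype_card, Fintype.card_fin] at h1
  push_cast at h1 h2 ⊢
  linarith

/-- The law of the neighbourhoods of the root in the random weak limit. -/
theorem real_nbhdEvent_eq_limitProb (hν : ∀ n, Exchangeable (ν n)) {q : PMF ℕ}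
    {ρ : Measure InfRootedTree} (h : DegSeqTendsto ν (iidLaw q)) (hmean : mean q = 2)
    (hlim : RandomWeakLimit (fun n => randomTree (ν n)) ρ) {R m : ℕ} (hR : 0 < R)
    {F : RootedGraph (Fin m)} (hF : F.IsDeepTree R) :
    ρ.real (nbhdEvent R F) = limitProb q R F := by
  rw [← limitValue_eq_limitProb]
  exact tendsto_nhds_unique (randomWeakLimit_iff.1 hlim R hR m F)
    (tendsto_nbhdStat_randomTree (tendsto_freq_of_degSeqTendsto hν h)
      ((mean_eq_two_iff q).1 hmean) hR F hF)

end RandomLimits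

end RandomTreeLimit

end

theorem mainTheorem1
    (ν : ∀ n : ℕ, PMF (treeDegSeqs (n + 1)))
    (hν : ∀ n, Exchangeable (ν n)) :
    ((∃ ρ : Measure InfRootedTree, IsProbabilityMeasure ρ ∧
        RandomWeakLimit (fun n => randomTree (ν n)) ρ) ↔
      ∃ q : PMF ℕ, DegSeqTendsto ν (iidLaw q) ∧ mean q = 2) ∧
    (∀ (q : PMF ℕ) (ρ : Measure InfRootedTree), IsProbabilityMeasure ρ →
      DegSeqTendsto ν (iidLaw q) → mean q = 2 →
      RandomWeakLimit (fun n => randomTree (ν n)) ρ →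
      ∀ (R : ℕ), 0 < R → ∀ (m : ℕ) (F : RootedGraph (Fin m)), F.IsDeepTree R →
        ρ.real (nbhdEvent R F) = limitProb q R F) := by
  exact ⟨⟨fun ⟨_, _, h⟩ => exists_degSeqTendsto hν h,
    fun ⟨_, h, hmean⟩ => exists_randomWeakLimit hν h hmean⟩,
    fun _ _ _ h hmean hlim _ hR _ _ hF => real_nbhdEvent_eq_limitProb hν h hmean hlim hR hF⟩
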